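/- **Setting.** Let $\mathbb k$ be a field of characteristic $0$. A *superfield algebra* is an associative, $\mathbb Z/2$-graded, supercommutative $\mathbb k$-algebra $A$ without unit, with an invertible odd superderivation $\mathcal D$ (playing the role of $\partial_\theta+\theta\,\partial_x$; invertibility means that integration constants are normalised to zero, as for superfields decaying exponentially as $x\to-\infty$). Super-pseudo-differential operators are series $\sum_{j\le N}a_jD^j$ with coefficients in $\mathbb k\oplus A$ and $D\,a=\mathcal D(a)+(-1)^{|a|}aD$; $P_+$ and $P_-$ are the parts with $j\ge 0$ and $j<0$; a flow acts on an operator coefficientwise. $P(g)$ denotes the application of $P$ to $g\in A$ (with $D^{-1}$ acting as $\mathcal D^{-1}$). Conjugation is given by $(PQ)^*=(-1)^{|P||Q|}Q^*P^*$, $D^*=-D$, $(D^{-1})^*=D^{-1}$, $a^*=a$. A bosonic (fermionic) flow is an even (odd) superderivation of $A$ that commutes (anticommutes) with $\mathcal D$. For bosonic $\Phi_0,\Psi_0\in A$ let $f_0=-2\mathcal D^{-1}(\Phi_0\Psi_0)$, i.e. $\mathcal D f_0+2\Phi_0\Psi_0=0$, let $$L=D+f_0+\Phi_0D^{-1}\Psi_0,$$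 and for $n\ge1$ let $$X^{(2n-1)}=2\sum_{l=0}^{n-2}L^{2(n-l)-3}(\Phi_0)\,D^{-1}\,(L^{2l+1})^*(\Psi_0).$$ The bosonic flows are, for $l\ge1$, $$\tfrac{\partial}{\partial t_l}L=-[L^{2l}_-,L]=[L^{2l}_+,L],\qquad \tfrac{\partial}{\partial t_l}\Phi_0=L^{2l}_+(\Phi_0),\qquad \tfrac{\partial}{\partial t_l}\Psi_0=-(L^{2l})^*_+(\Psi_0).$$ **Proposition.** The following modification of the fermionic flows $D_n$ $(n\ge 1)$ is consistent: $$D_nL=-\{L^{2n-1}_--X^{(2n-1)},L\}=\{L^{2n-1}_+,L\}+\{X^{(2n-1)},L\}-2L^{2n},\tag{1}$$ $$D_n\Phi_0=L^{2n-1}_+(\Phi_0)-2L^{2n-1}(\Phi_0)+X^{(2n-1)}(\Phi_0),\tag{2}$$ $$D_n\Psi_0=-(L^{2n-1})^*_+(\Psi_0)+2(L^{2n-1})^*(\Psi_0)-(X^{(2n-1)})^*(\Psi_0),\tag{3}$$ and the modified flows obey, for all $k,l\ge1$, the algebra of the unconstrained hierarchy $$\{D_k,D_l\}=-2\,\tfrac{\partial}{\partial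 t_{k+l-1}},\qquad \big[\tfrac{\partial}{\partial t_k},D_l\big]=0,\qquad \big[\tfrac{\partial}{\partial t_k},\tfrac{\partial}{\partial t_l}\big]=0 .\tag{4}$$ Precisely: (i) on the free superfield algebra on two bosonic generators $\Phi_0,\Psi_0$ there exist bosonic flows $\partial/\partial t_l$ and fermionic flows $D_n$ that satisfy all the bosonic flow equations, (1), (2), (3), and that satisfy (4) on the whole algebra; (ii) on every superfield algebra with bosonic elements $\Phi_0,\Psi_0$, any bosonic flows $\partial/\partial t_l$ with the prescribed action on $\Phi_0,\Psi_0$ and any fermionic flows $D_n$ satisfying (2) and (3) satisfy also the bosonic Lax equations and (1), and satisfy (4) on $\Phi_0$, $\Psi_0$ and $f_0$. -/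

import Mathlib

namespace SKP

universe u v

/-! ### Algebras of superfields -/

/-- An algebra of superfields over the field `𝕜`: an associative, supercommutative algebra without
unit, with its grading involution (`a ↦ a` for bosonic, `a ↦ -a` for fermionic `a`) and an odd
superderivation `𝒟` (the action of `∂/∂θ + θ ∂` on superfields) which is invertible, so that `𝒟⁻¹`
is defined and the constants of integration are zero. (Example: superfields that decay
exponentially as `x → -∞`, with all their derivatives.) There is no unit because `𝒟 1 = 0`; see `Coef` for the constants. -/
class SuperfieldAlgebra (𝕜 : Type u) (A : Type v) [Field 𝕜] [NonUnitalRing A] [Module 𝕜 A] where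
  /-- the grading involution `a ↦ (-1)^|a| a` -/
  grading : A →ₗ[𝕜] A
  par_par : ∀ a, grading (grading a) = a
  par_mul : ∀ a b, grading (a * b) = grading a * grading b
  /-- bosonic elements commute with everything -/
  even_comm : ∀ a b, grading a = a → a * b = b * a
  /-- fermionic elements anticommute with each other -/
  odd_comm : ∀ a b, grading a = -a → grading b = -b → a * b = -(b * a)
  /-- the invertible odd superderivation `𝒟_θ` -/
  der : A ≃ₗ[𝕜] A
  par_D : ∀ a, grading (der a) = -der (grading a)
  D_mul : ∀ a b, der (a * b) = der a * b + grading a * der b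

section

variable (𝕜 : Type u) {A : Type v} [Field 𝕜] [NonUnitalRing A] [Module 𝕜 A]
  [SuperfieldAlgebra 𝕜 A]

/-- The grading involution `a ↦ (-1)^|a| a`. -/
abbrev par : A →ₗ[𝕜] A := SuperfieldAlgebra.grading

/-- The action `𝒟_θ` of `𝒟` on superfields. -/
abbrev D : A ≃ₗ[𝕜] A := SuperfieldAlgebra.der

end

/-! ### Flows -/

section Flows

variable (𝕜 : Type u) (A : Type v) [Field 𝕜] [NonUnitalRing A] [Module 𝕜 A]
  [SuperfieldAlgebra 𝕜 A]

/-- A bosonic (evolutionary) flow: an even derivation commuting with `𝒟`. -/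
structure EvenFlow where
  toLin : A →ₗ[𝕜] A
  par_comm : ∀ a, par 𝕜 (toLin a) = toLin (par 𝕜 a)
  leibniz : ∀ a b, toLin (a * b) = toLin a * b + a * toLin b
  D_comm : ∀ a, toLin (D 𝕜 a) = D 𝕜 (toLin a)

/-- A fermionic (evolutionary) flow: an odd superderivation anticommuting with `𝒟`. -/
structure OddFlow where
  toLin : A →ₗ[𝕜] A
  par_comm : ∀ a, par 𝕜 (toLin a) = -toLin (par 𝕜 a)
  leibniz : ∀ a b, toLin (a * b) = toLin a * b + par 𝕜 a * toLin b
  D_anticomm : ∀ a, toLin (D 𝕜 a) = -D 𝕜 (toLin a)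

instance : CoeFun (EvenFlow 𝕜 A) (fun _ => A → A) := ⟨fun T => T.toLin⟩
instance : CoeFun (OddFlow 𝕜 A) (fun _ => A → A) := ⟨fun T => T.toLin⟩

end Flows

/-! ### Super-pseudo-differential operators as formal series -/

section SPDO

variable (𝕜 : Type u) (A : Type v) [Field 𝕜] [NonUnitalRing A] [Module 𝕜 A]
  [IsScalarTower 𝕜 A A] [SMulCommClass 𝕜 A A]

/-- Coefficients of operators: constants plus superfields. -/
abbrev Coef := Unitization 𝕜 A

variable {𝕜 A}

/-- A linear map on superfields, extended to the constants by `0`. -/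
noncomputable def ext (φ : A →ₗ[𝕜] A) : Coef 𝕜 A →ₗ[𝕜] Coef 𝕜 A :=
  Unitization.inrHom 𝕜 𝕜 A ∘ₗ φ ∘ₗ Unitization.sndHom 𝕜 𝕜 A

/-- The action of `𝒟` on coefficients (`𝒟 1 = 0`). -/
noncomputable def cD [SuperfieldAlgebra 𝕜 A] : Coef 𝕜 A →ₗ[𝕜] Coef 𝕜 A :=
  ext (D 𝕜 : A ≃ₗ[𝕜] A).toLinearMap

/-- The grading involution on coefficients (constants are bosonic). -/
noncomputable def cpar [SuperfieldAlgebra 𝕜 A] : Coef 𝕜 A →ₗ[𝕜] Coef 𝕜 A :=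
  (Algebra.linearMap 𝕜 (Coef 𝕜 A)) ∘ₗ (Unitization.fstHom 𝕜 A).toLinearMap + ext (par 𝕜)

/-- The `n`-th power of the grading involution, `c ↦ (-1)^(n |c|) c`. -/
noncomputable def cparPow [SuperfieldAlgebra 𝕜 A] (n : ℤ) : Coef 𝕜 A →ₗ[𝕜] Coef 𝕜 A :=
  if Even n then LinearMap.id else cpar

/-- The superbinomial coefficients, for which
`𝒟^n ∘ c = ∑_{k ≥ 0} superBinom n k (-1)^(|c| (n - k)) (𝒟^k c) 𝒟^(n - k)` for all integers `n`. -/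
def superBinom (n : ℤ) (k : ℕ) : ℤ :=
  if Even n ∧ Odd k then 0 else Ring.choose (n / 2) (k / 2)

variable (𝕜 A) in
/-- The additive group of sequences `(c_j)_{j ∈ ℤ}` that vanish for all large `j`. -/
def boundedAbove : AddSubgroup (ℤ → Coef 𝕜 A) where
  carrier := {P | ∃ N : ℤ, ∀ n, N < n → P n = 0}
  zero_mem' := ⟨0, fun _ _ => rfl⟩
  add_mem' := by
    rintro P Q ⟨M, hM⟩ ⟨N, hN⟩
    refine ⟨max M N, fun n hn => ?_⟩
    simp [hM n (lt_of_le_of_lt (le_max_left _ _) hn), hN n (lt_of_le_of_lt (le_max_right _ _) hn)]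
  neg_mem' := by
    rintro P ⟨M, hM⟩
    exact ⟨M, fun n hn => by simp [hM n hn]⟩

variable (𝕜 A) in
/-- Super-pseudo-differential operators `∑_j c_j 𝒟^j`, with `j` bounded above. -/
def SPDO : Type (max u v) := boundedAbove 𝕜 A

namespace SPDO

noncomputable instance : AddCommGroup (SPDO 𝕜 A) :=
  inferInstanceAs (AddCommGroup (boundedAbove 𝕜 A))

/-- The coefficient of `𝒟^n`. -/
def coeff (P : SPDO 𝕜 A) (n : ℤ) : Coef 𝕜 A := P.1 n

/-- The operator `c 𝒟^n`. -/
noncomputable def single (n : ℤ) (c : Coef 𝕜 A) : SPDO 𝕜 A :=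
  ⟨fun m => if m = n then c else 0, n, fun m hm => by simp [hm.ne']⟩

/-- The purely differential part `(·)₊`. -/
noncomputable def plus (P : SPDO 𝕜 A) : SPDO 𝕜 A :=
  ⟨fun n => if 0 ≤ n then P.coeff n else 0, by
    obtain ⟨N, hN⟩ := P.2
    exact ⟨N, fun n hn => by simp [coeff, hN n hn]⟩⟩

/-- The purely pseudo-differential part `(·)₋`. -/
noncomputable def minus (P : SPDO 𝕜 A) : SPDO 𝕜 A :=
  ⟨fun n => if n < 0 then P.coeff n else 0, by
    obtain ⟨N, hN⟩ := P.2
    exact ⟨N, fun n hn => by simp [coeff, hN n hn]⟩⟩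

/-- Apply a linear map of superfields to every coefficient (constants are annihilated); this is
how a flow acts on an operator. -/
noncomputable def mapCoeff (φ : A →ₗ[𝕜] A) (P : SPDO 𝕜 A) : SPDO 𝕜 A :=
  ⟨fun n => ext φ (P.coeff n), by
    obtain ⟨N, hN⟩ := P.2
    exact ⟨N, fun n hn => by simp [coeff, hN n hn]⟩⟩

variable [SuperfieldAlgebra 𝕜 A]

/-- The operator product. -/
noncomputable instance : Mul (SPDO 𝕜 A) where
  mul P Q := ⟨fun m => ∑ᶠ p : ℤ × ℕ, P.coeff p.1 *
      (superBinom p.1 p.2 • (cD^[p.2] (cparPow (p.1 - p.2) (Q.coeff (m - p.1 + p.2))))), by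
    obtain ⟨M, hM⟩ := P.2
    obtain ⟨N, hN⟩ := Q.2
    refine ⟨M + N, fun m hm => ?_⟩
    have h : ∀ p : ℤ × ℕ, P.coeff p.1 *
        (superBinom p.1 p.2 • (cD^[p.2] (cparPow (p.1 - p.2) (Q.coeff (m - p.1 + p.2))))) = 0 := by
      intro p
      by_cases hp : M < p.1
      · have h0 : P.coeff p.1 = 0 := hM _ hp
        rw [h0, zero_mul]
      · have h0 : Q.coeff (m - p.1 + p.2) = 0 := hN _ (by omega)
        rw [h0, map_zero, iterate_map_zero, smul_zero, mul_zero]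
    simp only [h, finsum_zero]⟩

/-- The commutator of two operators. -/
noncomputable def comm (P Q : SPDO 𝕜 A) : SPDO 𝕜 A := P * Q - Q * P

/-- The anticommutator of two operators. -/
noncomputable def anticomm (P Q : SPDO 𝕜 A) : SPDO 𝕜 A := P * Q + Q * P

/-- The result `P₊(g)` of applying the purely differential part of `P` to the superfield `g`. -/
noncomputable def applyPlus (P : SPDO 𝕜 A) (g : A) : Coef 𝕜 A :=
  ∑ᶠ j : ℕ, P.coeff j * cD^[j] (Unitization.inr g)

end SPDO

end SPDO

/-! ### Operators built from `𝒟`, `𝒟⁻¹` and superfields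

Such an operator can be expanded into a formal series, applied to superfields and conjugated. -/

/-- Operator expressions. In `fn p a` the operator is multiplication by the superfield `a`, whose
parity is `p`. -/
inductive SOp (A : Type v) : Type v
  | zero : SOp A
  | one : SOp A
  | D : SOp A
  | Dinv : SOp A
  | fn (p : ZMod 2) (a : A) : SOp A
  | add (P Q : SOp A) : SOp A
  | smul (c : ℤ) (P : SOp A) : SOp A
  | comp (P Q : SOp A) : SOp A

namespace SOp

section Expressions

variable {A : Type v}

/-- The grading `|P|` (all sums in use are sums of terms of equal parity). -/
def parity : SOp A → ZMod 2
  | zero => 0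
  | one => 0
  | D => 1
  | Dinv => 1
  | fn p _ => p
  | add P _ => P.parity
  | smul _ P => P.parity
  | comp P Q => P.parity + Q.parity

/-- Conjugation: `(P Q)^* = (-1)^(|P| |Q|) Q^* P^*`, `𝒟^* = -𝒟`, `(𝒟⁻¹)^* = 𝒟⁻¹`, `a^* = a`. -/
def adj : SOp A → SOp A
  | zero => zero
  | one => one
  | D => smul (-1) D
  | Dinv => Dinv
  | fn p a => fn p a
  | add P Q => add P.adj Q.adj
  | smul c P => smul c P.adj
  | comp P Q => smul (if P.parity = 1 ∧ Q.parity = 1 then -1 else 1) (comp Q.adj P.adj)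

/-- Powers of an operator. -/
def pow (P : SOp A) : ℕ → SOp A
  | 0 => one
  | n + 1 => comp P (pow P n)

/-- Finite sums of operators. -/
def sum (l : List (SOp A)) : SOp A := l.foldr add zero

end Expressions

variable (𝕜 : Type u) {A : Type v} [Field 𝕜] [NonUnitalRing A] [Module 𝕜 A]
  [SuperfieldAlgebra 𝕜 A]

/-- The action `P(g)` on a superfield `g`. -/
noncomputable def apply : SOp A → A → A
  | zero, _ => 0
  | one, g => g
  | D, g => SKP.D 𝕜 g
  | Dinv, g => (SKP.D 𝕜).symm g
  | fn _ a, g => a * g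
  | add P Q, g => P.apply g + Q.apply g
  | smul c P, g => c • P.apply g
  | comp P Q, g => P.apply (Q.apply g)

variable [IsScalarTower 𝕜 A A] [SMulCommClass 𝕜 A A]

/-- The expansion of `P` as a formal series in powers of `𝒟`. -/
noncomputable def toSPDO : SOp A → SPDO 𝕜 A
  | zero => 0
  | one => SPDO.single 0 1
  | D => SPDO.single 1 1
  | Dinv => SPDO.single (-1) 1
  | fn _ a => SPDO.single 0 (Unitization.inr a)
  | add P Q => P.toSPDO + Q.toSPDO
  | smul c P => c • P.toSPDO
  | comp P Q => P.toSPDO * Q.toSPDO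

end SOp

/-! ### The constrained hierarchy -/

section Hierarchy

variable (𝕜 : Type u) {A : Type v} [Field 𝕜] [NonUnitalRing A] [Module 𝕜 A]
  [SuperfieldAlgebra 𝕜 A] (Φ Ψ : A)

/-- The fermionic superfield `f₀`, fixed by the vanishing `𝒟 f₀ + 2 Φ₀ Ψ₀ = 0` of the zero-order
term of `L²`. -/
noncomputable def f0 : A := -(2 : ℤ) • (D 𝕜).symm (Φ * Ψ)

/-- The Lax operator `L = 𝒟 + f₀ + Φ₀ 𝒟⁻¹ Ψ₀`, with bosonic `Φ₀`, `Ψ₀`. -/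
noncomputable def L : SOp A :=
  .add (.add .D (.fn 1 (f0 𝕜 Φ Ψ))) (.comp (.fn 0 Φ) (.comp .Dinv (.fn 0 Ψ)))

/-- `L^k(Φ₀)`, of parity `k`. -/
noncomputable def LΦ (k : ℕ) : A := ((L 𝕜 Φ Ψ).pow k).apply 𝕜 Φ

/-- `(L^k)^*(Ψ₀)`, of parity `k`. -/
noncomputable def LΨ (k : ℕ) : A := ((L 𝕜 Φ Ψ).pow k).adj.apply 𝕜 Ψ

/-- `X^(2n-1) = 2 ∑_{l=0}^{n-2} L^(2(n-l)-3)(Φ₀) 𝒟⁻¹ (L^(2l+1))^*(Ψ₀)`, for `n ≥ 1`. -/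
noncomputable def X (n : ℕ) : SOp A :=
  .smul 2 (.sum ((List.range (n - 1)).map fun l =>
    .comp (.fn 1 (LΦ 𝕜 Φ Ψ (2 * (n - l) - 3))) (.comp .Dinv (.fn 1 (LΨ 𝕜 Φ Ψ (2 * l + 1))))))

variable [IsScalarTower 𝕜 A A] [SMulCommClass 𝕜 A A]

/-- The formal series of `L^k`. -/
noncomputable def Lpow (k : ℕ) : SPDO 𝕜 A := ((L 𝕜 Φ Ψ).pow k).toSPDO 𝕜

/-- The formal series of `(L^k)^*`. -/
noncomputable def LpowAdj (k : ℕ) : SPDO 𝕜 A := ((L 𝕜 Φ Ψ).pow k).adj.toSPDO 𝕜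

/-- The bosonic Lax equation `∂L/∂t_l = -[(L^(2l))₋, L] = [(L^(2l))₊, L]`. -/
def EvenLax (l : ℕ) (T : EvenFlow 𝕜 A) : Prop :=
  SPDO.mapCoeff T.toLin (Lpow 𝕜 Φ Ψ 1) = -SPDO.comm (Lpow 𝕜 Φ Ψ (2 * l)).minus (Lpow 𝕜 Φ Ψ 1) ∧
  SPDO.mapCoeff T.toLin (Lpow 𝕜 Φ Ψ 1) = SPDO.comm (Lpow 𝕜 Φ Ψ (2 * l)).plus (Lpow 𝕜 Φ Ψ 1)

/-- The bosonic flow of the pair: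
`∂Φ₀/∂t_l = (L^(2l))₊(Φ₀)` and `∂Ψ₀/∂t_l = -(L^(2l))^*₊(Ψ₀)`. -/
def EvenPair (l : ℕ) (T : EvenFlow 𝕜 A) : Prop :=
  Unitization.inr (T Φ) = (Lpow 𝕜 Φ Ψ (2 * l)).applyPlus Φ ∧
  Unitization.inr (T Ψ) = -(LpowAdj 𝕜 Φ Ψ (2 * l)).applyPlus Ψ

/-- The modified fermionic Lax equation
`D_n L = -{(L^(2n-1))₋ - X^(2n-1), L} = {(L^(2n-1))₊, L} + {X^(2n-1), L} - 2 L^(2n)`. -/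
def OddLax (n : ℕ) (T : OddFlow 𝕜 A) : Prop :=
  SPDO.mapCoeff T.toLin (Lpow 𝕜 Φ Ψ 1) =
    -SPDO.anticomm ((Lpow 𝕜 Φ Ψ (2 * n - 1)).minus - (X 𝕜 Φ Ψ n).toSPDO 𝕜) (Lpow 𝕜 Φ Ψ 1) ∧
  SPDO.mapCoeff T.toLin (Lpow 𝕜 Φ Ψ 1) =
    SPDO.anticomm (Lpow 𝕜 Φ Ψ (2 * n - 1)).plus (Lpow 𝕜 Φ Ψ 1) +
      SPDO.anticomm ((X 𝕜 Φ Ψ n).toSPDO 𝕜) (Lpow 𝕜 Φ Ψ 1) - (2 : ℤ) • Lpow 𝕜 Φ Ψ (2 * n)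

/-- The modified fermionic flow of the pair:
`D_n Φ₀ = (L^(2n-1))₊(Φ₀) - 2 L^(2n-1)(Φ₀) + X^(2n-1)(Φ₀)` and
`D_n Ψ₀ = -(L^(2n-1))^*₊(Ψ₀) + 2 (L^(2n-1))^*(Ψ₀) - (X^(2n-1))^*(Ψ₀)`. -/
def OddPair (n : ℕ) (T : OddFlow 𝕜 A) : Prop :=
  Unitization.inr (T Φ) = (Lpow 𝕜 Φ Ψ (2 * n - 1)).applyPlus Φ -
    (2 : ℤ) • Unitization.inr (LΦ 𝕜 Φ Ψ (2 * n - 1)) + Unitization.inr ((X 𝕜 Φ Ψ n).apply 𝕜 Φ) ∧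
  Unitization.inr (T Ψ) = -(LpowAdj 𝕜 Φ Ψ (2 * n - 1)).applyPlus Ψ +
    (2 : ℤ) • Unitization.inr (LΨ 𝕜 Φ Ψ (2 * n - 1)) - Unitization.inr ((X 𝕜 Φ Ψ n).adj.apply 𝕜 Ψ)

variable {𝕜} in
/-- At the superfield `g`, the flows satisfy `{D_k, D_l} = -2 ∂/∂t_(k+l-1)`,
`[∂/∂t_k, D_l] = 0` and `[∂/∂t_k, ∂/∂t_l] = 0` for all `k, l ≥ 1`. -/
def FlowAlgebraAt (T : ℕ → EvenFlow 𝕜 A) (δ : ℕ → OddFlow 𝕜 A) (g : A) : Prop :=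
  ∀ k l : ℕ, 1 ≤ k → 1 ≤ l →
    δ k (δ l g) + δ l (δ k g) = -((2 : ℤ) • T (k + l - 1) g) ∧
    T k (δ l g) = δ l (T k g) ∧
    T k (T l g) = T l (T k g)

end Hierarchy

/-! ### The free superfield algebra on two bosonic generators -/

/-- Formal expressions in two generators. -/
inductive Term (𝕜 : Type u) : Type u
  | Φ : Term 𝕜
  | Ψ : Term 𝕜
  | zero : Term 𝕜
  | add (a b : Term 𝕜) : Term 𝕜
  | smul (c : 𝕜) (a : Term 𝕜) : Term 𝕜
  | mul (a b : Term 𝕜) : Term 𝕜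
  | par (a : Term 𝕜) : Term 𝕜
  | D (a : Term 𝕜) : Term 𝕜
  | Dinv (a : Term 𝕜) : Term 𝕜

/-- The smallest congruence which imposes the laws of a superfield algebra and makes both
generators bosonic. -/
inductive Term.Rel (𝕜 : Type u) [Field 𝕜] : Term 𝕜 → Term 𝕜 → Prop
  | refl (a) : Term.Rel 𝕜 a a
  | symm {a b} : Term.Rel 𝕜 a b → Term.Rel 𝕜 b a
  | trans {a b c} : Term.Rel 𝕜 a b → Term.Rel 𝕜 b c → Term.Rel 𝕜 a c
  | congr_add {a a' b b'} : Term.Rel 𝕜 a a' → Term.Rel 𝕜 b b' →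
      Term.Rel 𝕜 (.add a b) (.add a' b')
  | congr_smul (c : 𝕜) {a a'} : Term.Rel 𝕜 a a' → Term.Rel 𝕜 (.smul c a) (.smul c a')
  | congr_mul {a a' b b'} : Term.Rel 𝕜 a a' → Term.Rel 𝕜 b b' →
      Term.Rel 𝕜 (.mul a b) (.mul a' b')
  | congr_par {a a'} : Term.Rel 𝕜 a a' → Term.Rel 𝕜 (.par a) (.par a')
  | congr_D {a a'} : Term.Rel 𝕜 a a' → Term.Rel 𝕜 (.D a) (.D a')
  | congr_Dinv {a a'} : Term.Rel 𝕜 a a' → Term.Rel 𝕜 (.Dinv a) (.Dinv a')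
  | add_assoc (a b c) : Term.Rel 𝕜 (.add (.add a b) c) (.add a (.add b c))
  | add_comm (a b) : Term.Rel 𝕜 (.add a b) (.add b a)
  | zero_add (a) : Term.Rel 𝕜 (.add .zero a) a
  | neg_add (a) : Term.Rel 𝕜 (.add (.smul (-1) a) a) .zero
  | one_smul (a) : Term.Rel 𝕜 (.smul 1 a) a
  | mul_smul (c d : 𝕜) (a) : Term.Rel 𝕜 (.smul (c * d) a) (.smul c (.smul d a))
  | add_smul (c d : 𝕜) (a) : Term.Rel 𝕜 (.smul (c + d) a) (.add (.smul c a) (.smul d a))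
  | zero_smul (a) : Term.Rel 𝕜 (.smul 0 a) .zero
  | smul_add (c : 𝕜) (a b) : Term.Rel 𝕜 (.smul c (.add a b)) (.add (.smul c a) (.smul c b))
  | smul_zero (c : 𝕜) : Term.Rel 𝕜 (.smul c .zero) .zero
  | mul_assoc (a b c) : Term.Rel 𝕜 (.mul (.mul a b) c) (.mul a (.mul b c))
  | left_distrib (a b c) : Term.Rel 𝕜 (.mul a (.add b c)) (.add (.mul a b) (.mul a c))
  | right_distrib (a b c) : Term.Rel 𝕜 (.mul (.add a b) c) (.add (.mul a c) (.mul b c))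
  | zero_mul (a) : Term.Rel 𝕜 (.mul .zero a) .zero
  | mul_zero (a) : Term.Rel 𝕜 (.mul a .zero) .zero
  | smul_mul (c : 𝕜) (a b) : Term.Rel 𝕜 (.mul (.smul c a) b) (.smul c (.mul a b))
  | mul_smul' (c : 𝕜) (a b) : Term.Rel 𝕜 (.mul a (.smul c b)) (.smul c (.mul a b))
  | par_Φ : Term.Rel 𝕜 (.par .Φ) .Φ
  | par_Ψ : Term.Rel 𝕜 (.par .Ψ) .Ψ
  | par_add (a b) : Term.Rel 𝕜 (.par (.add a b)) (.add (.par a) (.par b))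
  | par_smul (c : 𝕜) (a) : Term.Rel 𝕜 (.par (.smul c a)) (.smul c (.par a))
  | par_par (a) : Term.Rel 𝕜 (.par (.par a)) a
  | par_mul (a b) : Term.Rel 𝕜 (.par (.mul a b)) (.mul (.par a) (.par b))
  | even_comm (a b) : Term.Rel 𝕜 (.par a) a → Term.Rel 𝕜 (.mul a b) (.mul b a)
  | odd_comm (a b) : Term.Rel 𝕜 (.par a) (.smul (-1) a) → Term.Rel 𝕜 (.par b) (.smul (-1) b) →
      Term.Rel 𝕜 (.mul a b) (.smul (-1) (.mul b a))
  | D_add (a b) : Term.Rel 𝕜 (.D (.add a b)) (.add (.D a) (.D b))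
  | D_smul (c : 𝕜) (a) : Term.Rel 𝕜 (.D (.smul c a)) (.smul c (.D a))
  | Dinv_D (a) : Term.Rel 𝕜 (.Dinv (.D a)) a
  | D_Dinv (a) : Term.Rel 𝕜 (.D (.Dinv a)) a
  | par_D (a) : Term.Rel 𝕜 (.par (.D a)) (.smul (-1) (.D (.par a)))
  | D_mul (a b) : Term.Rel 𝕜 (.D (.mul a b)) (.add (.mul (.D a) b) (.mul (.par a) (.D b)))

/-- The congruence as a setoid. -/
def Term.setoid (𝕜 : Type u) [Field 𝕜] : Setoid (Term 𝕜) :=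
  ⟨Term.Rel 𝕜, .refl, .symm, .trans⟩

/-- The free superfield algebra over `𝕜` on two bosonic generators. -/
def FreeSuperfield (𝕜 : Type u) [Field 𝕜] : Type u := Quotient (Term.setoid 𝕜)

namespace FreeSuperfield

variable {𝕜 : Type u} [Field 𝕜]

/-- The class of an expression. -/
def mk (a : Term 𝕜) : FreeSuperfield 𝕜 := Quotient.mk (Term.setoid 𝕜) a

theorem mk_eq {a b : Term 𝕜} : mk a = mk b ↔ Term.Rel 𝕜 a b :=
  ⟨fun h => Quotient.exact h, fun h => Quotient.sound h⟩

theorem sound {a b : Term 𝕜} (h : Term.Rel 𝕜 a b) : mk a = mk b := Quotient.sound h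

theorem ind {p : FreeSuperfield 𝕜 → Prop} (h : ∀ a, p (mk a)) (x : FreeSuperfield 𝕜) : p x :=
  Quotient.ind h x

variable (𝕜) in
/-- The first generator. -/
def genΦ : FreeSuperfield 𝕜 := mk .Φ

variable (𝕜) in
/-- The second generator. -/
def genΨ : FreeSuperfield 𝕜 := mk .Ψ

instance : Zero (FreeSuperfield 𝕜) := ⟨mk .zero⟩
instance : Add (FreeSuperfield 𝕜) :=
  ⟨Quotient.map₂ .add fun _ _ h _ _ h' => .congr_add h h'⟩
instance : Mul (FreeSuperfield 𝕜) :=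
  ⟨Quotient.map₂ .mul fun _ _ h _ _ h' => .congr_mul h h'⟩
instance : SMul 𝕜 (FreeSuperfield 𝕜) :=
  ⟨fun c => Quotient.map (.smul c) fun _ _ h => .congr_smul c h⟩
instance : Neg (FreeSuperfield 𝕜) := ⟨fun x => (-1 : 𝕜) • x⟩

instance : NonUnitalRing (FreeSuperfield 𝕜) where
  add_assoc x y z := by
    induction x using ind; induction y using ind; induction z using ind
    exact sound (.add_assoc _ _ _)
  zero_add x := by
    induction x using ind
    exact sound (.zero_add _)
  add_zero x := by
    induction x using ind
    exact sound (.trans (.add_comm _ _) (.zero_add _))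
  add_comm x y := by
    induction x using ind; induction y using ind
    exact sound (.add_comm _ _)
  neg_add_cancel x := by
    induction x using ind
    exact sound (.neg_add _)
  mul_assoc x y z := by
    induction x using ind; induction y using ind; induction z using ind
    exact sound (.mul_assoc _ _ _)
  left_distrib x y z := by
    induction x using ind; induction y using ind; induction z using ind
    exact sound (.left_distrib _ _ _)
  right_distrib x y z := by
    induction x using ind; induction y using ind; induction z using ind
    exact sound (.right_distrib _ _ _)
  zero_mul x := by
    induction x using ind
    exact sound (.zero_mul _)
  mul_zero x := by
    induction x using ind
    exact sound (.mul_zero _)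
  nsmul := nsmulRec
  zsmul := zsmulRec

instance : Module 𝕜 (FreeSuperfield 𝕜) where
  one_smul x := by
    induction x using ind
    exact sound (.one_smul _)
  mul_smul c d x := by
    induction x using ind
    exact sound (.mul_smul c d _)
  smul_zero c := sound (.smul_zero c)
  zero_smul x := by
    induction x using ind
    exact sound (.zero_smul _)
  smul_add c x y := by
    induction x using ind; induction y using ind
    exact sound (.smul_add c _ _)
  add_smul c d x := by
    induction x using ind
    exact sound (.add_smul c d _)

instance : IsScalarTower 𝕜 (FreeSuperfield 𝕜) (FreeSuperfield 𝕜) where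
  smul_assoc c x y := by
    induction x using ind; induction y using ind
    exact sound (.smul_mul c _ _)

instance : SMulCommClass 𝕜 (FreeSuperfield 𝕜) (FreeSuperfield 𝕜) where
  smul_comm c x y := by
    induction x using ind; induction y using ind
    exact sound (.symm (.mul_smul' c _ _))

instance : SuperfieldAlgebra 𝕜 (FreeSuperfield 𝕜) where
  grading :=
    { toFun := Quotient.map .par fun _ _ h => .congr_par h
      map_add' := fun x y => by
        induction x using ind; induction y using ind
        exact sound (.par_add _ _)
      map_smul' := fun c x => by
        induction x using ind
        exact sound (.par_smul c _) }
  par_par x := by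
    induction x using ind
    exact sound (.par_par _)
  par_mul x y := by
    induction x using ind; induction y using ind
    exact sound (.par_mul _ _)
  even_comm x y h := by
    induction x using ind; induction y using ind
    exact sound (.even_comm _ _ (mk_eq.1 h))
  odd_comm x y h h' := by
    induction x using ind; induction y using ind
    exact sound (.odd_comm _ _ (mk_eq.1 h) (mk_eq.1 h'))
  der :=
    { toFun := Quotient.map .D fun _ _ h => .congr_D h
      invFun := Quotient.map .Dinv fun _ _ h => .congr_Dinv h
      map_add' := fun x y => by
        induction x using ind; induction y using ind
        exact sound (.D_add _ _)
      map_smul' := fun c x => by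
        induction x using ind
        exact sound (.D_smul c _)
      left_inv := fun x => by
        induction x using ind
        exact sound (.Dinv_D _)
      right_inv := fun x => by
        induction x using ind
        exact sound (.D_Dinv _) }
  par_D x := by
    induction x using ind
    exact sound (.par_D _)
  D_mul x y := by
    induction x using ind; induction y using ind
    exact sound (.D_mul _ _)

end FreeSuperfield

end SKP

/-! Put φ_k = L^k(Φ₀), ψ_k = (L^k)^*(Ψ₀) and σ_ij = 𝒟⁻¹(ψ_i φ_j), so that f₀ = -2σ_00. Since L = 𝒟 +
f₀ + φ₀𝒟⁻¹ψ₀, each step from φ_k to φ_(k+1), or from ψ_k to ψ_(k+1), involves only these superfields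
(`IsTower`). Moving one L across the pairing by integration by parts gives the quadratic relation
`IsTower.pairing_succ`, from which everything else follows.

The integral part of L^(p+1) is ∑_{a+b=p} φ_b 𝒟⁻¹ ψ_a (`Lpow_expansion`). The operator X is twice
the sum of the terms with odd a, so subtracting X replaces this sum by the alternating one. Bosonic
and modified fermionic flows thereby become one family, indexed by the level p and of parity p+1,
governed by Y_p = ∑_{a+b=p} (-1)^((p+1)a) φ_b 𝒟⁻¹ ψ_a: the flow V satisfies V φ₀ = (-1)^(p+1)
φ_(p+1) - Y_p(φ₀), with a conjugate formula for ψ₀ (`IsTowerFlow`, `evenPair_iff`, `oddPair_iff`).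
The flow ∂/∂t_l has level 2l-1 and D_n has level 2n-2.

Induction on the power of L extends these formulas to every φ_k, ψ_i and σ_ik (`map_φ`, `map_ψ`,
`map_pairing`); the sums over a+b=p collapse by telescoping. The same telescoping, for kernels φ_b
𝒟⁻¹ ψ_a, gives the Lax equation V L = (-1)^(p+1) L Y_p - Y_p L (`mapCoeff_lax`). Applying two flows
in succession gives the supercommutators on φ₀ and ψ₀ (`supercommutator_φ`, `supercommutator_ψ`):
they carry the factor ±(1 - (-1)^((p+1)(q+1))), so they vanish unless both flows are fermionic, and
then they equal -2 times the flow of level p+q+1.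

The elements on which the flow algebra holds are closed under all operations of a superfield
algebra, hence include f₀ and, in the free algebra, everything. Flows exist on the free algebra
because a superderivation may be prescribed on the generators (`flowTerm_congr`). -/

namespace SKP

universe u v

set_option linter.unusedSectionVars false

/-! ### Coefficients: the derivation and the grading on constants plus superfields. -/

section Coefficients

variable {𝕜 : Type u} {A : Type v} [Field 𝕜] [NonUnitalRing A] [Module 𝕜 A]
  [IsScalarTower 𝕜 A A] [SMulCommClass 𝕜 A A]

@[simp] theorem ext_fst (φ : A →ₗ[𝕜] A) (c : Coef 𝕜 A) : (ext φ c).fst = 0 := rfl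
@[simp] theorem ext_snd (φ : A →ₗ[𝕜] A) (c : Coef 𝕜 A) : (ext φ c).snd = φ c.snd := rfl

@[simp] theorem ext_inr (φ : A →ₗ[𝕜] A) (a : A) :
    ext φ (Unitization.inr a : Coef 𝕜 A) = Unitization.inr (φ a) := rfl

variable [SuperfieldAlgebra 𝕜 A]

@[simp] theorem cD_fst (c : Coef 𝕜 A) : (cD c).fst = 0 := rfl
@[simp] theorem cD_snd (c : Coef 𝕜 A) : (cD c).snd = D 𝕜 c.snd := rfl
@[simp] theorem cpar_fst (c : Coef 𝕜 A) : (cpar c).fst = c.fst := by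
  simp [cpar, Unitization.algebraMap_eq_inl]
@[simp] theorem cpar_snd (c : Coef 𝕜 A) : (cpar c).snd = par 𝕜 c.snd := by
  simp [cpar, Unitization.algebraMap_eq_inl]

@[simp] theorem cD_inr (a : A) : cD (Unitization.inr a : Coef 𝕜 A) = Unitization.inr (D 𝕜 a) := rfl
@[simp] theorem cpar_inr (a : A) :
    cpar (Unitization.inr a : Coef 𝕜 A) = Unitization.inr (par 𝕜 a) := by
  ext <;> simp

@[simp] theorem cD_one : cD (1 : Coef 𝕜 A) = 0 := by ext <;> simp
@[simp] theorem cpar_one : cpar (1 : Coef 𝕜 A) = 1 := by ext <;> simp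

theorem cD_mul (x y : Coef 𝕜 A) : cD (x * y) = cD x * y + cpar x * cD y := by
  ext
  · simp
  · simp [SuperfieldAlgebra.D_mul]
    abel

theorem cpar_mul (x y : Coef 𝕜 A) : cpar (x * y) = cpar x * cpar y := by
  ext <;> simp [SuperfieldAlgebra.par_mul]

theorem cpar_cpar (x : Coef 𝕜 A) : cpar (cpar x) = x := by
  ext <;> simp [SuperfieldAlgebra.par_par]

theorem cpar_cD (x : Coef 𝕜 A) : cpar (cD x) = -cD (cpar x) := by
  ext <;> simp [SuperfieldAlgebra.par_D]

theorem cpar_iterate_cD (k : ℕ) (x : Coef 𝕜 A) :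
    cpar (cD^[k] x) = (-1 : ℤ) ^ k • cD^[k] (cpar x) := by
  induction k generalizing x with
  | zero => simp
  | succ k ih =>
    rw [Function.iterate_succ_apply, ih, cpar_cD, iterate_map_neg, Function.iterate_succ_apply,
      pow_succ]
    simp

theorem cparPow_zero : cparPow (𝕜 := 𝕜) (A := A) 0 = LinearMap.id := by simp [cparPow]

theorem cpar_cparPow (n : ℤ) (x : Coef 𝕜 A) : cpar (cparPow n x) = cparPow (n + 1) x := by
  rcases Int.even_or_odd n with h | h
  · simp [cparPow, h, Int.not_even_iff_odd.2 h.add_one]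
  · simp [cparPow, h.add_one, Int.not_even_iff_odd.2 h, cpar_cpar]

theorem iterate_cD_one {k : ℕ} (hk : k ≠ 0) : cD^[k] (1 : Coef 𝕜 A) = 0 := by
  obtain ⟨k, rfl⟩ := Nat.exists_eq_succ_of_ne_zero hk
  rw [Function.iterate_succ_apply, cD_one, iterate_map_zero]

end Coefficients

/-! ### Superbinomial coefficients. -/

theorem superBinom_zero_right (n : ℤ) : superBinom n 0 = 1 := by simp [superBinom]

theorem superBinom_zero_succ (k : ℕ) : superBinom 0 (k + 1) = 0 := by
  unfold superBinom
  split_ifs with h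
  · rfl
  · have hk : (k + 1) / 2 = (k + 1) / 2 - 1 + 1 := by
      simp at h
      have : ¬ Odd (k+1) := by simpa using h
      rw [Nat.odd_iff] at this
      omega
    rw [hk]
    simp [Ring.choose_zero_succ]

/-- The Pascal rule encoded by 𝒟·𝒟^n = 𝒟^(n+1); the sign comes from carrying the grading past
𝒟^(k+1). Only for n and k both odd does the ordinary Pascal rule enter. -/
theorem superBinom_succ_succ (n : ℤ) (k : ℕ) :
    superBinom (n + 1) (k + 1) = superBinom n k + (-1) ^ (k + 1) * superBinom n (k + 1) := by
  obtain ⟨a, rfl | rfl⟩ := Int.even_or_odd' n <;> obtain ⟨b, rfl | rfl⟩ := Nat.even_or_odd' k <;>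
    have ha : ¬ Odd (2 * a) := Int.not_odd_iff_even.2 (even_two_mul a) <;>
    have hb : ¬ Odd (2 * b) := Nat.not_odd_iff_even.2 (even_two_mul b)
  · have h1 : (2 * a + 1) / 2 = a := by omega
    have h2 : (2 * b + 1) / 2 = b := by omega
    simp [superBinom, h1, h2, ha, hb, parity_simps]
  · have h1 : (2 * a + 1) / 2 = a := by omega
    simp [superBinom, h1, ha, parity_simps, pow_add, pow_mul]
  · have h1 : (2 * a + 1) / 2 = a := by omega
    have h2 : (2 * b + 1) / 2 = b := by omega
    simp [superBinom, h1, h2, ha, hb, parity_simps, pow_add, pow_mul]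
  · have h1 : (2 * a + 1) / 2 = a := by omega
    have h2 : (2 * b + 1) / 2 = b := by omega
    have h3 : (2 * a + 1 + 1) / 2 = a + 1 := by omega
    have h4 : (2 * b + 1 + 1) / 2 = b + 1 := by omega
    simp [superBinom, h1, h2, h3, h4, ha, parity_simps, pow_add, pow_mul,
      Ring.choose_succ_succ]

/-! ### The ring of super-pseudo-differential operators. -/

namespace SPDO

section AddGroup
variable {𝕜 : Type u} {A : Type v} [Field 𝕜] [NonUnitalRing A] [Module 𝕜 A]
  [IsScalarTower 𝕜 A A] [SMulCommClass 𝕜 A A]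

theorem ext_coeff {P Q : SPDO 𝕜 A} (h : ∀ n, P.coeff n = Q.coeff n) : P = Q :=
  Subtype.ext (funext h)

theorem exists_bound (P : SPDO 𝕜 A) : ∃ N : ℤ, ∀ n, N < n → P.coeff n = 0 := P.2

@[simp] theorem coeff_add (P Q : SPDO 𝕜 A) (n : ℤ) : (P + Q).coeff n = P.coeff n + Q.coeff n := rfl
@[simp] theorem coeff_zero (n : ℤ) : (0 : SPDO 𝕜 A).coeff n = 0 := rfl

variable (𝕜 A) in
/-- The coefficient of `𝒟^n` as an additive map. -/
def coeffHom (n : ℤ) : SPDO 𝕜 A →+ Coef 𝕜 A where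
  toFun P := P.coeff n
  map_zero' := rfl
  map_add' _ _ := rfl

@[simp] theorem coeff_zsmul (c : ℤ) (P : SPDO 𝕜 A) (n : ℤ) : (c • P).coeff n = c • P.coeff n :=
  map_zsmul (coeffHom 𝕜 A n) c P

@[simp] theorem coeff_sum {ι : Type*} (s : Finset ι) (P : ι → SPDO 𝕜 A) (n : ℤ) :
    (∑ i ∈ s, P i).coeff n = ∑ i ∈ s, (P i).coeff n :=
  map_sum (coeffHom 𝕜 A n) P s

theorem coeff_single (n m : ℤ) (c : Coef 𝕜 A) :
    (single n c).coeff m = if m = n then c else 0 := rfl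

end AddGroup

variable {𝕜 : Type u} {A : Type v} [Field 𝕜] [NonUnitalRing A] [Module 𝕜 A]
  [IsScalarTower 𝕜 A A] [SMulCommClass 𝕜 A A] [SuperfieldAlgebra 𝕜 A]

theorem coeff_mul_def (P Q : SPDO 𝕜 A) (m : ℤ) : (P * Q).coeff m = ∑ᶠ p : ℤ × ℕ, P.coeff p.1 *
      (superBinom p.1 p.2 • (cD^[p.2] (cparPow (p.1 - p.2) (Q.coeff (m - p.1 + p.2))))) := rfl

/-- The window `s` and the cutoff `K` are left free beyond their minimal size, so that different
products can be summed over a common range. -/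
theorem coeff_mul_of_bound {P Q : SPDO 𝕜 A} {M N : ℤ} (hP : ∀ n, M < n → P.coeff n = 0)
    (hQ : ∀ n, N < n → Q.coeff n = 0) (m : ℤ) {s : Finset ℤ} (hs : Finset.Icc (m - N) M ⊆ s)
    {K : ℕ} (hK : M + N - m < K) :
    (P * Q).coeff m = ∑ n ∈ s, ∑ k ∈ Finset.range K, P.coeff n *
      (superBinom n k • (cD^[k] (cparPow (n - k) (Q.coeff (m - n + k))))) := by
  rw [coeff_mul_def, ← Finset.sum_product']
  apply finsum_eq_sum_of_support_subset
  rintro ⟨n, k⟩ h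
  have h1 : n ≤ M := by
    by_contra h1
    apply h
    simp [hP n (by omega)]
  have h2 : m - n + k ≤ N := by
    by_contra h2
    apply h
    simp only [hQ (m - n + k) (by omega), map_zero, iterate_map_zero, smul_zero, mul_zero]
  simp only [Finset.coe_product, Set.mem_prod, Finset.mem_coe, Finset.mem_range]
  exact ⟨hs (Finset.mem_Icc.2 ⟨by omega, h1⟩), by omega⟩

/-- The coefficients of `c 𝒟^n Q`. -/
theorem coeff_single_mul {Q : SPDO 𝕜 A} {N : ℤ} (hQ : ∀ n, N < n → Q.coeff n = 0) (c : Coef 𝕜 A)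
    (n m : ℤ) {K : ℕ} (hK : n + N - m < K) :
    (single n c * Q).coeff m = c * ∑ k ∈ Finset.range K,
      (superBinom n k • (cD^[k] (cparPow (n - k) (Q.coeff (m - n + k))))) := by
  rw [coeff_mul_of_bound (M := n) (fun j hj => by simp [coeff_single, hj.ne']) hQ m
    (Finset.subset_insert n _) hK]
  rw [Finset.sum_eq_single_of_mem n (Finset.mem_insert_self _ _)]
  · simp [coeff_single, Finset.mul_sum]
  · intro j _ hj
    simp [coeff_single, hj]

theorem single_mul_bound {Q : SPDO 𝕜 A} {N : ℤ} (hQ : ∀ n, N < n → Q.coeff n = 0) (c : Coef 𝕜 A)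
    (n m : ℤ) (hm : n + N < m) : (single n c * Q).coeff m = 0 := by
  rw [coeff_single_mul hQ c n m (K := 0) (by push_cast; omega)]
  simp

/-- Grouping by the power of 𝒟 in `P` reduces questions about products to the operators 𝒟^n Q. -/
theorem coeff_mul_eq_sum {P Q : SPDO 𝕜 A} {M N : ℤ} (hP : ∀ n, M < n → P.coeff n = 0)
    (hQ : ∀ n, N < n → Q.coeff n = 0) (m : ℤ) {s : Finset ℤ} (hs : Finset.Icc (m - N) M ⊆ s) :
    (P * Q).coeff m = ∑ n ∈ s, P.coeff n * (single n 1 * Q).coeff m := by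
  rw [coeff_mul_of_bound hP hQ m hs (K := (M + N - m + 1).toNat) (by omega)]
  refine Finset.sum_congr rfl fun n _ => ?_
  by_cases hn : n ≤ M
  · rw [coeff_single_mul hQ 1 n m (K := (M + N - m + 1).toNat) (by omega), one_mul,
      Finset.mul_sum]
  · simp [hP n (by omega)]

protected theorem add_mul' (P Q R : SPDO 𝕜 A) : (P + Q) * R = P * R + Q * R := by
  obtain ⟨a, ha⟩ := exists_bound P
  obtain ⟨b, hb⟩ := exists_bound Q
  obtain ⟨c, hc⟩ := exists_bound R
  have ha' : ∀ n, max a b < n → P.coeff n = 0 := fun n hn => ha n (by omega)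
  have hb' : ∀ n, max a b < n → Q.coeff n = 0 := fun n hn => hb n (by omega)
  have hab : ∀ n, max a b < n → (P + Q).coeff n = 0 := fun n hn => by simp [ha' n hn, hb' n hn]
  refine ext_coeff fun m => ?_
  rw [coeff_add, coeff_mul_eq_sum hab hc m subset_rfl, coeff_mul_eq_sum ha' hc m subset_rfl,
    coeff_mul_eq_sum hb' hc m subset_rfl, ← Finset.sum_add_distrib]
  simp [add_mul]

protected theorem mul_add' (P Q R : SPDO 𝕜 A) : P * (Q + R) = P * Q + P * R := by
  obtain ⟨a, ha⟩ := exists_bound Q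
  obtain ⟨b, hb⟩ := exists_bound R
  obtain ⟨c, hc⟩ := exists_bound P
  have ha' : ∀ n, max a b < n → Q.coeff n = 0 := fun n hn => ha n (by omega)
  have hb' : ∀ n, max a b < n → R.coeff n = 0 := fun n hn => hb n (by omega)
  have hab : ∀ n, max a b < n → (Q + R).coeff n = 0 := fun n hn => by simp [ha' n hn, hb' n hn]
  refine ext_coeff fun m => ?_
  have hK : c + max a b - m < ((c + max a b - m + 1).toNat : ℤ) := by omega
  rw [coeff_add, coeff_mul_of_bound hc hab m subset_rfl hK,
    coeff_mul_of_bound hc ha' m subset_rfl hK, coeff_mul_of_bound hc hb' m subset_rfl hK,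
    ← Finset.sum_add_distrib]
  refine Finset.sum_congr rfl fun n _ => ?_
  rw [← Finset.sum_add_distrib]
  refine Finset.sum_congr rfl fun k _ => ?_
  rw [coeff_add, map_add, iterate_map_add, smul_add, mul_add]

protected theorem one_mul' (Q : SPDO 𝕜 A) : single 0 1 * Q = Q := by
  obtain ⟨b, hb⟩ := exists_bound Q
  refine ext_coeff fun m => ?_
  rw [coeff_single_mul hb 1 0 m (K := (b - m).toNat + 1) (by omega), Finset.sum_range_succ']
  simp [superBinom_zero_succ, superBinom_zero_right, cparPow_zero]

protected theorem mul_one' (P : SPDO 𝕜 A) : P * single 0 1 = P := by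
  obtain ⟨b, hb⟩ := exists_bound P
  have h0 : ∀ n : ℤ, 0 < n → (single 0 1 : SPDO 𝕜 A).coeff n = 0 :=
    fun n hn => by simp [coeff_single, hn.ne']
  refine ext_coeff fun m => ?_
  rw [coeff_mul_eq_sum hb h0 m (Finset.subset_insert m _),
    Finset.sum_eq_single_of_mem m (Finset.mem_insert_self _ _)]
  · rw [coeff_single_mul h0 1 m m (K := 1) (by simp)]
    have : cparPow m (1 : Coef 𝕜 A) = 1 := by unfold cparPow; split_ifs <;> simp
    simp [superBinom_zero_right, coeff_single, this]
  · intro n _ hn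
    obtain ⟨K, hK⟩ : ∃ K : ℕ, n + 0 - m < K := ⟨(n - m + 1).toNat, by omega⟩
    rw [coeff_single_mul h0 1 n m hK, one_mul]
    rw [Finset.sum_eq_zero, mul_zero]
    intro k _
    rw [coeff_single]
    split_ifs with h
    · have hk : k ≠ 0 := by rintro rfl; omega
      have : cparPow (n - k) (1 : Coef 𝕜 A) = 1 := by unfold cparPow; split_ifs <;> simp
      rw [this, iterate_cD_one hk, smul_zero]
    · rw [map_zero, iterate_map_zero, smul_zero]

/-- The coefficients of `𝒟 Q`. -/
theorem coeff_D_mul (Q : SPDO 𝕜 A) (m : ℤ) :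
    (single 1 1 * Q).coeff m = cD (Q.coeff m) + cpar (Q.coeff (m - 1)) := by
  obtain ⟨b, hb⟩ := exists_bound Q
  rw [coeff_single_mul hb 1 1 m (K := (b - m).toNat + 2) (by omega), Finset.sum_range_succ',
    Finset.sum_range_succ', Finset.sum_eq_zero]
  · simp [superBinom, cparPow]
  · intro k _
    have : superBinom 1 (k + 1 + 1) = 0 := by
      have h := superBinom_succ_succ 0 (k + 1)
      simpa [superBinom_zero_succ] using h
    rw [this, zero_smul]

/-- `𝒟 (𝒟^n Q) = 𝒟^(n+1) Q`. -/
theorem D_mul_single_mul (Q : SPDO 𝕜 A) (n : ℤ) :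
    single 1 1 * (single n 1 * Q) = single (n + 1) 1 * Q := by
  obtain ⟨b, hb⟩ := exists_bound Q
  refine ext_coeff fun m => ?_
  obtain ⟨K, hK⟩ : ∃ K : ℕ, n + 1 + b - m < K := ⟨(n + 1 + b - m + 1).toNat, by omega⟩
  rw [coeff_D_mul, coeff_single_mul hb 1 n m (K := K) (by omega),
    coeff_single_mul hb 1 n (m - 1) (K := K + 1) (by push_cast; omega),
    coeff_single_mul hb 1 (n + 1) m (K := K + 1) (by push_cast; omega), one_mul, one_mul, one_mul,
    Finset.sum_range_succ', Finset.sum_range_succ', map_add, ← add_assoc, map_sum, map_sum,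
    ← Finset.sum_add_distrib]
  -- The k-th summand of 𝒟 applied to the coefficient is paired with the (k+1)-st summand of the
  -- shifted coefficient, whence the cutoffs `K` and `K + 1`; the latter's k = 0 summand is left
  -- over.
  congr 1
  · refine Finset.sum_congr rfl fun k _ => ?_
    rw [superBinom_succ_succ, map_zsmul, map_zsmul, cpar_iterate_cD, cpar_cparPow, add_smul,
      ← Function.iterate_succ_apply' (f := cD), smul_smul, mul_comm]
    have e1 : n + 1 - ((k + 1 : ℕ) : ℤ) = n - k := by push_cast; ring
    have e2 : m - (n + 1) + ((k + 1 : ℕ) : ℤ) = m - n + k := by push_cast; ring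
    have e3 : n - ((k + 1 : ℕ) : ℤ) + 1 = n - k := by push_cast; ring
    have e4 : m - 1 - n + ((k + 1 : ℕ) : ℤ) = m - n + k := by push_cast; ring
    rw [e1, e2, e3, e4]
  · have e : m - 1 - n = m - (n + 1) := by ring
    simp [superBinom_zero_right, cpar_cparPow, e]

/-- Associativity with left factor 𝒟 amounts to the Leibniz rule for coefficients; the term with a
shifted coefficient is absorbed by 𝒟·𝒟^n = 𝒟^(n+1). -/
theorem D_mul_mul (Q R : SPDO 𝕜 A) : (single 1 1 * Q) * R = single 1 1 * (Q * R) := by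
  obtain ⟨b, hb⟩ := exists_bound Q
  obtain ⟨c, hc⟩ := exists_bound R
  refine ext_coeff fun m => ?_
  have hb1 : ∀ n, b + 1 < n → (single 1 1 * Q).coeff n = 0 :=
    fun n hn => single_mul_bound hb 1 1 n (by omega)
  have hb2 : ∀ n, b + 1 < n → Q.coeff n = 0 := fun n hn => hb n (by omega)
  rw [coeff_D_mul, coeff_mul_eq_sum hb1 hc m subset_rfl, coeff_mul_eq_sum hb2 hc m subset_rfl,
    coeff_mul_eq_sum hb hc (m - 1) (s := Finset.Icc (m - c - 1) b)
      (Finset.Icc_subset_Icc (by omega) le_rfl), map_sum, map_sum]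
  simp only [coeff_D_mul _ _, cD_mul, cpar_mul, add_mul, Finset.sum_add_distrib]
  rw [add_assoc]
  congr 1
  have h1 : ∑ n ∈ Finset.Icc (m - c) (b + 1), cpar (Q.coeff (n - 1)) * (single n 1 * R).coeff m =
      ∑ n ∈ Finset.Icc (m - c - 1) b, cpar (Q.coeff n) * (single (n + 1) 1 * R).coeff m := by
    refine Finset.sum_nbij' (fun n => n - 1) (fun n => n + 1) ?_ ?_ ?_ ?_ ?_ <;>
      simp
  -- The two windows differ only at their ends, where either 𝒟^n R has too low an order or the
  -- coefficient of `Q` vanishes.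
  have h2 : ∑ n ∈ Finset.Icc (m - c) (b + 1), cpar (Q.coeff n) * cD ((single n 1 * R).coeff m) =
      ∑ n ∈ Finset.Icc (m - c - 1) b, cpar (Q.coeff n) * cD ((single n 1 * R).coeff m) := by
    trans ∑ n ∈ Finset.Icc (m - c - 1) (b + 1), cpar (Q.coeff n) * cD ((single n 1 * R).coeff m)
    · refine Finset.sum_subset (Finset.Icc_subset_Icc (by omega) le_rfl) fun n h h' => ?_
      simp only [Finset.mem_Icc] at h h'
      rw [single_mul_bound hc 1 n m (by omega), map_zero, mul_zero]
    · refine (Finset.sum_subset (Finset.Icc_subset_Icc le_rfl (by omega)) fun n h h' => ?_).symm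
      simp only [Finset.mem_Icc] at h h'
      rw [hb n (by omega), map_zero, zero_mul]
  rw [h1, h2, ← Finset.sum_add_distrib]
  refine Finset.sum_congr rfl fun n _ => ?_
  rw [← D_mul_single_mul, coeff_D_mul, mul_add]

/-- The coefficient of 𝒟^(n+1) in 𝒟P is 𝒟 P_(n+1) plus the graded P_n. If 𝒟P = 0, the coefficients
of P therefore vanish one after another, downwards from the order of P. -/
theorem D_mul_cancel {Q R : SPDO 𝕜 A} (h : single 1 1 * Q = single 1 1 * R) : Q = R := by
  have key : ∀ P : SPDO 𝕜 A, single 1 1 * P = 0 → P = 0 := by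
    intro P hP
    obtain ⟨b, hb⟩ := exists_bound P
    have : ∀ k : ℕ, ∀ n : ℤ, b - k < n → P.coeff n = 0 := by
      intro k
      induction k with
      | zero => intro n hn; exact hb n (by simpa using hn)
      | succ k ih =>
        intro n hn
        have h1 := congrArg (fun R : SPDO 𝕜 A => R.coeff (n + 1)) hP
        simp only [coeff_D_mul, coeff_zero, add_sub_cancel_right] at h1
        rw [ih (n + 1) (by push_cast at hn; omega), map_zero, zero_add] at h1
        rw [← cpar_cpar (P.coeff n), h1, map_zero]
    refine ext_coeff fun n => this (b - n + 1).toNat n (by omega)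
  have h1 : single 1 1 * (Q - R) = 0 := by
    have := SPDO.mul_add' (single 1 1) (Q - R) R
    rw [sub_add_cancel, h] at this
    exact right_eq_add.1 this
  exact sub_eq_zero.1 (key _ h1)

/-- Positive powers are built up from 𝒟; negative ones are reached by multiplying by 𝒟 and
cancelling it, so no computation with negative superbinomials is needed. -/
theorem single_one_mul_mul (n : ℤ) (Q R : SPDO 𝕜 A) :
    (single n 1 * Q) * R = single n 1 * (Q * R) := by
  induction n with
  | zero => rw [SPDO.one_mul', SPDO.one_mul']
  | succ n ih =>
    rw [← D_mul_single_mul, D_mul_mul, ih, D_mul_single_mul]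
  | pred n ih =>
    apply D_mul_cancel
    rw [← D_mul_mul, D_mul_single_mul, D_mul_single_mul, sub_add_cancel, ih]

protected theorem mul_assoc' (P Q R : SPDO 𝕜 A) : P * Q * R = P * (Q * R) := by
  obtain ⟨a, ha⟩ := exists_bound P
  obtain ⟨b, hb⟩ := exists_bound Q
  obtain ⟨c, hc⟩ := exists_bound R
  have hQR : ∀ n, b + c < n → (Q * R).coeff n = 0 := fun n hn => by
    rw [coeff_mul_eq_sum hb hc n subset_rfl, Finset.Icc_eq_empty (by omega), Finset.sum_empty]
  have hPQ : ∀ n, a + b < n → (P * Q).coeff n = 0 := fun n hn => by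
    rw [coeff_mul_eq_sum ha hb n subset_rfl, Finset.Icc_eq_empty (by omega), Finset.sum_empty]
  refine ext_coeff fun m => ?_
  rw [coeff_mul_eq_sum hPQ hc m subset_rfl, coeff_mul_eq_sum ha hQR m subset_rfl]
  have h1 : ∀ j ∈ Finset.Icc (m - c) (a + b), (P * Q).coeff j * (single j 1 * R).coeff m =
      ∑ n ∈ Finset.Icc (m - (b + c)) a,
        P.coeff n * ((single n 1 * Q).coeff j * (single j 1 * R).coeff m) := by
    intro j hj
    rw [Finset.mem_Icc] at hj
    rw [coeff_mul_eq_sum ha hb j (s := Finset.Icc (m - (b + c)) a)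
      (Finset.Icc_subset_Icc (by omega) le_rfl), Finset.sum_mul]
    simp only [mul_assoc]
  rw [Finset.sum_congr rfl h1, Finset.sum_comm]
  refine Finset.sum_congr rfl fun n hn => ?_
  rw [Finset.mem_Icc] at hn
  rw [← single_one_mul_mul, coeff_mul_eq_sum (fun j hj => single_mul_bound hb 1 n j hj) hc m
    (s := Finset.Icc (m - c) (a + b)) (Finset.Icc_subset_Icc le_rfl (by omega)), Finset.mul_sum]

noncomputable instance : Ring (SPDO 𝕜 A) where
  __ := (inferInstance : AddCommGroup (SPDO 𝕜 A))
  __ := (inferInstance : Mul (SPDO 𝕜 A))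
  one := single 0 1
  mul_assoc := SPDO.mul_assoc'
  one_mul := SPDO.one_mul'
  mul_one := SPDO.mul_one'
  left_distrib := SPDO.mul_add'
  right_distrib := SPDO.add_mul'
  zero_mul P := by
    have := SPDO.add_mul' 0 0 P
    rw [add_zero] at this
    exact left_eq_add.1 this
  mul_zero P := by
    have := SPDO.mul_add' P 0 0
    rw [add_zero] at this
    exact left_eq_add.1 this

end SPDO
-- Elementary operators, integration by parts, and the action of differential operators.
namespace SPDO

variable {𝕜 : Type u} {A : Type v} [Field 𝕜] [NonUnitalRing A] [Module 𝕜 A]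
  [IsScalarTower 𝕜 A A] [SMulCommClass 𝕜 A A] [SuperfieldAlgebra 𝕜 A]

variable (𝕜 A) in
/-- The operator `𝒟`. -/
noncomputable def dOp : SPDO 𝕜 A := single 1 1

variable (𝕜 A) in
/-- The operator `𝒟⁻¹`. -/
noncomputable def dInv : SPDO 𝕜 A := single (-1) 1

theorem coeff_const_mul (c : Coef 𝕜 A) (Q : SPDO 𝕜 A) (m : ℤ) :
    (single 0 c * Q).coeff m = c * Q.coeff m := by
  obtain ⟨b, hb⟩ := exists_bound Q
  obtain ⟨K, hK⟩ : ∃ K : ℕ, 0 + b - m < K := ⟨(0 + b - m + 1).toNat, by omega⟩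
  have h1 := coeff_single_mul hb 1 0 m hK
  rw [SPDO.one_mul', one_mul] at h1
  rw [coeff_single_mul hb c 0 m hK, ← h1]

variable (𝕜 A) in
/-- Coefficients as operators of order zero. -/
noncomputable def const : Coef 𝕜 A →+* SPDO 𝕜 A where
  toFun c := single 0 c
  map_zero' := ext_coeff fun n => by simp [coeff_single]
  map_one' := rfl
  map_add' x y := ext_coeff fun n => by
    simp only [coeff_add, coeff_single]
    split_ifs <;> simp
  map_mul' x y := ext_coeff fun n => by
    rw [coeff_const_mul]
    simp only [coeff_single]
    split_ifs <;> simp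

theorem const_apply (c : Coef 𝕜 A) : const 𝕜 A c = single 0 c := rfl

variable (𝕜 A) in
/-- Multiplication by a superfield. -/
noncomputable def fnOp : A →+ SPDO 𝕜 A :=
  (const 𝕜 A).toAddMonoidHom.comp (Unitization.inrHom 𝕜 𝕜 A).toAddMonoidHom

theorem fnOp_apply (a : A) : fnOp 𝕜 A a = single 0 (Unitization.inr a) := rfl

theorem fnOp_eq_const (a : A) : fnOp 𝕜 A a = const 𝕜 A (Unitization.inr a) := rfl

theorem fnOp_mul (a b : A) : fnOp 𝕜 A (a * b) = fnOp 𝕜 A a * fnOp 𝕜 A b := by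
  rw [fnOp_eq_const, Unitization.inr_mul, map_mul]
  rfl

theorem coeff_fnOp_mul (a : A) (Q : SPDO 𝕜 A) (m : ℤ) :
    (fnOp 𝕜 A a * Q).coeff m = Unitization.inr a * Q.coeff m :=
  coeff_const_mul _ _ _

theorem single_mul_single_one (n m : ℤ) :
    (single n 1 * single m 1 : SPDO 𝕜 A) = single (n + m) 1 := by
  induction n with
  | zero => rw [SPDO.one_mul', zero_add]
  | succ n ih =>
    rw [← D_mul_single_mul, ih]
    refine ext_coeff fun j => ?_
    rw [coeff_D_mul]
    simp only [coeff_single]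
    have : (j - 1 = n + m) ↔ (j = n + 1 + m) := by omega
    simp only [this]
    split_ifs <;> simp
  | pred n ih =>
    apply D_mul_cancel
    rw [D_mul_single_mul, sub_add_cancel, ih]
    refine ext_coeff fun j => ?_
    rw [coeff_D_mul]
    simp only [coeff_single]
    have : (j - 1 = -n - 1 + m) ↔ (j = -n + m) := by omega
    simp only [this]
    split_ifs <;> simp

theorem dOp_mul_dInv : dOp 𝕜 A * dInv 𝕜 A = 1 := by
  rw [dOp, dInv, single_mul_single_one]; rfl

theorem dInv_mul_dOp : dInv 𝕜 A * dOp 𝕜 A = 1 := by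
  rw [dOp, dInv, single_mul_single_one]; rfl

theorem dOp_mul_fnOp (a : A) :
    dOp 𝕜 A * fnOp 𝕜 A a = fnOp 𝕜 A (D 𝕜 a) + fnOp 𝕜 A (par 𝕜 a) * dOp 𝕜 A := by
  refine ext_coeff fun m => ?_
  rw [dOp, coeff_D_mul, coeff_add, coeff_fnOp_mul, fnOp_apply, fnOp_apply, coeff_single,
    coeff_single, coeff_single, coeff_single]
  have : (m - 1 = 0) ↔ (m = 1) := by omega
  simp only [this]
  split_ifs <;> simp

theorem dInv_mul_fnOp_mul_dOp (b : A) :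
    dInv 𝕜 A * fnOp 𝕜 A b * dOp 𝕜 A =
      fnOp 𝕜 A (par 𝕜 b) - dInv 𝕜 A * fnOp 𝕜 A (D 𝕜 (par 𝕜 b)) := by
  have h := dOp_mul_fnOp (𝕜 := 𝕜) (par 𝕜 b)
  rw [SuperfieldAlgebra.par_par] at h
  rw [mul_assoc, eq_sub_of_add_eq' h.symm, mul_sub, ← mul_assoc, dInv_mul_dOp, one_mul]

/-- Integration by parts: with c = 𝒟e, multiplication by c is 𝒟∘e minus (graded e)∘𝒟, and the outer
factors 𝒟⁻¹ cancel one 𝒟 in each term. -/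
theorem dInv_mul_fnOp_mul_dInv (c : A) :
    dInv 𝕜 A * fnOp 𝕜 A c * dInv 𝕜 A = fnOp 𝕜 A ((D 𝕜).symm c) * dInv 𝕜 A -
      dInv 𝕜 A * fnOp 𝕜 A (par 𝕜 ((D 𝕜).symm c)) := by
  have h := dOp_mul_fnOp (𝕜 := 𝕜) ((D 𝕜).symm c)
  rw [LinearEquiv.apply_symm_apply] at h
  rw [eq_sub_of_add_eq h.symm, mul_sub, sub_mul, ← mul_assoc, dInv_mul_dOp, one_mul, ← mul_assoc,
    mul_assoc _ (dOp 𝕜 A), dOp_mul_dInv, mul_one]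

/-! ### Differential and integral parts -/

/-- `P` is purely differential. -/
def IsDiff (P : SPDO 𝕜 A) : Prop := ∀ n < 0, P.coeff n = 0

/-- `P` is purely pseudo-differential. -/
def IsInt (P : SPDO 𝕜 A) : Prop := ∀ n ≥ 0, P.coeff n = 0

theorem coeff_plus (P : SPDO 𝕜 A) (n : ℤ) : P.plus.coeff n = if 0 ≤ n then P.coeff n else 0 := rfl
theorem coeff_minus (P : SPDO 𝕜 A) (n : ℤ) : P.minus.coeff n = if n < 0 then P.coeff n else 0 := rfl

theorem plus_add_minus (P : SPDO 𝕜 A) : P.plus + P.minus = P := ext_coeff fun n => by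
  rw [coeff_add, coeff_plus, coeff_minus]
  split_ifs <;> first | omega | simp

theorem isDiff_plus (P : SPDO 𝕜 A) : IsDiff P.plus := fun n hn => by
  rw [coeff_plus, if_neg (not_le.2 hn)]

theorem isInt_minus (P : SPDO 𝕜 A) : IsInt P.minus := fun n hn => by
  rw [coeff_minus, if_neg (not_lt.2 hn)]

theorem IsDiff.add {P Q : SPDO 𝕜 A} (hP : IsDiff P) (hQ : IsDiff Q) : IsDiff (P + Q) :=
  fun n hn => by rw [coeff_add, hP n hn, hQ n hn, add_zero]

theorem IsInt.add {P Q : SPDO 𝕜 A} (hP : IsInt P) (hQ : IsInt Q) : IsInt (P + Q) :=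
  fun n hn => by rw [coeff_add, hP n hn, hQ n hn, add_zero]

theorem IsDiff.zsmul {P : SPDO 𝕜 A} (hP : IsDiff P) (c : ℤ) : IsDiff (c • P) :=
  fun n hn => by rw [coeff_zsmul, hP n hn, smul_zero]

theorem IsDiff.sum {ι : Type*} {s : Finset ι} {P : ι → SPDO 𝕜 A} (h : ∀ i ∈ s, IsDiff (P i)) :
    IsDiff (∑ i ∈ s, P i) :=
  fun n hn => by rw [coeff_sum, Finset.sum_eq_zero fun i hi => h i hi n hn]

theorem IsInt.sum {ι : Type*} {s : Finset ι} {P : ι → SPDO 𝕜 A} (h : ∀ i ∈ s, IsInt (P i)) :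
    IsInt (∑ i ∈ s, P i) :=
  fun n hn => by rw [coeff_sum, Finset.sum_eq_zero fun i hi => h i hi n hn]

theorem minus_eq {P R S : SPDO 𝕜 A} (h : P = R + S) (hR : IsDiff R) (hS : IsInt S) :
    P.minus = S := ext_coeff fun n => by
  subst h
  rw [coeff_minus, coeff_add]
  split_ifs with hn
  · rw [hR n hn, zero_add]
  · rw [hS n (not_lt.1 hn)]

theorem isDiff_const (c : Coef 𝕜 A) : IsDiff (const 𝕜 A c) := fun n hn => by
  rw [const_apply, coeff_single, if_neg hn.ne]

theorem isDiff_fnOp (a : A) : IsDiff (fnOp 𝕜 A a) := isDiff_const _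

theorem isDiff_dOp : IsDiff (dOp 𝕜 A) := fun n hn => by
  rw [dOp, coeff_single, if_neg (by omega)]

theorem isInt_const_mul_dInv_mul (c : Coef 𝕜 A) (b : A) :
    IsInt (const 𝕜 A c * dInv 𝕜 A * fnOp 𝕜 A b) := fun n hn => by
  rw [mul_assoc, const_apply, coeff_const_mul, dInv,
    single_mul_bound (N := 0) (fun j hj => ?_) 1 (-1) n (by omega), mul_zero]
  rw [fnOp_apply, coeff_single, if_neg hj.ne']

theorem isInt_fnOp_mul_dInv_mul (a b : A) : IsInt (fnOp 𝕜 A a * dInv 𝕜 A * fnOp 𝕜 A b) :=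
  isInt_const_mul_dInv_mul _ _

theorem IsDiff.single_natCast_mul {Q : SPDO 𝕜 A} (hQ : IsDiff Q) (n : ℕ) :
    IsDiff (single n 1 * Q) := by
  induction n with
  | zero => simpa using (SPDO.one_mul' Q).symm ▸ hQ
  | succ n ih =>
    intro m hm
    rw [Nat.cast_succ, ← D_mul_single_mul, coeff_D_mul, ih m hm, ih (m - 1) (by omega)]
    simp

/-- For differential P a product is a sum over natural powers with a cutoff that does not depend on
Q or on the coefficient, so it is an identity of operators. -/
theorem IsDiff.exists_bound {P : SPDO 𝕜 A} (hP : IsDiff P) :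
    ∃ M : ℕ, (∀ n : ℤ, M < n → P.coeff n = 0) ∧ ∀ (Q : SPDO 𝕜 A) (K : ℕ) (_ : M < K) (m : ℤ),
      (P * Q).coeff m = ∑ n ∈ Finset.range K, P.coeff n * (single n 1 * Q).coeff m := by
  obtain ⟨M, hM⟩ := SPDO.exists_bound P
  refine ⟨M.toNat, fun n hn => hM n (by omega), fun Q K hK m => ?_⟩
  obtain ⟨N, hN⟩ := SPDO.exists_bound Q
  rw [coeff_mul_eq_sum hM hN m (s := Finset.Icc (min (m - N) 0) K)
    (Finset.Icc_subset_Icc (by omega) (by omega))]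
  symm
  trans ∑ n ∈ (Finset.range K).map Nat.castEmbedding, P.coeff n * (single n 1 * Q).coeff m
  · rw [Finset.sum_map]; rfl
  refine Finset.sum_subset (fun n hn => ?_) fun n hn hn' => ?_
  · simp only [Finset.mem_map, Finset.mem_range, Nat.castEmbedding_apply] at hn
    obtain ⟨j, hj, rfl⟩ := hn
    rw [Finset.mem_Icc]
    omega
  · simp only [Finset.mem_map, Finset.mem_range, Nat.castEmbedding_apply, not_exists,
      not_and] at hn'
    have : n < 0 ∨ (K : ℤ) ≤ n := by
      by_contra h
      exact hn' n.toNat (by omega) (by omega)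
    rcases this with h | h
    · rw [hP n h, zero_mul]
    · rw [hM n (by omega), zero_mul]

theorem IsDiff.mul {P Q : SPDO 𝕜 A} (hP : IsDiff P) (hQ : IsDiff Q) : IsDiff (P * Q) := by
  obtain ⟨M, hM, h⟩ := hP.exists_bound
  intro m hm
  rw [h Q (M + 1) (Nat.lt_succ_self M), Finset.sum_eq_zero]
  intro n _
  rw [hQ.single_natCast_mul n m hm, mul_zero]

/-- The action of the differential part of `P` on coefficients. -/
noncomputable def act (P : SPDO 𝕜 A) (x : Coef 𝕜 A) : Coef 𝕜 A :=
  ∑ᶠ j : ℕ, P.coeff j * cD^[j] x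

theorem applyPlus_eq_act (P : SPDO 𝕜 A) (g : A) : P.applyPlus g = P.act (Unitization.inr g) := rfl

theorem act_eq_sum {P : SPDO 𝕜 A} {M : ℕ} (hM : ∀ n : ℤ, M < n → P.coeff n = 0) {K : ℕ}
    (hK : M < K) (x : Coef 𝕜 A) : P.act x = ∑ j ∈ Finset.range K, P.coeff j * cD^[j] x := by
  refine finsum_eq_sum_of_support_subset _ fun j hj => ?_
  by_contra h
  apply hj
  simp only [Finset.coe_range, Set.mem_Iio, not_lt] at h
  change P.coeff j * _ = 0
  rw [hM j (by omega), zero_mul]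

theorem exists_nat_bound (P : SPDO 𝕜 A) : ∃ M : ℕ, ∀ n : ℤ, M < n → P.coeff n = 0 := by
  obtain ⟨M, hM⟩ := SPDO.exists_bound P
  exact ⟨M.toNat, fun n hn => hM n (by omega)⟩

theorem act_add_left (P Q : SPDO 𝕜 A) (x : Coef 𝕜 A) : (P + Q).act x = P.act x + Q.act x := by
  obtain ⟨M, hM⟩ := exists_nat_bound P
  obtain ⟨N, hN⟩ := exists_nat_bound Q
  rw [act_eq_sum (M := max M N) (K := max M N + 1) (fun n hn => hM n (by omega)) (by omega),
    act_eq_sum (M := max M N) (K := max M N + 1) (fun n hn => hN n (by omega)) (by omega),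
    act_eq_sum (M := max M N) (K := max M N + 1)
      (fun n hn => by rw [coeff_add, hM n (by omega), hN n (by omega), add_zero]) (by omega),
    ← Finset.sum_add_distrib]
  simp [add_mul]

theorem act_add_right (P : SPDO 𝕜 A) (x y : Coef 𝕜 A) : P.act (x + y) = P.act x + P.act y := by
  obtain ⟨M, hM⟩ := exists_nat_bound P
  rw [act_eq_sum hM (Nat.lt_succ_self M), act_eq_sum hM (Nat.lt_succ_self M),
    act_eq_sum hM (Nat.lt_succ_self M), ← Finset.sum_add_distrib]
  refine Finset.sum_congr rfl fun j _ => ?_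
  rw [iterate_map_add, mul_add]

/-- The action on a fixed coefficient, as an additive map in the operator. -/
noncomputable def actHom (x : Coef 𝕜 A) : SPDO 𝕜 A →+ Coef 𝕜 A :=
  AddMonoidHom.mk' (fun P => P.act x) fun P Q => act_add_left P Q x

theorem act_zsmul_left (c : ℤ) (P : SPDO 𝕜 A) (x : Coef 𝕜 A) : (c • P).act x = c • P.act x :=
  map_zsmul (actHom x) c P

theorem act_sum_left {ι : Type*} (s : Finset ι) (P : ι → SPDO 𝕜 A) (x : Coef 𝕜 A) :
    (∑ i ∈ s, P i).act x = ∑ i ∈ s, (P i).act x :=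
  map_sum (actHom x) P s

theorem act_zsmul_right (c : ℤ) (P : SPDO 𝕜 A) (x : Coef 𝕜 A) : P.act (c • x) = c • P.act x :=
  map_zsmul (AddMonoidHom.mk' (fun y => P.act y) fun y z => act_add_right P y z) c x

theorem IsInt.act_eq_zero {P : SPDO 𝕜 A} (hP : IsInt P) (x : Coef 𝕜 A) : P.act x = 0 := by
  rw [act]
  simp [hP _ (Int.natCast_nonneg _)]

theorem act_plus (P : SPDO 𝕜 A) (x : Coef 𝕜 A) : P.plus.act x = P.act x := by
  conv_rhs => rw [← plus_add_minus P, act_add_left, (isInt_minus P).act_eq_zero, add_zero]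

theorem act_const (c x : Coef 𝕜 A) : (const 𝕜 A c).act x = c * x := by
  rw [act_eq_sum (M := 0) (K := 1) (fun n hn => ?_) Nat.zero_lt_one]
  · simp [const_apply, coeff_single]
  · rw [const_apply, coeff_single, if_neg (by omega)]

theorem act_fnOp (a : A) (x : Coef 𝕜 A) : (fnOp 𝕜 A a).act x = Unitization.inr a * x :=
  act_const _ _

theorem act_dOp (x : Coef 𝕜 A) : (dOp 𝕜 A).act x = cD x := by
  rw [act_eq_sum (M := 1) (K := 2) (fun n hn => ?_) Nat.one_lt_two]
  · simp [dOp, coeff_single]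
  · rw [dOp, coeff_single, if_neg (by push_cast at hn; omega)]

theorem IsDiff.act_dOp_mul {Q : SPDO 𝕜 A} (hQ : IsDiff Q) (x : Coef 𝕜 A) :
    (single 1 1 * Q).act x = cD (Q.act x) := by
  obtain ⟨M, hM⟩ := exists_nat_bound Q
  have hM' : ∀ n : ℤ, ((M + 1 : ℕ) : ℤ) < n → (single 1 1 * Q).coeff n = 0 := fun n hn => by
    push_cast at hn
    rw [coeff_D_mul, hM n (by omega), hM (n - 1) (by omega), map_zero, map_zero, add_zero]
  rw [act_eq_sum hM' (Nat.lt_succ_self _), act_eq_sum hM (K := M + 1) (by omega), map_sum]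
  simp only [coeff_D_mul, cD_mul, add_mul, Finset.sum_add_distrib]
  congr 1
  · rw [Finset.sum_range_succ, hM ((M + 1 : ℕ) : ℤ) (by push_cast; omega), map_zero, zero_mul,
      add_zero]
  · rw [Finset.sum_range_succ', Nat.cast_zero, hQ (0 - 1) (by omega), map_zero, zero_mul, add_zero]
    simp [Function.iterate_succ_apply']

theorem IsDiff.act_single_natCast_mul {Q : SPDO 𝕜 A} (hQ : IsDiff Q) (n : ℕ) (x : Coef 𝕜 A) :
    (single n 1 * Q).act x = cD^[n] (Q.act x) := by
  induction n with
  | zero => simp [SPDO.one_mul']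
  | succ n ih =>
    rw [Nat.cast_succ, ← D_mul_single_mul, (hQ.single_natCast_mul n).act_dOp_mul, ih,
      Function.iterate_succ_apply']

theorem IsDiff.act_mul {P Q : SPDO 𝕜 A} (hP : IsDiff P) (hQ : IsDiff Q) (x : Coef 𝕜 A) :
    (P * Q).act x = P.act (Q.act x) := by
  obtain ⟨M, hM, h⟩ := hP.exists_bound
  have h1 : P * Q = ∑ n ∈ Finset.range (M + 1), const 𝕜 A (P.coeff n) * (single n 1 * Q) :=
    ext_coeff fun m => by
      rw [h Q (M + 1) (Nat.lt_succ_self M), coeff_sum]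
      exact Finset.sum_congr rfl fun n _ => (coeff_const_mul _ _ _).symm
  have h2 : ∀ (c : Coef 𝕜 A) (R : SPDO 𝕜 A), (const 𝕜 A c * R).act x = c * R.act x := by
    intro c R
    obtain ⟨N, hN⟩ := exists_nat_bound R
    rw [act_eq_sum hN (Nat.lt_succ_self N), act_eq_sum (M := N) (K := N + 1)
      (fun n hn => by rw [const_apply, coeff_const_mul, hN n hn, mul_zero]) (Nat.lt_succ_self N),
      Finset.mul_sum]
    simp only [const_apply, coeff_const_mul, mul_assoc]
  rw [h1, act_sum_left, act_eq_sum hM (Nat.lt_succ_self M)]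
  refine Finset.sum_congr rfl fun n _ => ?_
  rw [h2, hQ.act_single_natCast_mul]

theorem act_one (P : SPDO 𝕜 A) : P.act 1 = P.coeff 0 := by
  rw [act, finsum_eq_single _ 0]
  · simp
  · intro n hn
    rw [iterate_cD_one hn, mul_zero]

theorem coeff_mul_dInv (P : SPDO 𝕜 A) (n : ℤ) : (P * dInv 𝕜 A).coeff n = P.coeff (n + 1) := by
  obtain ⟨M, hM⟩ := SPDO.exists_bound P
  rw [coeff_mul_eq_sum hM (N := -1)
    (fun j hj => by rw [dInv, coeff_single, if_neg (by omega)]) n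
    (Finset.subset_insert (n + 1) _),
    Finset.sum_eq_single_of_mem (n + 1) (Finset.mem_insert_self _ _)]
  · rw [dInv, single_mul_single_one, coeff_single, if_pos (by omega), mul_one]
  · intro j _ hj
    rw [dInv, single_mul_single_one, coeff_single, if_neg (by omega), mul_zero]

/-- A differential operator times `a 𝒟⁻¹ b`. -/
theorem IsDiff.mul_dInv {P : SPDO 𝕜 A} (hP : IsDiff P) (a : A) :
    ∃ R : SPDO 𝕜 A, IsDiff R ∧
      (∀ b : A, P * (fnOp 𝕜 A a * dInv 𝕜 A * fnOp 𝕜 A b) =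
        R * fnOp 𝕜 A b + const 𝕜 A (P.applyPlus a) * dInv 𝕜 A * fnOp 𝕜 A b) ∧
      ∀ b g : A, (R * fnOp 𝕜 A b).applyPlus g =
        P.applyPlus (a * (D 𝕜).symm (b * g)) -
          P.applyPlus a * Unitization.inr ((D 𝕜).symm (b * g)) := by
  have hPa := hP.mul (isDiff_fnOp (𝕜 := 𝕜) a)
  have h0 : (P * fnOp 𝕜 A a).coeff 0 = P.applyPlus a := by
    rw [← act_one, hP.act_mul (isDiff_fnOp a), act_fnOp, mul_one, applyPlus_eq_act]
  set R := (P * fnOp 𝕜 A a * dInv 𝕜 A).plus with hR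
  -- Right multiplication by 𝒟⁻¹ shifts coefficients by one, so the only term pushed below order
  -- zero is the constant term of P∘a, which is P(a).
  have h1 : P * fnOp 𝕜 A a * dInv 𝕜 A = R + const 𝕜 A (P.applyPlus a) * dInv 𝕜 A := by
    refine ext_coeff fun n => ?_
    rw [coeff_add, hR, coeff_plus, coeff_mul_dInv, coeff_mul_dInv, const_apply, coeff_single]
    split_ifs with h h' h' <;> try omega
    · rw [add_zero]
    · rw [h', h0, zero_add]
    · rw [hPa (n + 1) (by omega), zero_add]
  have h2 : R * dOp 𝕜 A = P * fnOp 𝕜 A a - const 𝕜 A (P.applyPlus a) := by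
    rw [eq_sub_of_add_eq h1.symm, sub_mul, mul_assoc _ (dInv 𝕜 A), dInv_mul_dOp, mul_one,
      mul_assoc _ (dInv 𝕜 A), dInv_mul_dOp, mul_one]
  have hRd : IsDiff R := isDiff_plus _
  clear_value R
  refine ⟨R, hRd, fun b => ?_, fun b g => ?_⟩
  · rw [← add_mul, ← h1]
    simp only [mul_assoc]
  · rw [applyPlus_eq_act, hRd.act_mul (isDiff_fnOp b), act_fnOp,
      ← Unitization.inr_mul]
    -- Writing bg as 𝒟 of its antiderivative turns the action of R into that of R𝒟, which `h2`
    -- computes.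
    conv_lhs => rw [← LinearEquiv.apply_symm_apply (D 𝕜) (b * g), ← cD_inr, ← act_dOp,
      ← hRd.act_mul isDiff_dOp, h2]
    rw [sub_eq_add_neg, ← neg_one_zsmul, act_add_left, act_zsmul_left, act_const,
      hP.act_mul (isDiff_fnOp a), act_fnOp, ← Unitization.inr_mul, neg_one_zsmul,
      ← sub_eq_add_neg]
    rfl

end SPDO

/-! ### Homogeneous superfields and flows of either parity. -/

section Homogeneous

variable (𝕜 : Type u) {A : Type v} [Field 𝕜] [NonUnitalRing A] [Module 𝕜 A]
  [SuperfieldAlgebra 𝕜 A]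

/-- `a` is homogeneous of parity `k mod 2`. -/
def IsHomog (k : ℕ) (a : A) : Prop := par 𝕜 a = (-1 : ℤ) ^ k • a

variable {𝕜}

theorem zsmul_neg_one_pow_congr {M : Type*} [AddCommGroup M] {x y : ℕ} (h : Even x ↔ Even y)
    (a : M) : (-1 : ℤ) ^ x • a = (-1 : ℤ) ^ y • a := by
  rw [neg_one_pow_congr h]

theorem zsmul_neg_one_pow_self {M : Type*} [AddCommGroup M] (k : ℕ) (a : M) :
    (-1 : ℤ) ^ k • (-1 : ℤ) ^ k • a = a := by
  rw [smul_smul, ← mul_pow]; simp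

namespace IsHomog

variable {i j : ℕ} {a b : A}

theorem congr (h : IsHomog 𝕜 i a) (hij : Even i ↔ Even j) : IsHomog 𝕜 j a := by
  rw [IsHomog, h, zsmul_neg_one_pow_congr hij]

theorem add (ha : IsHomog 𝕜 i a) (hb : IsHomog 𝕜 i b) : IsHomog 𝕜 i (a + b) := by
  rw [IsHomog, map_add, ha, hb, smul_add]

theorem zsmul (c : ℤ) (ha : IsHomog 𝕜 i a) : IsHomog 𝕜 i (c • a) := by
  rw [IsHomog, map_zsmul, ha, smul_comm]

theorem neg (ha : IsHomog 𝕜 i a) : IsHomog 𝕜 i (-a) := by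
  rw [IsHomog, map_neg, ha, smul_neg]

theorem sub (ha : IsHomog 𝕜 i a) (hb : IsHomog 𝕜 i b) : IsHomog 𝕜 i (a - b) := by
  rw [IsHomog, map_sub, ha, hb, smul_sub]

theorem sum {ι : Type*} {s : Finset ι} {f : ι → A} (h : ∀ x ∈ s, IsHomog 𝕜 i (f x)) :
    IsHomog 𝕜 i (∑ x ∈ s, f x) := by
  rw [IsHomog, map_sum, Finset.smul_sum]
  exact Finset.sum_congr rfl h

theorem mul (ha : IsHomog 𝕜 i a) (hb : IsHomog 𝕜 j b) : IsHomog 𝕜 (i + j) (a * b) := by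
  rw [IsHomog, SuperfieldAlgebra.par_mul]
  change par 𝕜 a * par 𝕜 b = _
  rw [ha, hb, smul_mul_smul_comm, pow_add]

theorem D (ha : IsHomog 𝕜 i a) : IsHomog 𝕜 (i + 1) (SKP.D 𝕜 a) := by
  rw [IsHomog, SuperfieldAlgebra.par_D]
  change -SKP.D 𝕜 (par 𝕜 a) = _
  rw [ha, map_zsmul, pow_succ]
  simp

theorem Dinv (ha : IsHomog 𝕜 i a) : IsHomog 𝕜 (i + 1) ((SKP.D 𝕜).symm a) := by
  rw [IsHomog]
  apply (SKP.D 𝕜).injective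
  have h := SuperfieldAlgebra.par_D (𝕜 := 𝕜) ((SKP.D 𝕜).symm a)
  change par 𝕜 (SKP.D 𝕜 _) = -SKP.D 𝕜 (par 𝕜 _) at h
  rw [LinearEquiv.apply_symm_apply, ha] at h
  rw [map_zsmul, LinearEquiv.apply_symm_apply, ← neg_eq_iff_eq_neg.2 h, pow_succ]
  simp

theorem D_mul (ha : IsHomog 𝕜 i a) (b : A) :
    SKP.D 𝕜 (a * b) = SKP.D 𝕜 a * b + (-1 : ℤ) ^ i • (a * SKP.D 𝕜 b) := by
  rw [SKP.D, SuperfieldAlgebra.D_mul]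
  change _ + par 𝕜 a * _ = _
  rw [ha, smul_mul_assoc]

theorem mul_comm (ha : IsHomog 𝕜 i a) (hb : IsHomog 𝕜 j b) :
    a * b = (-1 : ℤ) ^ (i * j) • (b * a) := by
  rcases Nat.even_or_odd i with hi | hi
  · rw [SuperfieldAlgebra.even_comm (𝕜 := 𝕜) a b (by rw [← par, ha, hi.neg_one_pow, one_smul]),
      (hi.mul_right j).neg_one_pow, one_smul]
  · rcases Nat.even_or_odd j with hj | hj
    · rw [SuperfieldAlgebra.even_comm (𝕜 := 𝕜) b a (by rw [← par, hb, hj.neg_one_pow, one_smul]),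
        (hj.mul_left i).neg_one_pow, one_smul]
    · rw [SuperfieldAlgebra.odd_comm (𝕜 := 𝕜) a b (by rw [← par, ha, hi.neg_one_pow, neg_one_smul])
        (by rw [← par, hb, hj.neg_one_pow, neg_one_smul]), (hi.mul hj).neg_one_pow, neg_one_smul]

end IsHomog

/-- A flow of parity `s`: a superderivation that supercommutes with `𝒟`. -/
structure IsFlow (s : ℕ) (V : A →ₗ[𝕜] A) : Prop where
  par_map : ∀ a, par 𝕜 (V a) = (-1 : ℤ) ^ s • V (par 𝕜 a)
  leibniz : ∀ {i : ℕ} {a : A}, IsHomog 𝕜 i a → ∀ b,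
    V (a * b) = V a * b + (-1 : ℤ) ^ (s * i) • (a * V b)
  map_D : ∀ a, V (D 𝕜 a) = (-1 : ℤ) ^ s • D 𝕜 (V a)

theorem EvenFlow.isFlow (T : EvenFlow 𝕜 A) {s : ℕ} (hs : Even s) : IsFlow s T.toLin where
  par_map a := by rw [hs.neg_one_pow, one_smul, T.par_comm]
  leibniz {i a} _ b := by rw [T.leibniz, (hs.mul_right i).neg_one_pow, one_smul]
  map_D a := by rw [hs.neg_one_pow, one_smul, T.D_comm]

theorem OddFlow.isFlow (T : OddFlow 𝕜 A) {s : ℕ} (hs : Odd s) : IsFlow s T.toLin where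
  par_map a := by rw [hs.neg_one_pow, neg_one_smul, T.par_comm]
  leibniz {i a} ha b := by rw [T.leibniz, ha, smul_mul_assoc, pow_mul, hs.neg_one_pow]
  map_D a := by rw [hs.neg_one_pow, neg_one_smul, T.D_anticomm]

namespace IsFlow

variable {s : ℕ} {V : A →ₗ[𝕜] A} (hV : IsFlow s V)
include hV

theorem map_Dinv (a : A) : V ((D 𝕜).symm a) = (-1 : ℤ) ^ s • (D 𝕜).symm (V a) := by
  apply (D 𝕜).injective
  have h := hV.map_D ((D 𝕜).symm a)
  rw [LinearEquiv.apply_symm_apply] at h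
  rw [map_zsmul, LinearEquiv.apply_symm_apply, h, zsmul_neg_one_pow_self]

end IsFlow

end Homogeneous

/-! ### The tower φ_k, ψ_k, its pairings σ_ij, and the action of a flow on them. -/

section Tower

open Finset.HasAntidiagonal

variable (𝕜 : Type u) {A : Type v} [Field 𝕜] [NonUnitalRing A] [Module 𝕜 A]
  [SuperfieldAlgebra 𝕜 A]

/-- The pairings `𝒟⁻¹(ψ_i φ_j)`. -/
noncomputable def pairing (φ ψ : ℕ → A) (i j : ℕ) : A := (D 𝕜).symm (ψ i * φ j)

/-- The recursion satisfied by `φ_k = L^k(Φ₀)` and `ψ_k = (L^k)^*(Ψ₀)`. -/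
structure IsTower (φ ψ : ℕ → A) (f : A) : Prop where
  homog_φ : ∀ k, IsHomog 𝕜 k (φ k)
  homog_ψ : ∀ k, IsHomog 𝕜 k (ψ k)
  eq_f : f = -((2 : ℤ) • pairing 𝕜 φ ψ 0 0)
  φ_succ : ∀ k, φ (k + 1) = D 𝕜 (φ k) + f * φ k + φ 0 * pairing 𝕜 φ ψ 0 k
  ψ_succ : ∀ k, ψ (k + 1) = (-1 : ℤ) ^ k • (-D 𝕜 (ψ k) + f * ψ k + ψ 0 * pairing 𝕜 φ ψ k 0)

variable {𝕜}

theorem sum_antidiagonal_telescope {M : Type*} [AddCommGroup M] (p : ℕ) (G : ℕ × ℕ → M) :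
    ∑ x ∈ antidiagonal p, (G (x.1 + 1, x.2) - G (x.1, x.2 + 1)) =
      G (p + 1, 0) - G (0, p + 1) := by
  have h1 := Finset.Nat.sum_antidiagonal_succ (n := p) (f := G)
  have h2 := Finset.Nat.sum_antidiagonal_succ' (n := p) (f := G)
  rw [Finset.sum_sub_distrib, sub_eq_sub_iff_add_eq_add, add_comm, ← h1, h2, add_comm]

namespace IsTower

variable {φ ψ : ℕ → A} {f : A} (h : IsTower 𝕜 φ ψ f)

theorem D_pairing (i j : ℕ) : D 𝕜 (pairing 𝕜 φ ψ i j) = ψ i * φ j :=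
  LinearEquiv.apply_symm_apply _ _

include h

theorem homog_pairing (i j : ℕ) : IsHomog 𝕜 (i + j + 1) (pairing 𝕜 φ ψ i j) :=
  ((h.homog_ψ i).mul (h.homog_φ j)).Dinv

theorem homog_f : IsHomog 𝕜 1 f := h.eq_f ▸ ((h.homog_pairing 0 0).zsmul 2).neg

/-- Integrated form of the adjointness of L and L^*: both sides have the same image under 𝒟, which
is injective. The local boundary term comes from 𝒟 and the product of pairings from φ₀𝒟⁻¹ψ₀. -/
theorem pairing_succ (i j : ℕ) : pairing 𝕜 φ ψ i (j + 1) = pairing 𝕜 φ ψ (i + 1) j +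
    (-1 : ℤ) ^ i • (ψ i * φ j) + pairing 𝕜 φ ψ i 0 * pairing 𝕜 φ ψ 0 j := by
  apply (D 𝕜).injective
  rw [map_add, map_add, map_zsmul, (h.homog_pairing i 0).D_mul, (h.homog_ψ i).D_mul, D_pairing,
    D_pairing, D_pairing, D_pairing, h.φ_succ, h.ψ_succ]
  simp only [mul_add, add_mul, smul_mul_assoc, ← mul_assoc]
  rw [(h.homog_ψ i).mul_comm h.homog_f, (h.homog_ψ 0).mul_comm (h.homog_pairing i 0)]
  -- Once each sign is fixed to be 1 or -1, what remains is an identity in an abelian group; all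
  -- later sign computations of this kind work alike.
  rcases neg_one_pow_eq_or ℤ i with hi | hi <;>
    simp [hi, pow_add, mul_assoc] <;> abel

end IsTower

/-- A flow of parity `p + 1` with the prescribed action on `φ₀` and `ψ₀`. -/
structure IsTowerFlow (φ ψ : ℕ → A) (p : ℕ) (V : A →ₗ[𝕜] A) : Prop extends IsFlow (p + 1) V where
  map_φ_zero : V (φ 0) = (-1 : ℤ) ^ (p + 1) • φ (p + 1) - ∑ x ∈ antidiagonal p,
    (-1 : ℤ) ^ ((p + 1) * x.1) • (φ x.2 * pairing 𝕜 φ ψ x.1 0)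
  map_ψ_zero : V (ψ 0) = -((-1 : ℤ) ^ (p + 1) • ψ (p + 1)) + ∑ x ∈ antidiagonal p,
    (-1 : ℤ) ^ ((p + 1) * x.1 + x.2) • (pairing 𝕜 φ ψ 0 x.2 * ψ x.1)

namespace IsTowerFlow

variable {φ ψ : ℕ → A} {f : A} {p : ℕ} {V : A →ₗ[𝕜] A}
  (hV : IsTowerFlow φ ψ p V) (h : IsTower 𝕜 φ ψ f)
include hV h

/-- The formulas for φ_k and ψ_i are hypotheses because the inductions in `map_φ` and `map_ψ` need
this result at (0, k) and at (i, 0). After applying 𝒟 it is the Leibniz rule for ψ_i φ_k. -/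
theorem map_pairing_aux (i k : ℕ)
    (hφ : V (φ k) = (-1 : ℤ) ^ ((p + 1) * (k + 1)) • φ (k + (p + 1)) -
      ∑ x ∈ antidiagonal p,
        (-1 : ℤ) ^ ((p + 1) * x.1) • (φ x.2 * pairing 𝕜 φ ψ x.1 k))
    (hψ : V (ψ i) = -((-1 : ℤ) ^ (p + 1) • ψ (i + (p + 1))) + ∑ x ∈ antidiagonal p,
        (-1 : ℤ) ^ ((p + 1) * i + (p + 1) * x.1 + i + x.2) • (pairing 𝕜 φ ψ i x.2 * ψ x.1)) :
    V (pairing 𝕜 φ ψ i k) = -pairing 𝕜 φ ψ (i + (p + 1)) k +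
      (-1 : ℤ) ^ ((p + 1) * (i + k)) • pairing 𝕜 φ ψ i (k + (p + 1)) -
      ∑ x ∈ antidiagonal p, (-1 : ℤ) ^ ((p + 1) * (1 + i + x.1)) •
        (pairing 𝕜 φ ψ i x.2 * pairing 𝕜 φ ψ x.1 k) := by
  rw [pairing, hV.map_Dinv]
  apply (D 𝕜).injective
  rw [map_zsmul, LinearEquiv.apply_symm_apply, hV.leibniz (h.homog_ψ i), hφ, hψ, map_sub, map_add,
    map_neg, map_zsmul, map_sum, IsTower.D_pairing, IsTower.D_pairing]
  have key : ∑ x ∈ antidiagonal p, D 𝕜 ((-1 : ℤ) ^ ((p + 1) * (1 + i + x.1)) •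
        (pairing 𝕜 φ ψ i x.2 * pairing 𝕜 φ ψ x.1 k)) =
      (-1 : ℤ) ^ (p + 1) • ((-1 : ℤ) ^ ((p + 1) * i) • (ψ i * ∑ x ∈ antidiagonal p,
        (-1 : ℤ) ^ ((p + 1) * x.1) • (φ x.2 * pairing 𝕜 φ ψ x.1 k))) -
      (-1 : ℤ) ^ (p + 1) • ((∑ x ∈ antidiagonal p,
        (-1 : ℤ) ^ ((p + 1) * i + (p + 1) * x.1 + i + x.2) • (pairing 𝕜 φ ψ i x.2 * ψ x.1)) *
          φ k) := by
    rw [Finset.mul_sum, Finset.sum_mul, Finset.smul_sum, Finset.smul_sum, Finset.smul_sum,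
      ← Finset.sum_sub_distrib]
    refine Finset.sum_congr rfl ?_
    rintro ⟨a, b⟩ hx
    obtain rfl := mem_antidiagonal.1 hx
    rw [map_zsmul, (h.homog_pairing i b).D_mul, IsTower.D_pairing, IsTower.D_pairing]
    simp only [mul_smul_comm, smul_mul_assoc, mul_assoc]
    rcases neg_one_pow_eq_or ℤ i with hi | hi <;> rcases neg_one_pow_eq_or ℤ a with ha | ha <;>
      rcases neg_one_pow_eq_or ℤ b with hb | hb <;>
      simp [hi, ha, hb, pow_add, pow_mul] <;> abel
  rw [key]
  generalize p + 1 = m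
  simp only [add_mul, mul_sub, smul_add, smul_sub, neg_mul, smul_neg, smul_mul_assoc,
    mul_smul_comm, zsmul_neg_one_pow_self]
  rw [smul_smul, smul_smul, ← pow_add, ← pow_add, neg_one_pow_congr
    (show Even (m + m * i + m * (k + 1)) ↔ Even (m * (i + k)) by
      simp only [Nat.even_add, Nat.even_mul, Nat.even_add_one]; tauto)]
  abel

/-- Since f = -2σ_00, `map_pairing_aux` applies with the defining equations as hypotheses.
Telescoping `pairing_succ` along a+b=p evaluates σ_(0,p+1) - σ_(p+1,0), and its quadratic part
cancels, leaving a local expression. -/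
theorem map_f : V f = -((2 : ℤ) • ∑ x ∈ antidiagonal p,
    (-1 : ℤ) ^ x.1 • (ψ x.1 * φ x.2)) := by
  have h0 := map_pairing_aux hV h 0 0 (by simpa using hV.map_φ_zero) (by simpa using hV.map_ψ_zero)
  have ht := sum_antidiagonal_telescope p (fun x => pairing 𝕜 φ ψ x.1 x.2)
  have hs : ∑ x ∈ antidiagonal p,
      (-1 : ℤ) ^ ((p + 1) * (1 + 0 + x.1)) • (pairing 𝕜 φ ψ 0 x.2 * pairing 𝕜 φ ψ x.1 0) =
      ∑ x ∈ antidiagonal p, pairing 𝕜 φ ψ x.1 0 * pairing 𝕜 φ ψ 0 x.2 := by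
    refine Finset.sum_congr rfl ?_
    rintro ⟨a, b⟩ hx
    obtain rfl := mem_antidiagonal.1 hx
    rw [(h.homog_pairing 0 b).mul_comm (h.homog_pairing a 0), smul_smul, ← pow_add,
      Even.neg_one_pow, one_smul]
    simp only [Nat.even_add, Nat.even_mul, Nat.even_add_one, add_zero, zero_add]
    tauto
  simp only [h.pairing_succ] at ht
  rw [hs] at h0
  rw [h.eq_f, map_neg, map_zsmul, h0]
  have ht' : pairing 𝕜 φ ψ 0 (p + 1) - pairing 𝕜 φ ψ (p + 1) 0 =
      ∑ x ∈ antidiagonal p, (-1 : ℤ) ^ x.1 • (ψ x.1 * φ x.2) +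
      ∑ x ∈ antidiagonal p, pairing 𝕜 φ ψ x.1 0 * pairing 𝕜 φ ψ 0 x.2 := by
    -- The boundary value σ_(0,p+1) in `ht` has been expanded by the same rule and must be expanded
    -- here too.
    rw [← neg_sub, h.pairing_succ 0 p]
    simp only [pow_zero] at ht ⊢
    rw [← ht, ← Finset.sum_add_distrib, ← Finset.sum_neg_distrib]
    refine Finset.sum_congr rfl fun x _ => ?_
    abel
  have e := eq_sub_of_add_eq ht'.symm
  rw [e]
  simp
  abel

/-- Induction through φ_(k+1) = 𝒟φ_k + fφ_k + φ₀σ_0k. Applying 𝒟 + f to φ_b σ_ak raises the index of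
φ_b, and `pairing_succ` trades σ_(a,k+1) for σ_(a+1,k); the difference telescopes, and its two end
terms account for the leading terms of V(φ₀) and V(σ_0k). -/
theorem map_φ (k : ℕ) : V (φ k) = (-1 : ℤ) ^ ((p + 1) * (k + 1)) • φ (k + (p + 1)) -
      ∑ x ∈ antidiagonal p, (-1 : ℤ) ^ ((p + 1) * x.1) • (φ x.2 * pairing 𝕜 φ ψ x.1 k) := by
  induction k with
  | zero => simpa using hV.map_φ_zero
  | succ k ih =>
    have hσ := map_pairing_aux hV h 0 k ih (by simpa using hV.map_ψ_zero)
    have hf := map_f hV h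
    have ht := sum_antidiagonal_telescope p
      (fun x => (-1 : ℤ) ^ ((p + 1) * x.1 + (p + 1)) • (φ x.2 * pairing 𝕜 φ ψ x.1 k))
    have key : ∑ x ∈ antidiagonal p, ((-1 : ℤ) ^ ((p + 1) + (p + 1) * x.1) •
          (D 𝕜 (φ x.2 * pairing 𝕜 φ ψ x.1 k) + f * (φ x.2 * pairing 𝕜 φ ψ x.1 k)) +
        (2 : ℤ) • (-1 : ℤ) ^ x.1 • (ψ x.1 * φ x.2 * φ k) +
        (-1 : ℤ) ^ ((p + 1) * x.1) • (φ x.2 * pairing 𝕜 φ ψ x.1 0 * pairing 𝕜 φ ψ 0 k) +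
        (-1 : ℤ) ^ ((p + 1) * (1 + 0 + x.1)) •
          (φ 0 * (pairing 𝕜 φ ψ 0 x.2 * pairing 𝕜 φ ψ x.1 k))) =
        ∑ x ∈ antidiagonal p,
          ((-1 : ℤ) ^ ((p + 1) * x.1) • (φ x.2 * pairing 𝕜 φ ψ x.1 (k + 1)) -
          ((-1 : ℤ) ^ ((p + 1) * (x.1 + 1) + (p + 1)) • (φ x.2 * pairing 𝕜 φ ψ (x.1 + 1) k) -
          (-1 : ℤ) ^ ((p + 1) * x.1 + (p + 1)) • (φ (x.2 + 1) * pairing 𝕜 φ ψ x.1 k))) := by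
      refine Finset.sum_congr rfl ?_
      rintro ⟨a, b⟩ hx
      obtain rfl := mem_antidiagonal.1 hx
      rw [(h.homog_φ b).D_mul, IsTower.D_pairing, h.φ_succ b, h.pairing_succ a k,
        (h.homog_ψ a).mul_comm (h.homog_φ b)]
      simp only [mul_add, add_mul, mul_smul_comm, smul_mul_assoc, mul_assoc]
      rcases neg_one_pow_eq_or ℤ a with ha | ha <;> rcases neg_one_pow_eq_or ℤ b with hb | hb <;>
        simp [ha, hb, pow_add, pow_mul] <;> abel
    rw [Finset.sum_sub_distrib, ht] at key
    simp only [Finset.sum_add_distrib] at key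
    rw [h.φ_succ k, map_add, map_add, hV.map_D, hV.leibniz h.homog_f, hV.leibniz (h.homog_φ 0),
      ih, hσ, hf, hV.map_φ_zero, show k + 1 + (p + 1) = k + (p + 1) + 1 by ring, h.φ_succ (k + (p + 1))]
    simp only [zero_add, mul_one, mul_zero] at key ⊢
    clear hf hσ ht ih hV
    generalize p + 1 = m at key ⊢
    simp only [map_sub, map_zsmul, map_sum, mul_sub, sub_mul, mul_neg, mul_add, smul_sub, smul_add,
      smul_neg, mul_smul_comm, smul_mul_assoc, smul_smul, ← pow_add, Finset.mul_sum, Finset.sum_mul,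
      Finset.smul_sum, neg_mul, Finset.sum_add_distrib, mul_one, add_zero,
      pow_zero, one_smul, one_mul] at key ⊢
    have s1 : (-1 : ℤ) ^ (m + (m * k + m)) = (-1) ^ (m * k) :=
      neg_one_pow_congr (by simp only [Nat.even_add]; tauto)
    have s2 : (-1 : ℤ) ^ (m * k + m + m) = (-1) ^ (m * k) :=
      neg_one_pow_congr (by simp only [Nat.even_add]; tauto)
    have s3 : (-1 : ℤ) ^ (m * m + m) = 1 :=
      Even.neg_one_pow (by simp only [Nat.even_add, Nat.even_mul]; tauto)
    rw [s3] at key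
    rw [s1, s2]
    linear_combination (norm := module) (-1 : ℤ) • key

/-- The conjugate of the argument for `map_φ`: now the first index of σ_ib and the index of ψ_a are
shifted. -/
theorem map_ψ (i : ℕ) : V (ψ i) = -((-1 : ℤ) ^ (p + 1) • ψ (i + (p + 1))) +
    ∑ x ∈ antidiagonal p,
      (-1 : ℤ) ^ ((p + 1) * i + (p + 1) * x.1 + i + x.2) • (pairing 𝕜 φ ψ i x.2 * ψ x.1) := by
  induction i with
  | zero => simpa using hV.map_ψ_zero
  | succ i ih =>
    have hσ := map_pairing_aux hV h i 0 (by simpa using hV.map_φ_zero) ih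
    have hf := map_f hV h
    have ht := sum_antidiagonal_telescope p
      (fun x => (-1 : ℤ) ^ ((p + 1) * i + (p + 1) * x.1 + x.1) • (pairing 𝕜 φ ψ i x.2 * ψ x.1))
    have key : ∑ x ∈ antidiagonal p, (
        -((-1 : ℤ) ^ ((p + 1) + ((p + 1) * i + (p + 1) * x.1 + i + x.2)) •
          D 𝕜 (pairing 𝕜 φ ψ i x.2 * ψ x.1)) +
        (-1 : ℤ) ^ ((p + 1) + ((p + 1) * i + (p + 1) * x.1 + i + x.2)) •
          (f * (pairing 𝕜 φ ψ i x.2 * ψ x.1)) -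
        (2 : ℤ) • (-1 : ℤ) ^ x.1 • (ψ x.1 * φ x.2 * ψ i) +
        (-1 : ℤ) ^ ((p + 1) * x.1 + x.2) • (pairing 𝕜 φ ψ 0 x.2 * ψ x.1 * pairing 𝕜 φ ψ i 0) -
        (-1 : ℤ) ^ ((p + 1) * (1 + i + x.1)) •
          (ψ 0 * (pairing 𝕜 φ ψ i x.2 * pairing 𝕜 φ ψ x.1 0))) =
        ∑ x ∈ antidiagonal p,
          ((-1 : ℤ) ^ (i + ((p + 1) * (i + 1) + (p + 1) * x.1 + (i + 1) + x.2)) •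
            (pairing 𝕜 φ ψ (i + 1) x.2 * ψ x.1) +
          ((-1 : ℤ) ^ ((p + 1) * i + (p + 1) * (x.1 + 1) + (x.1 + 1)) •
            (pairing 𝕜 φ ψ i x.2 * ψ (x.1 + 1)) -
          (-1 : ℤ) ^ ((p + 1) * i + (p + 1) * x.1 + x.1) •
            (pairing 𝕜 φ ψ i (x.2 + 1) * ψ x.1))) := by
      refine Finset.sum_congr rfl ?_
      rintro ⟨a, b⟩ hx
      obtain rfl := mem_antidiagonal.1 hx
      have c1 := ((h.homog_ψ a).mul (h.homog_φ b)).mul_comm (h.homog_ψ i)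
      rw [(h.homog_ψ a).mul_comm (h.homog_φ b), mul_smul_comm, smul_mul_assoc] at c1
      have c2 := ((h.homog_pairing 0 b).mul (h.homog_ψ a)).mul_comm (h.homog_pairing i 0)
      have c3 := (h.homog_ψ 0).mul_comm ((h.homog_pairing i b).mul (h.homog_pairing a 0))
      have c4 := h.homog_f.mul_comm (h.homog_pairing i b)
      rw [(h.homog_pairing i b).D_mul, IsTower.D_pairing, h.ψ_succ a, h.pairing_succ i b,
        (h.homog_ψ 0).mul_comm (h.homog_pairing a 0), ← mul_assoc f, c4, c3, c2]
      rw [(h.homog_ψ a).mul_comm (h.homog_φ b), smul_mul_assoc, smul_mul_assoc, c1]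
      simp only [mul_add, add_mul, mul_smul_comm, smul_mul_assoc, mul_assoc, mul_neg]
      rcases neg_one_pow_eq_or ℤ a with ha | ha <;> rcases neg_one_pow_eq_or ℤ b with hb | hb <;>
        rcases neg_one_pow_eq_or ℤ i with hi | hi <;>
        simp [ha, hb, hi, pow_add, pow_mul] <;> abel
    rw [Finset.sum_add_distrib, ht] at key
    simp only [Finset.sum_add_distrib, Finset.sum_sub_distrib, Finset.sum_neg_distrib] at key
    rw [h.ψ_succ i, map_zsmul, map_add, map_add, map_neg, hV.map_D, hV.leibniz h.homog_f,
      hV.leibniz (h.homog_ψ 0), ih, hσ, hf, hV.map_ψ_zero,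
      show i + 1 + (p + 1) = i + (p + 1) + 1 by ring, h.ψ_succ (i + (p + 1))]
    have hm := (h.homog_ψ (p + 1)).mul_comm (h.homog_pairing i 0)
    have hm' := (h.homog_ψ 0).mul_comm (h.homog_pairing i (p + 1))
    clear hf hσ ht ih hV
    simp only [zero_add, mul_one, mul_zero, add_zero, zero_mul, pow_zero, one_smul] at key hm hm' ⊢
    generalize p + 1 = m at key hm hm' ⊢
    -- The recursion for ψ_(i+1) carries a global sign (-1)^i; inserting its square here lets that
    -- sign be distributed over the goal and over `key`.
    rw [← zsmul_neg_one_pow_self i (∑ x ∈ antidiagonal p,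
      (-1 : ℤ) ^ (m * (i + 1) + m * x.1 + (i + 1) + x.2) •
        (pairing 𝕜 φ ψ (i + 1) x.2 * ψ x.1))]
    replace key := congrArg (fun y => (-1 : ℤ) ^ i • y) key
    simp only [map_add, map_neg, map_zsmul, map_sum, mul_sub, mul_neg, mul_add, add_mul, smul_sub,
      smul_add, hm, hm', smul_neg, mul_smul_comm, smul_mul_assoc, smul_smul, ← pow_add,
      Finset.mul_sum, Finset.sum_mul, Finset.smul_sum, neg_mul, mul_one] at key ⊢
    have s1 : (-1 : ℤ) ^ (i + (m + m)) = (-1) ^ i :=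
      neg_one_pow_congr (by simp only [Nat.even_add]; tauto)
    have s2 : (-1 : ℤ) ^ (m + (i + m)) = (-1) ^ i :=
      neg_one_pow_congr (by simp only [Nat.even_add]; tauto)
    have s3 : (-1 : ℤ) ^ (i + (m + (m * i + m))) = (-1) ^ (i + m * i) :=
      neg_one_pow_congr (by simp only [Nat.even_add]; tauto)
    have s4 : (-1 : ℤ) ^ (i + (m * i + m * m + m)) = (-1) ^ (i + m * i) :=
      neg_one_pow_congr (by simp only [Nat.even_add, Nat.even_mul]; tauto)
    rw [s4] at key
    rw [s1, s2, s3]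
    linear_combination (norm := module) key

theorem map_pairing (i k : ℕ) : V (pairing 𝕜 φ ψ i k) = -pairing 𝕜 φ ψ (i + (p + 1)) k +
    (-1 : ℤ) ^ ((p + 1) * (i + k)) • pairing 𝕜 φ ψ i (k + (p + 1)) -
      ∑ x ∈ antidiagonal p, (-1 : ℤ) ^ ((p + 1) * (1 + i + x.1)) •
        (pairing 𝕜 φ ψ i x.2 * pairing 𝕜 φ ψ x.1 k) :=
  map_pairing_aux hV h i k (map_φ hV h k) (map_ψ hV h i)

end IsTowerFlow
end Tower
-- Supercommutators of two flows on φ₀ and ψ₀.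
section Commutators

open Finset.HasAntidiagonal

variable {𝕜 : Type u} {A : Type v} [Field 𝕜] [NonUnitalRing A] [Module 𝕜 A]
  [SuperfieldAlgebra 𝕜 A]

/-- The pairs a+b = p+q+1 split into those with a ≤ p and those with a ≥ p+1; this is how sums of
levels p and q combine into one of level p+q+1. -/
theorem sum_antidiagonal_add_succ {M : Type*} [AddCommMonoid M] (p q : ℕ) (F : ℕ → ℕ → M) :
    ∑ x ∈ antidiagonal (p + q + 1), F x.1 x.2 =
      ∑ x ∈ antidiagonal p, F x.1 (x.2 + (q + 1)) +
        ∑ x ∈ antidiagonal q, F (x.1 + (p + 1)) x.2 := by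
  induction p generalizing F with
  | zero =>
    rw [zero_add, Finset.Nat.sum_antidiagonal_succ]
    simp
  | succ p ih =>
    rw [show p + 1 + q + 1 = p + q + 1 + 1 by ring, Finset.Nat.sum_antidiagonal_succ,
      Finset.Nat.sum_antidiagonal_succ (n := p)]
    have h := ih (fun i j => F (i + 1) j)
    simp only at h ⊢
    rw [h, ← add_assoc, show p + q + 1 + 1 = p + 1 + (q + 1) by ring]
    refine congrArg₂ _ rfl (Finset.sum_congr rfl fun x _ => ?_)
    rw [add_assoc]

namespace IsTowerFlow

variable {φ ψ : ℕ → A} {f : A} {p q : ℕ} {V W : A →ₗ[𝕜] A}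

/-- The terms are grouped so that both double sums, and both sums with second pairing index p+1 or
q+1, are exchanged up to the sign (-1)^((p+1)(q+1)) when the flows are swapped; these cancel in the
supercommutator. -/
theorem map_map_φ (hV : IsTowerFlow φ ψ p V) (hW : IsTowerFlow φ ψ q W) (h : IsTower 𝕜 φ ψ f) :
    W (V (φ 0)) = (-1 : ℤ) ^ ((p + 1) + (q + 1) + (p + 1) * (q + 1)) • φ (p + q + 2) -
      ∑ y ∈ antidiagonal q, (-1 : ℤ) ^ ((p + 1) + (q + 1) * y.1) •
        (φ y.2 * pairing 𝕜 φ ψ y.1 (p + 1)) -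
      ∑ x ∈ antidiagonal p, (-1 : ℤ) ^ ((p + 1) * x.1 + (q + 1) * x.2 + (q + 1)) •
        (φ (x.2 + (q + 1)) * pairing 𝕜 φ ψ x.1 0) +
      ∑ x ∈ antidiagonal p, ∑ y ∈ antidiagonal q, (-1 : ℤ) ^ ((p + 1) * x.1 + (q + 1) * y.1) •
        (φ y.2 * (pairing 𝕜 φ ψ y.1 x.2 * pairing 𝕜 φ ψ x.1 0)) +
      ∑ x ∈ antidiagonal p, (-1 : ℤ) ^ ((p + 1) * x.1 + (q + 1) * x.2) •
        (φ x.2 * pairing 𝕜 φ ψ (x.1 + (q + 1)) 0) -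
      (-1 : ℤ) ^ ((p + 1) * (q + 1)) • ∑ x ∈ antidiagonal p,
        (-1 : ℤ) ^ ((q + 1) + (p + 1) * x.1) • (φ x.2 * pairing 𝕜 φ ψ x.1 (q + 1)) +
      (-1 : ℤ) ^ ((p + 1) * (q + 1)) • ∑ y ∈ antidiagonal q, ∑ x ∈ antidiagonal p,
        (-1 : ℤ) ^ ((q + 1) * y.1 + (p + 1) * x.1) •
          (φ x.2 * (pairing 𝕜 φ ψ x.1 y.2 * pairing 𝕜 φ ψ y.1 0)) := by
  have key : ∀ x ∈ antidiagonal p,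
      W ((-1 : ℤ) ^ ((p + 1) * x.1) • (φ x.2 * pairing 𝕜 φ ψ x.1 0)) =
        (-1 : ℤ) ^ ((p + 1) * x.1 + (q + 1) * x.2 + (q + 1)) •
          (φ (x.2 + (q + 1)) * pairing 𝕜 φ ψ x.1 0) -
        ∑ y ∈ antidiagonal q, (-1 : ℤ) ^ ((p + 1) * x.1 + (q + 1) * y.1) •
          (φ y.2 * (pairing 𝕜 φ ψ y.1 x.2 * pairing 𝕜 φ ψ x.1 0)) -
        (-1 : ℤ) ^ ((p + 1) * x.1 + (q + 1) * x.2) •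
          (φ x.2 * pairing 𝕜 φ ψ (x.1 + (q + 1)) 0) +
        (-1 : ℤ) ^ ((p + 1) * (q + 1)) •
          (-1 : ℤ) ^ ((q + 1) + (p + 1) * x.1) • (φ x.2 * pairing 𝕜 φ ψ x.1 (q + 1)) -
        (-1 : ℤ) ^ ((p + 1) * (q + 1)) • ∑ y ∈ antidiagonal q,
          (-1 : ℤ) ^ ((q + 1) * y.1 + (p + 1) * x.1) •
            (φ x.2 * (pairing 𝕜 φ ψ x.1 y.2 * pairing 𝕜 φ ψ y.1 0)) := by
    rintro ⟨a, b⟩ hx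
    obtain rfl := mem_antidiagonal.1 hx
    rw [map_zsmul, hW.leibniz (h.homog_φ b), map_φ hW h, map_pairing hW h]
    simp only [Finset.mul_sum, Finset.sum_mul, mul_sub, sub_mul, mul_add, mul_neg, mul_smul_comm,
      smul_mul_assoc, mul_assoc, zero_add, add_zero]
    rcases neg_one_pow_eq_or ℤ a with ha | ha <;> rcases neg_one_pow_eq_or ℤ b with hb | hb <;>
      rcases neg_one_pow_eq_or ℤ q with hq | hq <;>
      simp [ha, hb, hq, pow_add, pow_mul] <;> abel
  rw [hV.map_φ_zero, map_sub, map_sum, Finset.sum_congr rfl key, map_zsmul, map_φ hW h]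
  simp only [Finset.sum_add_distrib, Finset.sum_sub_distrib, smul_sub, Finset.smul_sum, smul_smul,
    ← pow_add]
  rw [Finset.sum_comm (s := antidiagonal q) (t := antidiagonal p),
    show p + 1 + (q + 1) = p + q + 2 by ring,
    neg_one_pow_congr (show Even (p + 1 + (q + 1) * (p + 1 + 1)) ↔
      Even (p + q + 2 + (p + 1) * (q + 1)) by
        simp only [Nat.even_add, Nat.even_mul, Nat.even_add_one]; tauto)]
  abel

theorem map_map_ψ (hV : IsTowerFlow φ ψ p V) (hW : IsTowerFlow φ ψ q W) (h : IsTower 𝕜 φ ψ f) :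
    W (V (ψ 0)) = (-1 : ℤ) ^ ((p + 1) + (q + 1)) • ψ (p + q + 2) -
      (-1 : ℤ) ^ ((p + 1) * (q + 1)) • ∑ y ∈ antidiagonal q,
        (-1 : ℤ) ^ ((q + 1) * y.1 + y.2) • (pairing 𝕜 φ ψ (p + 1) y.2 * ψ y.1) -
      ∑ x ∈ antidiagonal p,
        (-1 : ℤ) ^ ((p + 1) * x.1 + x.2) • (pairing 𝕜 φ ψ (q + 1) x.2 * ψ x.1) +
      ∑ x ∈ antidiagonal p, (-1 : ℤ) ^ ((p + 1) * x.1 + x.2 + (q + 1) * x.2) •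
        (pairing 𝕜 φ ψ 0 (x.2 + (q + 1)) * ψ x.1) -
      ∑ x ∈ antidiagonal p, (-1 : ℤ) ^ ((p + 1) * x.1 + x.2 + (q + 1) * x.2) •
        (pairing 𝕜 φ ψ 0 x.2 * ψ (x.1 + (q + 1))) -
      ∑ x ∈ antidiagonal p, ∑ y ∈ antidiagonal q,
        (-1 : ℤ) ^ ((p + 1) * x.1 + x.2 + (q + 1) * y.1 + (q + 1)) •
          (pairing 𝕜 φ ψ 0 y.2 * (pairing 𝕜 φ ψ y.1 x.2 * ψ x.1)) -
      (-1 : ℤ) ^ ((p + 1) * (q + 1)) • ∑ y ∈ antidiagonal q, ∑ x ∈ antidiagonal p,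
        (-1 : ℤ) ^ ((q + 1) * y.1 + y.2 + (p + 1) * x.1 + (p + 1)) •
          (pairing 𝕜 φ ψ 0 x.2 * (pairing 𝕜 φ ψ x.1 y.2 * ψ y.1)) := by
  have key : ∀ x ∈ antidiagonal p,
      W ((-1 : ℤ) ^ ((p + 1) * x.1 + x.2) • (pairing 𝕜 φ ψ 0 x.2 * ψ x.1)) =
        -((-1 : ℤ) ^ ((p + 1) * x.1 + x.2) • (pairing 𝕜 φ ψ (q + 1) x.2 * ψ x.1)) +
        (-1 : ℤ) ^ ((p + 1) * x.1 + x.2 + (q + 1) * x.2) •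
          (pairing 𝕜 φ ψ 0 (x.2 + (q + 1)) * ψ x.1) -
        (-1 : ℤ) ^ ((p + 1) * x.1 + x.2 + (q + 1) * x.2) •
          (pairing 𝕜 φ ψ 0 x.2 * ψ (x.1 + (q + 1))) -
        ∑ y ∈ antidiagonal q,
          (-1 : ℤ) ^ ((p + 1) * x.1 + x.2 + (q + 1) * y.1 + (q + 1)) •
            (pairing 𝕜 φ ψ 0 y.2 * (pairing 𝕜 φ ψ y.1 x.2 * ψ x.1)) -
        (-1 : ℤ) ^ ((p + 1) * (q + 1)) • ∑ y ∈ antidiagonal q,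
          (-1 : ℤ) ^ ((q + 1) * y.1 + y.2 + (p + 1) * x.1 + (p + 1)) •
            (pairing 𝕜 φ ψ 0 x.2 * (pairing 𝕜 φ ψ x.1 y.2 * ψ y.1)) := by
    rintro ⟨a, b⟩ hx
    obtain rfl := mem_antidiagonal.1 hx
    rw [map_zsmul, hW.leibniz (h.homog_pairing 0 b), map_ψ hW h, map_pairing hW h]
    simp only [Finset.mul_sum, Finset.sum_mul, sub_mul, mul_add, add_mul, mul_neg, neg_mul,
      mul_smul_comm, smul_mul_assoc, mul_assoc, zero_add, add_zero]
    rcases neg_one_pow_eq_or ℤ a with ha | ha <;> rcases neg_one_pow_eq_or ℤ b with hb | hb <;>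
      rcases neg_one_pow_eq_or ℤ q with hq | hq <;>
      simp [ha, hb, hq, pow_add, pow_mul] <;> abel
  rw [hV.map_ψ_zero, map_add, map_sum, Finset.sum_congr rfl key, map_neg, map_zsmul, map_ψ hW h]
  have hs : (-1 : ℤ) ^ (p + 1) • ∑ x ∈ antidiagonal q,
      (-1 : ℤ) ^ ((q + 1) * (p + 1) + (q + 1) * x.1 + (p + 1) + x.2) •
        (pairing 𝕜 φ ψ (p + 1) x.2 * ψ x.1) =
      (-1 : ℤ) ^ ((p + 1) * (q + 1)) • ∑ y ∈ antidiagonal q,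
        (-1 : ℤ) ^ ((q + 1) * y.1 + y.2) • (pairing 𝕜 φ ψ (p + 1) y.2 * ψ y.1) := by
    rw [Finset.smul_sum, Finset.smul_sum]
    refine Finset.sum_congr rfl fun y _ => ?_
    rw [smul_smul, smul_smul, ← pow_add, ← pow_add]
    refine zsmul_neg_one_pow_congr ?_ _
    simp only [Nat.even_add, Nat.even_mul, Nat.even_add_one]
    tauto
  rw [smul_add, hs]
  simp only [Finset.sum_add_distrib, Finset.sum_sub_distrib, Finset.sum_neg_distrib, smul_neg,
    Finset.smul_sum, smul_smul, ← pow_add]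
  rw [Finset.sum_comm (s := antidiagonal q) (t := antidiagonal p),
    show p + 1 + (q + 1) = p + q + 2 by ring]
  abel

/-- The sums surviving the cancellation have either φ or ψ shifted by a full level. Splitting the
sum of level p+q+1 at p (`e1`) and at q (`e2`) matches them in pairs. -/
theorem supercommutator_φ (hV : IsTowerFlow φ ψ p V) (hW : IsTowerFlow φ ψ q W)
    (h : IsTower 𝕜 φ ψ f) :
    W (V (φ 0)) - (-1 : ℤ) ^ ((p + 1) * (q + 1)) • V (W (φ 0)) =
      ((-1 : ℤ) ^ ((p + 1) * (q + 1)) - 1) • ((-1 : ℤ) ^ (p + q) • φ (p + q + 2) +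
        ∑ x ∈ antidiagonal (p + q + 1),
          (-1 : ℤ) ^ ((p + 1) * x.1 + (q + 1) * x.2) • (φ x.2 * pairing 𝕜 φ ψ x.1 0)) := by
  have e1 : ∑ x ∈ antidiagonal (p + q + 1),
      (-1 : ℤ) ^ ((p + 1) * x.1 + (q + 1) * x.2) • (φ x.2 * pairing 𝕜 φ ψ x.1 0) =
      ∑ x ∈ antidiagonal p, (-1 : ℤ) ^ ((p + 1) * x.1 + (q + 1) * x.2 + (q + 1)) •
        (φ (x.2 + (q + 1)) * pairing 𝕜 φ ψ x.1 0) +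
      (-1 : ℤ) ^ ((p + 1) * (q + 1)) • ∑ x ∈ antidiagonal q,
        (-1 : ℤ) ^ ((q + 1) * x.1 + (p + 1) * x.2) •
          (φ x.2 * pairing 𝕜 φ ψ (x.1 + (p + 1)) 0) := by
    rw [sum_antidiagonal_add_succ p q (fun i j =>
      (-1 : ℤ) ^ ((p + 1) * i + (q + 1) * j) • (φ j * pairing 𝕜 φ ψ i 0)), Finset.smul_sum]
    refine congrArg₂ _ (Finset.sum_congr rfl fun x _ => zsmul_neg_one_pow_congr ?_ _)
      (Finset.sum_congr rfl fun x hx => ?_)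
    · simp only [Nat.even_add, Nat.even_mul, Nat.even_add_one]
      tauto
    · obtain rfl := mem_antidiagonal.1 hx
      rw [smul_smul, ← pow_add]
      refine zsmul_neg_one_pow_congr ?_ _
      by_cases hx1 : Even x.1 <;> by_cases hx2 : Even x.2 <;> by_cases hp : Even p <;>
        simp [Nat.even_add, Nat.even_mul, hx1, hx2, hp]
  have e2 : ∑ x ∈ antidiagonal (p + q + 1),
      (-1 : ℤ) ^ ((p + 1) * x.1 + (q + 1) * x.2) • (φ x.2 * pairing 𝕜 φ ψ x.1 0) =
      ∑ x ∈ antidiagonal q, (-1 : ℤ) ^ ((q + 1) * x.1 + (p + 1) * x.2 + (p + 1)) •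
        (φ (x.2 + (p + 1)) * pairing 𝕜 φ ψ x.1 0) +
      (-1 : ℤ) ^ ((p + 1) * (q + 1)) • ∑ x ∈ antidiagonal p,
        (-1 : ℤ) ^ ((p + 1) * x.1 + (q + 1) * x.2) •
          (φ x.2 * pairing 𝕜 φ ψ (x.1 + (q + 1)) 0) := by
    rw [add_comm p q, sum_antidiagonal_add_succ q p (fun i j =>
      (-1 : ℤ) ^ ((p + 1) * i + (q + 1) * j) • (φ j * pairing 𝕜 φ ψ i 0)), Finset.smul_sum]
    refine congrArg₂ _ (Finset.sum_congr rfl fun x hx => ?_)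
      (Finset.sum_congr rfl fun x hx => ?_)
    · obtain rfl := mem_antidiagonal.1 hx
      refine zsmul_neg_one_pow_congr ?_ _
      by_cases hx1 : Even x.1 <;> by_cases hx2 : Even x.2 <;> by_cases hp : Even p <;>
        simp [Nat.even_add, Nat.even_mul, hx1, hx2, hp]
    · rw [smul_smul, ← pow_add]
      refine zsmul_neg_one_pow_congr ?_ _
      by_cases hx1 : Even x.1 <;> by_cases hx2 : Even x.2 <;> by_cases hp : Even p <;>
        by_cases hq : Even q <;> simp [Nat.even_add, Nat.even_mul, hx1, hx2, hp, hq]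
  have s1 : (-1 : ℤ) ^ (p + q) = (-1) ^ (p + 1 + (q + 1)) :=
    neg_one_pow_congr (by simp only [Nat.even_add, Nat.even_add_one]; tauto)
  rw [map_map_φ hV hW h, map_map_φ hW hV h, add_comm q p, mul_comm (q + 1) (p + 1),
    add_comm (q + 1) (p + 1), s1, sub_smul ((-1 : ℤ) ^ ((p + 1) * (q + 1))) 1, smul_add, one_smul,
    e1]
  -- The copy carrying the sign is to be split by `e2`, the other one stays split by `e1`.
  nth_rewrite 1 [← e1]
  rw [e2, pow_add _ (p + 1 + (q + 1))]
  rcases neg_one_pow_eq_or ℤ ((p + 1) * (q + 1)) with hs | hs <;> rw [hs] <;> module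

theorem supercommutator_ψ (hV : IsTowerFlow φ ψ p V) (hW : IsTowerFlow φ ψ q W)
    (h : IsTower 𝕜 φ ψ f) :
    W (V (ψ 0)) - (-1 : ℤ) ^ ((p + 1) * (q + 1)) • V (W (ψ 0)) =
      (1 - (-1 : ℤ) ^ ((p + 1) * (q + 1))) • ((-1 : ℤ) ^ (p + q) • ψ (p + q + 2) +
        ∑ x ∈ antidiagonal (p + q + 1),
          (-1 : ℤ) ^ ((p + 1) * x.1 + (q + 1) * x.2 + x.2) •
            (pairing 𝕜 φ ψ 0 x.2 * ψ x.1)) := by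
  have e1 : ∑ x ∈ antidiagonal (p + q + 1),
      (-1 : ℤ) ^ ((p + 1) * x.1 + (q + 1) * x.2 + x.2) • (pairing 𝕜 φ ψ 0 x.2 * ψ x.1) =
      ∑ x ∈ antidiagonal p, (-1 : ℤ) ^ ((p + 1) * x.1 + x.2 + (q + 1) * x.2) •
        (pairing 𝕜 φ ψ 0 (x.2 + (q + 1)) * ψ x.1) +
      (-1 : ℤ) ^ ((p + 1) * (q + 1)) • ∑ x ∈ antidiagonal q,
        (-1 : ℤ) ^ ((q + 1) * x.1 + x.2 + (p + 1) * x.2) •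
          (pairing 𝕜 φ ψ 0 x.2 * ψ (x.1 + (p + 1))) := by
    rw [sum_antidiagonal_add_succ p q (fun i j =>
      (-1 : ℤ) ^ ((p + 1) * i + (q + 1) * j + j) • (pairing 𝕜 φ ψ 0 j * ψ i)), Finset.smul_sum]
    refine congrArg₂ _ (Finset.sum_congr rfl fun x _ => zsmul_neg_one_pow_congr ?_ _)
      (Finset.sum_congr rfl fun x hx => ?_)
    · simp only [Nat.even_add, Nat.even_mul, Nat.even_add_one]
      tauto
    · obtain rfl := mem_antidiagonal.1 hx
      rw [smul_smul, ← pow_add]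
      refine zsmul_neg_one_pow_congr ?_ _
      by_cases hx1 : Even x.1 <;> by_cases hx2 : Even x.2 <;> by_cases hp : Even p <;>
        simp [Nat.even_add, Nat.even_mul, hx1, hx2, hp]
  have e2 : ∑ x ∈ antidiagonal (p + q + 1),
      (-1 : ℤ) ^ ((p + 1) * x.1 + (q + 1) * x.2 + x.2) • (pairing 𝕜 φ ψ 0 x.2 * ψ x.1) =
      ∑ x ∈ antidiagonal q, (-1 : ℤ) ^ ((q + 1) * x.1 + x.2 + (p + 1) * x.2) •
        (pairing 𝕜 φ ψ 0 (x.2 + (p + 1)) * ψ x.1) +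
      (-1 : ℤ) ^ ((p + 1) * (q + 1)) • ∑ x ∈ antidiagonal p,
        (-1 : ℤ) ^ ((p + 1) * x.1 + x.2 + (q + 1) * x.2) •
          (pairing 𝕜 φ ψ 0 x.2 * ψ (x.1 + (q + 1))) := by
    rw [add_comm p q, sum_antidiagonal_add_succ q p (fun i j =>
      (-1 : ℤ) ^ ((p + 1) * i + (q + 1) * j + j) • (pairing 𝕜 φ ψ 0 j * ψ i)), Finset.smul_sum]
    refine congrArg₂ _ (Finset.sum_congr rfl fun x hx => ?_)
      (Finset.sum_congr rfl fun x hx => ?_)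
    · obtain rfl := mem_antidiagonal.1 hx
      refine zsmul_neg_one_pow_congr ?_ _
      by_cases hx1 : Even x.1 <;> by_cases hx2 : Even x.2 <;> by_cases hp : Even p <;>
        simp [Nat.even_add, Nat.even_mul, hx1, hx2, hp]
    · rw [smul_smul, ← pow_add]
      refine zsmul_neg_one_pow_congr ?_ _
      by_cases hx1 : Even x.1 <;> by_cases hx2 : Even x.2 <;> by_cases hp : Even p <;>
        by_cases hq : Even q <;> simp [Nat.even_add, Nat.even_mul, hx1, hx2, hp, hq]
  have s1 : (-1 : ℤ) ^ (p + q) = (-1) ^ (p + 1 + (q + 1)) :=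
    neg_one_pow_congr (by simp only [Nat.even_add, Nat.even_add_one]; tauto)
  rw [map_map_ψ hV hW h, map_map_ψ hW hV h, add_comm q p, mul_comm (q + 1) (p + 1),
    add_comm (q + 1) (p + 1), s1, sub_smul 1, smul_add ((-1 : ℤ) ^ ((p + 1) * (q + 1))), one_smul,
    e1]
  nth_rewrite 2 [← e1]
  rw [e2]
  rcases neg_one_pow_eq_or ℤ ((p + 1) * (q + 1)) with hs | hs <;> rw [hs] <;> module

end IsTowerFlow
end Commutators
-- Calculus of integral operators a 𝒟⁻¹ b.
section Kernels

variable {𝕜 : Type u} {A : Type v} [Field 𝕜] [NonUnitalRing A] [Module 𝕜 A]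
  [IsScalarTower 𝕜 A A] [SMulCommClass 𝕜 A A] [SuperfieldAlgebra 𝕜 A]

namespace SPDO

variable (𝕜) in
/-- The operator `a 𝒟⁻¹ b`. -/
noncomputable def kernel : A →+ A →+ SPDO 𝕜 A :=
  AddMonoidHom.mk' (fun a => AddMonoidHom.mk' (fun b => fnOp 𝕜 A a * dInv 𝕜 A * fnOp 𝕜 A b)
    fun b c => by rw [map_add, mul_add])
    fun a b => by ext c : 1; simp [add_mul]

theorem kernel_apply (a b : A) : kernel 𝕜 a b = fnOp 𝕜 A a * dInv 𝕜 A * fnOp 𝕜 A b := rfl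

theorem kernel_zsmul_left (c : ℤ) (a b : A) : kernel 𝕜 (c • a) b = c • kernel 𝕜 a b := by
  rw [map_zsmul]; rfl

theorem kernel_add_left (a a' b : A) : kernel 𝕜 (a + a') b = kernel 𝕜 a b + kernel 𝕜 a' b := by
  rw [map_add]; rfl

theorem kernel_sub_left (a a' b : A) : kernel 𝕜 (a - a') b = kernel 𝕜 a b - kernel 𝕜 a' b := by
  rw [map_sub]; rfl

theorem kernel_sum_left {ι : Type*} (s : Finset ι) (a : ι → A) (b : A) :
    kernel 𝕜 (∑ x ∈ s, a x) b = ∑ x ∈ s, kernel 𝕜 (a x) b := by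
  rw [map_sum, AddMonoidHom.finsetSum_apply]

theorem dOp_mul_kernel (a b : A) :
    dOp 𝕜 A * kernel 𝕜 a b = kernel 𝕜 (D 𝕜 a) b + fnOp 𝕜 A (par 𝕜 a * b) := by
  rw [kernel_apply, kernel_apply, ← mul_assoc, ← mul_assoc, dOp_mul_fnOp, add_mul, add_mul,
    mul_assoc _ (dOp 𝕜 A), dOp_mul_dInv, mul_one, fnOp_mul]

theorem fnOp_mul_kernel (c a b : A) : fnOp 𝕜 A c * kernel 𝕜 a b = kernel 𝕜 (c * a) b := by
  rw [kernel_apply, kernel_apply, fnOp_mul]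
  simp only [mul_assoc]

theorem kernel_mul_dOp (a b : A) :
    kernel 𝕜 a b * dOp 𝕜 A = fnOp 𝕜 A (a * par 𝕜 b) - kernel 𝕜 a (D 𝕜 (par 𝕜 b)) := by
  rw [kernel_apply, kernel_apply, mul_assoc, mul_assoc, ← mul_assoc (dInv 𝕜 A),
    dInv_mul_fnOp_mul_dOp, mul_sub, fnOp_mul, mul_assoc]

theorem kernel_mul_fnOp (a b c : A) : kernel 𝕜 a b * fnOp 𝕜 A c = kernel 𝕜 a (b * c) := by
  rw [kernel_apply, kernel_apply, fnOp_mul, mul_assoc]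

theorem kernel_mul_kernel (a b c e : A) :
    kernel 𝕜 a b * kernel 𝕜 c e = kernel 𝕜 (a * (D 𝕜).symm (b * c)) e -
      kernel 𝕜 a (par 𝕜 ((D 𝕜).symm (b * c)) * e) := by
  have : kernel 𝕜 a b * kernel 𝕜 c e =
      fnOp 𝕜 A a * (dInv 𝕜 A * fnOp 𝕜 A (b * c) * dInv 𝕜 A) * fnOp 𝕜 A e := by
    simp only [kernel_apply, fnOp_mul, mul_assoc]
  rw [this, dInv_mul_fnOp_mul_dInv]
  simp only [kernel_apply, fnOp_mul, mul_assoc, mul_sub, sub_mul]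

theorem isInt_kernel (a b : A) : IsInt (kernel 𝕜 a b) := isInt_fnOp_mul_dInv_mul a b

/-- Multiplication on the right by `ε 𝒟 + f + u 𝒟⁻¹ w` of an operator whose integral part is a
finite sum of terms `a 𝒟⁻¹ b`. -/
theorem expansion_mul {ι : Type*} {s : Finset ι} {a b : ι → A} {P : SPDO 𝕜 A} {E : A → A}
    (hP : P.minus = ∑ x ∈ s, kernel 𝕜 (a x) (b x))
    (hE : ∀ g, P.applyPlus g = Unitization.inr (E g - ∑ x ∈ s, a x * (D 𝕜).symm (b x * g)))
    (ε : ℤ) (f u w : A) :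
    (P * (ε • dOp 𝕜 A + fnOp 𝕜 A f + kernel 𝕜 u w)).minus =
      ∑ x ∈ s, kernel 𝕜 (a x) (-(ε • D 𝕜 (par 𝕜 (b x))) + b x * f -
        par 𝕜 ((D 𝕜).symm (b x * u)) * w) + kernel 𝕜 (E u) w ∧
    ∀ g, (P * (ε • dOp 𝕜 A + fnOp 𝕜 A f + kernel 𝕜 u w)).applyPlus g =
      Unitization.inr (E (ε • D 𝕜 g + f * g + u * (D 𝕜).symm (w * g)) -
        (∑ x ∈ s, a x * (D 𝕜).symm ((-(ε • D 𝕜 (par 𝕜 (b x))) + b x * f -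
          par 𝕜 ((D 𝕜).symm (b x * u)) * w) * g) + E u * (D 𝕜).symm (w * g))) := by
  obtain ⟨R, hR, hR1, hR2⟩ := (isDiff_plus P).mul_dInv u
  have hpl : ∀ g : A, P.plus.applyPlus g = P.applyPlus g := fun g => act_plus P _
  -- The sum subtracted here cancels the last sum of `h1`, so that only the kernel with the full
  -- action E(u) survives.
  have hc : const 𝕜 A (P.applyPlus u) * dInv 𝕜 A * fnOp 𝕜 A w = kernel 𝕜 (E u) w -
      ∑ x ∈ s, kernel 𝕜 (a x * (D 𝕜).symm (b x * u)) w := by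
    rw [hE, ← kernel_sum_left, ← kernel_sub_left]
    rfl
  have hdec : P * (ε • dOp 𝕜 A + fnOp 𝕜 A f + kernel 𝕜 u w) =
      (ε • (P.plus * dOp 𝕜 A) + P.plus * fnOp 𝕜 A f + R * fnOp 𝕜 A w +
        ∑ x ∈ s, ε • fnOp 𝕜 A (a x * par 𝕜 (b x))) +
      (∑ x ∈ s, kernel 𝕜 (a x) (-(ε • D 𝕜 (par 𝕜 (b x))) + b x * f -
        par 𝕜 ((D 𝕜).symm (b x * u)) * w) + kernel 𝕜 (E u) w) := by
    have h1 : P.minus * (ε • dOp 𝕜 A + fnOp 𝕜 A f + kernel 𝕜 u w) =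
        ∑ x ∈ s, ε • fnOp 𝕜 A (a x * par 𝕜 (b x)) +
        ∑ x ∈ s, kernel 𝕜 (a x) (-(ε • D 𝕜 (par 𝕜 (b x))) + b x * f -
          par 𝕜 ((D 𝕜).symm (b x * u)) * w) +
        ∑ x ∈ s, kernel 𝕜 (a x * (D 𝕜).symm (b x * u)) w := by
      rw [hP, Finset.sum_mul, ← Finset.sum_add_distrib, ← Finset.sum_add_distrib]
      refine Finset.sum_congr rfl fun x _ => ?_
      rw [mul_add, mul_add, mul_smul_comm, kernel_mul_dOp, kernel_mul_fnOp, kernel_mul_kernel,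
        map_sub, map_add, map_neg, map_zsmul, smul_sub]
      abel
    have h2 := hR1 w
    rw [hpl, hc, ← kernel_apply] at h2
    conv_lhs => rw [← plus_add_minus P]
    rw [add_mul, h1, mul_add, mul_add, h2, mul_smul_comm]
    abel
  have hdiff : IsDiff (ε • (P.plus * dOp 𝕜 A) + P.plus * fnOp 𝕜 A f + R * fnOp 𝕜 A w +
      ∑ x ∈ s, ε • fnOp 𝕜 A (a x * par 𝕜 (b x))) :=
    ((((isDiff_plus P).mul isDiff_dOp).zsmul ε).add ((isDiff_plus P).mul (isDiff_fnOp f))).add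
      (hR.mul (isDiff_fnOp w)) |>.add (IsDiff.sum fun x _ => (isDiff_fnOp _).zsmul ε)
  have hint : IsInt (∑ x ∈ s, kernel 𝕜 (a x) (-(ε • D 𝕜 (par 𝕜 (b x))) + b x * f -
        par 𝕜 ((D 𝕜).symm (b x * u)) * w) + kernel 𝕜 (E u) w) :=
    (IsInt.sum fun x _ => isInt_kernel _ _).add (isInt_kernel _ _)
  refine ⟨minus_eq hdec hdiff hint, fun g => ?_⟩
  have h3 := hR2 w g
  rw [hpl, hpl, hE u, ← Unitization.inr_mul] at h3
  have h4 : P.applyPlus (ε • D 𝕜 g + f * g + u * (D 𝕜).symm (w * g)) =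
      ε • P.applyPlus (D 𝕜 g) + P.applyPlus (f * g) + P.applyPlus (u * (D 𝕜).symm (w * g)) := by
    simp only [applyPlus_eq_act, Unitization.inr_add, act_add_right]
    rw [← act_zsmul_right]
    congr 3
    exact map_zsmul (Unitization.inrHom 𝕜 𝕜 A) ε (D 𝕜 g)
  -- Integration by parts moves the right factor from g onto b; the last two terms are the boundary
  -- contributions.
  have h5 : ∀ x ∈ s, a x * (D 𝕜).symm (b x * (ε • D 𝕜 g + f * g + u * (D 𝕜).symm (w * g))) =
      a x * (D 𝕜).symm ((-(ε • D 𝕜 (par 𝕜 (b x))) + b x * f -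
          par 𝕜 ((D 𝕜).symm (b x * u)) * w) * g) +
        a x * (D 𝕜).symm (b x * u) * (D 𝕜).symm (w * g) + ε • (a x * par 𝕜 (b x) * g) := by
    intro x _
    rw [mul_assoc (a x), mul_assoc (a x), ← mul_smul_comm, ← mul_add, ← mul_add]
    congr 1
    apply (D 𝕜).injective
    rw [map_add, map_add, map_zsmul, LinearEquiv.apply_symm_apply, LinearEquiv.apply_symm_apply,
      SuperfieldAlgebra.D_mul, SuperfieldAlgebra.D_mul, SuperfieldAlgebra.par_par]
    change _ = _ + (D 𝕜 ((D 𝕜).symm _) * _ + par 𝕜 _ * D 𝕜 ((D 𝕜).symm _)) + _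
    rw [LinearEquiv.apply_symm_apply, LinearEquiv.apply_symm_apply]
    simp only [mul_add, sub_mul, add_mul, neg_mul, smul_mul_assoc, mul_smul_comm, smul_add,
      mul_assoc]
    change _ = -(ε • (D 𝕜 (par 𝕜 (b x)) * g)) + _ - _ + _ +
      (ε • (D 𝕜 (par 𝕜 (b x)) * g) + ε • (b x * D 𝕜 g))
    abel
  rw [hE, Finset.sum_congr rfl h5, Finset.sum_add_distrib, Finset.sum_add_distrib] at h4
  have h6 : (∑ x ∈ s, ε • fnOp 𝕜 A (a x * par 𝕜 (b x))).act (Unitization.inr g) =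
      Unitization.inr (∑ x ∈ s, ε • (a x * par 𝕜 (b x) * g)) := by
    rw [act_sum_left]
    refine Eq.trans ?_ (map_sum (Unitization.inrHom 𝕜 𝕜 A) _ s).symm
    refine Finset.sum_congr rfl fun x _ => ?_
    rw [act_zsmul_left, act_fnOp, ← Unitization.inr_mul]
    exact (map_zsmul (Unitization.inrHom 𝕜 𝕜 A) ε _).symm
  rw [applyPlus_eq_act, hdec, act_add_left, hint.act_eq_zero, add_zero, act_add_left, act_add_left,
    act_add_left, act_zsmul_left, (isDiff_plus P).act_mul isDiff_dOp,
    (isDiff_plus P).act_mul (isDiff_fnOp f), act_dOp, act_fnOp, cD_inr, ← Unitization.inr_mul,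
    act_plus, act_plus, ← applyPlus_eq_act, ← applyPlus_eq_act, h6, ← applyPlus_eq_act, h3,
    add_sub_assoc', ← h4, ← Unitization.inr_sub, ← Unitization.inr_add]
  congr 1
  rw [sub_mul, Finset.sum_mul]
  abel

end SPDO
end Kernels
-- Powers of L and of its conjugate: tower recursion and integral parts.
section LaxOperator

open Finset.HasAntidiagonal

variable {𝕜 : Type u} {A : Type v} [Field 𝕜] [NonUnitalRing A] [Module 𝕜 A]
  [SuperfieldAlgebra 𝕜 A] {Φ Ψ : A}

theorem apply_L (g : A) : (L 𝕜 Φ Ψ).apply 𝕜 g =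
    D 𝕜 g + f0 𝕜 Φ Ψ * g + Φ * (D 𝕜).symm (Ψ * g) := rfl

theorem apply_L_adj (g : A) : (L 𝕜 Φ Ψ).adj.apply 𝕜 g =
    -D 𝕜 g + f0 𝕜 Φ Ψ * g + Ψ * (D 𝕜).symm (Φ * g) := by
  simp [L, SOp.adj, SOp.apply, SOp.parity]

theorem parity_pow_L (k : ℕ) : ((L 𝕜 Φ Ψ).pow k).parity = k := by
  induction k with
  | zero => rfl
  | succ k ih =>
    rw [SOp.pow, SOp.parity, ih, Nat.cast_succ, add_comm]
    rfl

/-- The sign is that of exchanging the odd L with L^k, of parity k. -/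
theorem adj_pow_succ (k : ℕ) : ((L 𝕜 Φ Ψ).pow (k + 1)).adj =
    .smul ((-1) ^ k) (.comp ((L 𝕜 Φ Ψ).pow k).adj (L 𝕜 Φ Ψ).adj) := by
  rw [SOp.pow, SOp.adj, parity_pow_L]
  congr 1
  rcases Nat.even_or_odd k with hk | hk
  · rw [hk.neg_one_pow, if_neg]
    rintro ⟨-, h⟩
    rw [(ZMod.natCast_eq_zero_iff_even).2 hk] at h
    exact absurd h (by decide)
  · rw [hk.neg_one_pow, if_pos]
    exact ⟨rfl, (ZMod.natCast_eq_one_iff_odd).2 hk⟩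

theorem apply_add (P : SOp A) (g g' : A) : P.apply 𝕜 (g + g') = P.apply 𝕜 g + P.apply 𝕜 g' := by
  induction P generalizing g g' with
  | zero => simp [SOp.apply]
  | one => rfl
  | D => exact map_add _ _ _
  | Dinv => exact map_add _ _ _
  | fn p a => exact mul_add _ _ _
  | add P Q hP hQ => simp only [SOp.apply, hP, hQ]; abel
  | smul c P hP => simp only [SOp.apply, hP, smul_add]
  | comp P Q hP hQ => simp only [SOp.apply, hP, hQ]

theorem apply_zsmul (P : SOp A) (c : ℤ) (g : A) : P.apply 𝕜 (c • g) = c • P.apply 𝕜 g :=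
  map_zsmul (AddMonoidHom.mk' (fun g => P.apply 𝕜 g) (apply_add P)) c g

theorem apply_pow_L_apply_L (k : ℕ) (g : A) : ((L 𝕜 Φ Ψ).pow k).apply 𝕜 ((L 𝕜 Φ Ψ).apply 𝕜 g) =
    (L 𝕜 Φ Ψ).apply 𝕜 (((L 𝕜 Φ Ψ).pow k).apply 𝕜 g) := by
  induction k with
  | zero => rfl
  | succ k ih =>
    rw [SOp.pow, SOp.apply, ih]
    rfl

theorem apply_adj_pow_succ (k : ℕ) (g : A) : ((L 𝕜 Φ Ψ).pow (k + 1)).adj.apply 𝕜 g =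
    (-1 : ℤ) ^ k • ((L 𝕜 Φ Ψ).pow k).adj.apply 𝕜 ((L 𝕜 Φ Ψ).adj.apply 𝕜 g) := by
  rw [adj_pow_succ]; rfl

theorem apply_adj_pow_apply_adj (k : ℕ) (g : A) :
    ((L 𝕜 Φ Ψ).pow k).adj.apply 𝕜 ((L 𝕜 Φ Ψ).adj.apply 𝕜 g) =
      (L 𝕜 Φ Ψ).adj.apply 𝕜 (((L 𝕜 Φ Ψ).pow k).adj.apply 𝕜 g) := by
  induction k generalizing g with
  | zero => rfl
  | succ k ih => rw [apply_adj_pow_succ, apply_adj_pow_succ, ih, ih, apply_zsmul]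

theorem LΦ_zero : LΦ 𝕜 Φ Ψ 0 = Φ := rfl
theorem LΨ_zero : LΨ 𝕜 Φ Ψ 0 = Ψ := rfl

theorem LΨ_succ (k : ℕ) : LΨ 𝕜 Φ Ψ (k + 1) =
    (-1 : ℤ) ^ k • (L 𝕜 Φ Ψ).adj.apply 𝕜 (LΨ 𝕜 Φ Ψ k) := by
  rw [LΨ, apply_adj_pow_succ, apply_adj_pow_apply_adj]; rfl

theorem isHomog_zero_iff {a : A} : IsHomog 𝕜 0 a ↔ par 𝕜 a = a := by simp [IsHomog]

theorem isTower_L (hΦ : par 𝕜 Φ = Φ) (hΨ : par 𝕜 Ψ = Ψ) :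
    IsTower 𝕜 (LΦ 𝕜 Φ Ψ) (LΨ 𝕜 Φ Ψ) (f0 𝕜 Φ Ψ) := by
  rw [← isHomog_zero_iff] at hΦ hΨ
  have hf : IsHomog 𝕜 1 (f0 𝕜 Φ Ψ) := (hΦ.mul hΨ).Dinv.zsmul _
  have h1 : ∀ k, IsHomog 𝕜 k (LΦ 𝕜 Φ Ψ k) := fun k => by
    induction k with
    | zero => exact hΦ
    | succ k ih =>
      change IsHomog 𝕜 (k + 1) ((L 𝕜 Φ Ψ).apply 𝕜 (LΦ 𝕜 Φ Ψ k))
      rw [apply_L]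
      refine (ih.D.add ((hf.mul ih).congr ?_)).add ((hΦ.mul (hΨ.mul ih).Dinv).congr ?_) <;>
        simp [Nat.even_add]
  have h2 : ∀ k, IsHomog 𝕜 k (LΨ 𝕜 Φ Ψ k) := fun k => by
    induction k with
    | zero => exact hΨ
    | succ k ih =>
      rw [LΨ_succ, apply_L_adj]
      refine ((ih.D.neg.add ((hf.mul ih).congr ?_)).add
        ((hΨ.mul (hΦ.mul ih).Dinv).congr ?_)).zsmul _ <;>
        simp [Nat.even_add]
  refine ⟨h1, h2, ?_, fun k => rfl, fun k => ?_⟩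
  · rw [f0, pairing, LΦ_zero, LΨ_zero, hΦ.mul_comm hΨ]
    simp
  · rw [LΨ_succ, apply_L_adj, pairing, LΦ_zero, hΦ.mul_comm (h2 k)]
    simp [LΨ_zero]

variable [IsScalarTower 𝕜 A A] [SMulCommClass 𝕜 A A]

open SPDO

theorem toSPDO_L : (L 𝕜 Φ Ψ).toSPDO 𝕜 =
    (1 : ℤ) • dOp 𝕜 A + fnOp 𝕜 A (f0 𝕜 Φ Ψ) + kernel 𝕜 Φ Ψ := by
  rw [one_smul, kernel_apply, mul_assoc]
  rfl

theorem toSPDO_L_adj : (L 𝕜 Φ Ψ).adj.toSPDO 𝕜 =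
    (-1 : ℤ) • dOp 𝕜 A + fnOp 𝕜 A (f0 𝕜 Φ Ψ) + kernel 𝕜 Ψ Φ := by
  rw [kernel_apply]
  simp only [L, SOp.adj, SOp.toSPDO, SOp.parity]
  simp
  rfl

theorem Lpow_succ (k : ℕ) : Lpow 𝕜 Φ Ψ (k + 1) = Lpow 𝕜 Φ Ψ 1 * Lpow 𝕜 Φ Ψ k := by
  have h1 : Lpow 𝕜 Φ Ψ 1 = (L 𝕜 Φ Ψ).toSPDO 𝕜 := mul_one ((L 𝕜 Φ Ψ).toSPDO 𝕜)
  rw [h1]; rfl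

theorem Lpow_one : Lpow 𝕜 Φ Ψ 1 = (L 𝕜 Φ Ψ).toSPDO 𝕜 := mul_one ((L 𝕜 Φ Ψ).toSPDO 𝕜)

theorem Lpow_eq_pow (k : ℕ) : Lpow 𝕜 Φ Ψ k = Lpow 𝕜 Φ Ψ 1 ^ k := by
  induction k with
  | zero => rfl
  | succ k ih => rw [Lpow_succ, ih, pow_succ']

theorem LpowAdj_succ (k : ℕ) : LpowAdj 𝕜 Φ Ψ (k + 1) =
    (-1 : ℤ) ^ k • (LpowAdj 𝕜 Φ Ψ k * (L 𝕜 Φ Ψ).adj.toSPDO 𝕜) := by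
  rw [LpowAdj, adj_pow_succ]; rfl

theorem one_minus : (1 : SPDO 𝕜 A).minus = 0 :=
  minus_eq (add_zero 1).symm (map_one (const 𝕜 A) ▸ isDiff_const 1) fun _ _ => rfl

theorem one_applyPlus (g : A) : (1 : SPDO 𝕜 A).applyPlus g = Unitization.inr g := by
  rw [applyPlus_eq_act, ← map_one (const 𝕜 A), act_const, one_mul]

theorem minus_zsmul (c : ℤ) (P : SPDO 𝕜 A) : (c • P).minus = c • P.minus := ext_coeff fun n => by
  simp only [coeff_minus, coeff_zsmul]
  split_ifs <;> simp

theorem inr_zsmul (c : ℤ) (a : A) : (Unitization.inr (c • a) : Coef 𝕜 A) = c • Unitization.inr a :=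
  map_zsmul (Unitization.inrHom 𝕜 𝕜 A) c a

/-- Induction by right multiplication with L: `expansion_mul` sends each right factor ψ_a to
ψ_(a+1). The second part links the action of the truncated formal series with that of the full
expression, in which 𝒟⁻¹ acts on superfields. -/
theorem Lpow_expansion (hΦ : par 𝕜 Φ = Φ) (hΨ : par 𝕜 Ψ = Ψ) (p : ℕ) :
    (Lpow 𝕜 Φ Ψ (p + 1)).minus =
      ∑ x ∈ antidiagonal p, kernel 𝕜 (LΦ 𝕜 Φ Ψ x.2) (LΨ 𝕜 Φ Ψ x.1) ∧
    ∀ g, (Lpow 𝕜 Φ Ψ (p + 1)).applyPlus g = Unitization.inr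
      (((L 𝕜 Φ Ψ).pow (p + 1)).apply 𝕜 g -
        ∑ x ∈ antidiagonal p, LΦ 𝕜 Φ Ψ x.2 * (D 𝕜).symm (LΨ 𝕜 Φ Ψ x.1 * g)) := by
  have h := isTower_L hΦ hΨ
  have step : ∀ i, -((1 : ℤ) • D 𝕜 (par 𝕜 (LΨ 𝕜 Φ Ψ i))) + LΨ 𝕜 Φ Ψ i * f0 𝕜 Φ Ψ -
      par 𝕜 ((D 𝕜).symm (LΨ 𝕜 Φ Ψ i * Φ)) * Ψ = LΨ 𝕜 Φ Ψ (i + 1) := by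
    intro i
    have h1 := h.homog_pairing i 0
    rw [pairing, LΦ_zero] at h1
    rw [h.ψ_succ, h.homog_ψ i, h1, (h.homog_ψ i).mul_comm h.homog_f, pairing, LΦ_zero, LΨ_zero,
      smul_mul_assoc, h1.mul_comm (isHomog_zero_iff.2 hΨ), map_zsmul]
    rcases neg_one_pow_eq_or ℤ i with hi | hi <;> simp [hi, pow_succ] <;> abel
  induction p with
  | zero =>
    have := expansion_mul (𝕜 := 𝕜) (s := (∅ : Finset (ℕ × ℕ))) (a := fun _ => 0) (b := fun _ => 0)
      (P := 1) (E := fun g : A => g) (by rw [one_minus]; rfl)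
      (fun g => by rw [one_applyPlus, Finset.sum_empty, sub_zero]) 1 (f0 𝕜 Φ Ψ) Φ Ψ
    rw [← toSPDO_L, one_mul, ← Lpow_one] at this
    refine ⟨this.1.trans ?_, fun g => (this.2 g).trans ?_⟩ <;>
      rw [Finset.sum_empty, zero_add, Finset.Nat.antidiagonal_zero, Finset.sum_singleton]
    · rfl
    · rw [one_smul, ← apply_L]; rfl
  | succ p ih =>
    have := expansion_mul ih.1 ih.2 1 (f0 𝕜 Φ Ψ) Φ Ψ
    rw [← toSPDO_L, ← Lpow_one, Lpow_eq_pow (p + 1), ← pow_succ, ← Lpow_eq_pow] at this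
    simp only [step] at this
    simp only [one_smul, ← apply_L, apply_pow_L_apply_L] at this
    refine ⟨this.1.trans ?_, fun g => (this.2 g).trans ?_⟩
    -- The new kernel L^(p+1)(Φ₀) 𝒟⁻¹ Ψ₀ is the summand (0, p+1); all others have their first index
    -- raised.
    · rw [Finset.Nat.sum_antidiagonal_succ, add_comm]; rfl
    · rw [Finset.Nat.sum_antidiagonal_succ, add_comm (∑ x ∈ antidiagonal p, _)]; rfl

/-- The exponent is the conjugation sign of φ_b 𝒟⁻¹ ψ_a: b(a+1) for exchanging φ_b with 𝒟⁻¹ψ_a, and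
a for exchanging 𝒟⁻¹ with ψ_a. -/
theorem LpowAdj_expansion (hΦ : par 𝕜 Φ = Φ) (hΨ : par 𝕜 Ψ = Ψ) (p : ℕ) :
    (LpowAdj 𝕜 Φ Ψ (p + 1)).minus = ∑ x ∈ antidiagonal p, kernel 𝕜
      ((-1 : ℤ) ^ (x.1 + x.2 * (x.1 + 1)) • LΨ 𝕜 Φ Ψ x.1) (LΦ 𝕜 Φ Ψ x.2) ∧
    ∀ g, (LpowAdj 𝕜 Φ Ψ (p + 1)).applyPlus g = Unitization.inr
      (((L 𝕜 Φ Ψ).pow (p + 1)).adj.apply 𝕜 g - ∑ x ∈ antidiagonal p,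
        ((-1 : ℤ) ^ (x.1 + x.2 * (x.1 + 1)) • LΨ 𝕜 Φ Ψ x.1) *
          (D 𝕜).symm (LΦ 𝕜 Φ Ψ x.2 * g)) := by
  have h := isTower_L hΦ hΨ
  have step : ∀ j, -((-1 : ℤ) • D 𝕜 (par 𝕜 (LΦ 𝕜 Φ Ψ j))) + LΦ 𝕜 Φ Ψ j * f0 𝕜 Φ Ψ -
      par 𝕜 ((D 𝕜).symm (LΦ 𝕜 Φ Ψ j * Ψ)) * Φ = (-1 : ℤ) ^ j • LΦ 𝕜 Φ Ψ (j + 1) := by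
    intro j
    have h1 := h.homog_pairing 0 j
    have h2 := (h.homog_φ j).mul_comm (h.homog_ψ 0)
    rw [LΨ_zero, mul_zero, pow_zero, one_smul] at h2
    rw [h2]
    rw [pairing, LΨ_zero] at h1
    rw [h.φ_succ, h.homog_φ j, h1, (h.homog_φ j).mul_comm h.homog_f, pairing, LΦ_zero, LΨ_zero,
      smul_mul_assoc, h1.mul_comm (isHomog_zero_iff.2 hΦ), map_zsmul]
    rcases neg_one_pow_eq_or ℤ j with hj | hj <;> simp [hj, pow_succ, sub_eq_add_neg]
  induction p with
  | zero =>
    have := expansion_mul (𝕜 := 𝕜) (s := (∅ : Finset (ℕ × ℕ))) (a := fun _ => 0) (b := fun _ => 0)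
      (P := 1) (E := fun g : A => g) (by rw [one_minus]; rfl)
      (fun g => by rw [one_applyPlus, Finset.sum_empty, sub_zero]) (-1) (f0 𝕜 Φ Ψ) Ψ Φ
    rw [← toSPDO_L_adj, one_mul] at this
    have e : LpowAdj 𝕜 Φ Ψ (0 + 1) = (L 𝕜 Φ Ψ).adj.toSPDO 𝕜 := by
      rw [LpowAdj_succ, pow_zero, one_smul]
      exact one_mul _
    rw [e]
    refine ⟨this.1.trans ?_, fun g => (this.2 g).trans ?_⟩ <;>
      rw [Finset.sum_empty, zero_add, Finset.Nat.antidiagonal_zero, Finset.sum_singleton]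
    · rw [zero_mul, zero_add, pow_zero, one_smul]; rfl
    · rw [apply_adj_pow_succ, apply_L_adj, neg_one_smul, zero_mul, zero_add, pow_zero, one_smul,
        one_smul]
      rfl
  | succ p ih =>
    have := expansion_mul ih.1 ih.2 (-1) (f0 𝕜 Φ Ψ) Ψ Φ
    rw [← toSPDO_L_adj] at this
    simp only [step] at this
    simp only [neg_one_smul, ← apply_L_adj] at this
    have hsgn : ∀ x ∈ antidiagonal p, (-1 : ℤ) ^ (x.1 + (x.2 + 1) * (x.1 + 1)) =
        (-1) ^ (p + 1) * ((-1) ^ (x.1 + x.2 * (x.1 + 1)) * (-1) ^ x.2) := by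
      rintro ⟨a, b⟩ hx
      obtain rfl := mem_antidiagonal.1 hx
      rw [← pow_add, ← pow_add]
      refine neg_one_pow_congr ?_
      simp only [Nat.even_add, Nat.even_mul, Nat.even_add_one]
      tauto
    rw [LpowAdj_succ]
    refine ⟨?_, fun g => ?_⟩
    · rw [minus_zsmul, this.1, Finset.Nat.sum_antidiagonal_succ', smul_add, add_comm,
        Finset.smul_sum]
      congr 1
      · rw [zero_mul, add_zero, kernel_zsmul_left]; rfl
      · refine Finset.sum_congr rfl fun x hx => ?_
        rw [hsgn x hx]
        rw [kernel_zsmul_left, kernel_zsmul_left, map_zsmul, smul_smul, smul_smul, mul_assoc]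
    · rw [applyPlus_eq_act, act_zsmul_left, ← applyPlus_eq_act, this.2,
        Finset.Nat.sum_antidiagonal_succ', ← inr_zsmul, smul_sub, smul_add, Finset.smul_sum,
        ← apply_adj_pow_succ]
      congr 2
      rw [add_comm]
      congr 1
      · rw [zero_mul, add_zero, smul_mul_assoc]; rfl
      · refine Finset.sum_congr rfl fun x hx => ?_
        rw [hsgn x hx]
        simp only [smul_mul_assoc, mul_smul_comm, map_zsmul, smul_smul]
        rw [mul_comm ((-1 : ℤ) ^ x.2)]

end LaxOperator
-- Reduction of the equations for Φ₀ and Ψ₀ to flows on the tower.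
section PairEquations

open Finset.HasAntidiagonal

variable {𝕜 : Type u} {A : Type v} [Field 𝕜] [NonUnitalRing A] [Module 𝕜 A]
  [SuperfieldAlgebra 𝕜 A] {Φ Ψ : A}

/-- A sum and its alternating version differ by twice the odd-indexed terms, which is exactly the
form of X. -/
theorem sum_range_alternating {M : Type*} [AddCommGroup M] (N : ℕ) (f : ℕ → M) :
    ∑ k ∈ Finset.range (2 * N + 1), f k = ∑ k ∈ Finset.range (2 * N + 1), (-1 : ℤ) ^ k • f k +
      (2 : ℤ) • ∑ l ∈ Finset.range N, f (2 * l + 1) := by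
  induction N with
  | zero => simp
  | succ N ih =>
    rw [show 2 * (N + 1) + 1 = 2 * N + 1 + 1 + 1 by ring, Finset.sum_range_succ,
      Finset.sum_range_succ, ih, Finset.sum_range_succ _ N, Finset.sum_range_succ _ (2 * N + 1 + 1),
      Finset.sum_range_succ _ (2 * N + 1), (even_two_mul N).add_one.neg_one_pow,
      (even_two_mul N).add_one.add_one.neg_one_pow]
    module

theorem sum_antidiagonal_alternating {M : Type*} [AddCommGroup M] (N : ℕ) (F : ℕ × ℕ → M) :
    ∑ x ∈ antidiagonal (2 * N), F x = ∑ x ∈ antidiagonal (2 * N), (-1 : ℤ) ^ x.1 • F x +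
      (2 : ℤ) • ∑ l ∈ Finset.range N, F (2 * l + 1, 2 * (N - l) - 1) := by
  rw [Finset.Nat.sum_antidiagonal_eq_sum_range_succ_mk,
    Finset.Nat.sum_antidiagonal_eq_sum_range_succ_mk, sum_range_alternating]
  congr 2
  refine Finset.sum_congr rfl fun l hl => ?_
  rw [Finset.mem_range] at hl
  congr 2
  omega

theorem map_SOp_sum {M : Type*} [AddCommMonoid M] (F : SOp A → M) (h0 : F .zero = 0)
    (hadd : ∀ P Q, F (.add P Q) = F P + F Q) (N : ℕ) (P : ℕ → SOp A) :
    F (.sum ((List.range N).map P)) = ∑ l ∈ Finset.range N, F (P l) := by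
  have : ∀ s : List ℕ, F (.sum (s.map P)) = (s.map fun l => F (P l)).sum := fun s => by
    induction s with
    | nil => exact h0
    | cons a s ih => rw [List.map_cons, List.map_cons, List.sum_cons, ← ih, ← hadd]; rfl
  rw [this]
  rfl

theorem X_apply (N : ℕ) (g : A) : (X 𝕜 Φ Ψ (N + 1)).apply 𝕜 g = (2 : ℤ) • ∑ l ∈ Finset.range N,
    LΦ 𝕜 Φ Ψ (2 * (N - l) - 1) * (D 𝕜).symm (LΨ 𝕜 Φ Ψ (2 * l + 1) * g) := by
  rw [X, SOp.apply, Nat.add_sub_cancel,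
    map_SOp_sum (fun P => P.apply 𝕜 g) rfl fun _ _ => rfl]
  congr 1
  refine Finset.sum_congr rfl fun l hl => ?_
  rw [show 2 * (N + 1 - l) - 3 = 2 * (N - l) - 1 by omega]
  rfl

/-- The overall minus sign comes from exchanging 𝒟⁻¹ with the fermionic right factor; their product
is even, so the fermionic left factor passes it freely. -/
theorem X_adj_apply (N : ℕ) (g : A) : (X 𝕜 Φ Ψ (N + 1)).adj.apply 𝕜 g =
    -((2 : ℤ) • ∑ l ∈ Finset.range N,
      LΨ 𝕜 Φ Ψ (2 * l + 1) * (D 𝕜).symm (LΦ 𝕜 Φ Ψ (2 * (N - l) - 1) * g)) := by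
  rw [X, SOp.adj, SOp.apply, Nat.add_sub_cancel,
    map_SOp_sum (fun P => P.adj.apply 𝕜 g) rfl fun _ _ => rfl, ← smul_neg,
    ← Finset.sum_neg_distrib]
  congr 1
  refine Finset.sum_congr rfl fun l hl => ?_
  rw [show 2 * (N + 1 - l) - 3 = 2 * (N - l) - 1 by omega]
  simp only [SOp.adj, SOp.apply, SOp.parity]
  rw [if_neg (by decide), if_pos (by decide), one_smul, neg_one_smul]

variable [IsScalarTower 𝕜 A A] [SMulCommClass 𝕜 A A]

open SPDO

theorem X_toSPDO (N : ℕ) : (X 𝕜 Φ Ψ (N + 1)).toSPDO 𝕜 = (2 : ℤ) • ∑ l ∈ Finset.range N,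
    kernel 𝕜 (LΦ 𝕜 Φ Ψ (2 * (N - l) - 1)) (LΨ 𝕜 Φ Ψ (2 * l + 1)) := by
  rw [X, SOp.toSPDO, Nat.add_sub_cancel,
    map_SOp_sum (fun P => P.toSPDO 𝕜) rfl fun _ _ => rfl]
  congr 1
  refine Finset.sum_congr rfl fun l hl => ?_
  rw [show 2 * (N + 1 - l) - 3 = 2 * (N - l) - 1 by omega, kernel_apply, mul_assoc]
  rfl

theorem Lpow_applyPlus (hΦ : par 𝕜 Φ = Φ) (hΨ : par 𝕜 Ψ = Ψ) (p : ℕ) :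
    (Lpow 𝕜 Φ Ψ (p + 1)).applyPlus Φ = Unitization.inr (LΦ 𝕜 Φ Ψ (p + 1) -
      ∑ x ∈ antidiagonal p, LΦ 𝕜 Φ Ψ x.2 * pairing 𝕜 (LΦ 𝕜 Φ Ψ) (LΨ 𝕜 Φ Ψ) x.1 0) :=
  (Lpow_expansion hΦ hΨ p).2 Φ

theorem LΨ_mul_Dinv (hΦ : par 𝕜 Φ = Φ) (hΨ : par 𝕜 Ψ = Ψ) (i j : ℕ) :
    LΨ 𝕜 Φ Ψ i * (D 𝕜).symm (LΦ 𝕜 Φ Ψ j * Ψ) =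
      (-1 : ℤ) ^ (i * (j + 1)) • (pairing 𝕜 (LΦ 𝕜 Φ Ψ) (LΨ 𝕜 Φ Ψ) 0 j * LΨ 𝕜 Φ Ψ i) := by
  have h := isTower_L hΦ hΨ
  have h2 := (h.homog_φ j).mul_comm (isHomog_zero_iff.2 hΨ)
  rw [mul_zero, pow_zero, one_smul] at h2
  have h3 := (h.homog_ψ i).mul_comm (h.homog_pairing 0 j)
  rw [zero_add] at h3
  rw [h2, ← h3]
  rfl

theorem LpowAdj_applyPlus (hΦ : par 𝕜 Φ = Φ) (hΨ : par 𝕜 Ψ = Ψ) (p : ℕ) :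
    (LpowAdj 𝕜 Φ Ψ (p + 1)).applyPlus Ψ = Unitization.inr (LΨ 𝕜 Φ Ψ (p + 1) -
      ∑ x ∈ antidiagonal p, (-1 : ℤ) ^ x.2 •
        (pairing 𝕜 (LΦ 𝕜 Φ Ψ) (LΨ 𝕜 Φ Ψ) 0 x.2 * LΨ 𝕜 Φ Ψ x.1)) := by
  rw [(LpowAdj_expansion hΦ hΨ p).2 Ψ]
  congr 2
  refine Finset.sum_congr rfl fun x _ => ?_
  rw [smul_mul_assoc, LΨ_mul_Dinv hΦ hΨ, smul_smul, ← pow_add]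
  refine zsmul_neg_one_pow_congr ?_ _
  simp only [Nat.even_add, Nat.even_mul, Nat.even_add_one]
  tauto

variable (𝕜 Φ Ψ) in
/-- The derivative of `Φ₀` along the flow of parity `p + 1` and level `p`. -/
noncomputable def flowΦ (p : ℕ) : A := (-1 : ℤ) ^ (p + 1) • LΦ 𝕜 Φ Ψ (p + 1) -
  ∑ x ∈ antidiagonal p, (-1 : ℤ) ^ ((p + 1) * x.1) •
    (LΦ 𝕜 Φ Ψ x.2 * pairing 𝕜 (LΦ 𝕜 Φ Ψ) (LΨ 𝕜 Φ Ψ) x.1 0)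

variable (𝕜 Φ Ψ) in
/-- The derivative of `Ψ₀` along the flow of parity `p + 1` and level `p`. -/
noncomputable def flowΨ (p : ℕ) : A := -((-1 : ℤ) ^ (p + 1) • LΨ 𝕜 Φ Ψ (p + 1)) +
  ∑ x ∈ antidiagonal p, (-1 : ℤ) ^ ((p + 1) * x.1 + x.2) •
    (pairing 𝕜 (LΦ 𝕜 Φ Ψ) (LΨ 𝕜 Φ Ψ) 0 x.2 * LΨ 𝕜 Φ Ψ x.1)

theorem evenPair_iff (hΦ : par 𝕜 Φ = Φ) (hΨ : par 𝕜 Ψ = Ψ) {l p : ℕ} (hp : 2 * l = p + 1)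
    (T : EvenFlow 𝕜 A) :
    EvenPair 𝕜 Φ Ψ l T ↔ T Φ = flowΦ 𝕜 Φ Ψ p ∧ T Ψ = flowΨ 𝕜 Φ Ψ p := by
  have hs : Even (p + 1) := hp ▸ even_two_mul l
  rw [EvenPair, hp, Lpow_applyPlus hΦ hΨ, LpowAdj_applyPlus hΦ hΨ, ← Unitization.inr_neg,
    Unitization.inr_injective.eq_iff, Unitization.inr_injective.eq_iff, flowΦ, flowΨ, neg_sub,
    neg_add_eq_sub]
  simp only [pow_add, pow_mul, hs.neg_one_pow, one_pow, one_smul, one_mul]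

/-- The two corrections act separately: the term with factor 2 reverses the sign of the leading
L^(2n-1) term, and X turns the sum into an alternating one. -/
theorem oddPair_iff (hΦ : par 𝕜 Φ = Φ) (hΨ : par 𝕜 Ψ = Ψ) {n p : ℕ} (hp : 2 * n - 1 = p + 1)
    (T : OddFlow 𝕜 A) :
    OddPair 𝕜 Φ Ψ n T ↔ T Φ = flowΦ 𝕜 Φ Ψ p ∧ T Ψ = flowΨ 𝕜 Φ Ψ p := by
  obtain ⟨N, rfl⟩ : ∃ N, n = N + 1 := ⟨n - 1, by omega⟩
  obtain rfl : p = 2 * N := by omega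
  have hs : Odd (2 * N + 1) := (even_two_mul N).add_one
  rw [OddPair, hp, Lpow_applyPlus hΦ hΨ, LpowAdj_applyPlus hΦ hΨ, ← inr_zsmul, ← inr_zsmul,
    ← Unitization.inr_neg, ← Unitization.inr_sub, ← Unitization.inr_add, ← Unitization.inr_add,
    ← Unitization.inr_sub, Unitization.inr_injective.eq_iff, Unitization.inr_injective.eq_iff,
    flowΦ, flowΨ, X_apply, X_adj_apply, hs.neg_one_pow]
  have e1 := sum_antidiagonal_alternating N fun x =>
    LΦ 𝕜 Φ Ψ x.2 * pairing 𝕜 (LΦ 𝕜 Φ Ψ) (LΨ 𝕜 Φ Ψ) x.1 0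
  have e2 := sum_antidiagonal_alternating N fun x =>
    pairing 𝕜 (LΦ 𝕜 Φ Ψ) (LΨ 𝕜 Φ Ψ) 0 x.2 * LΨ 𝕜 Φ Ψ x.1
  have e3 : ∀ l ∈ Finset.range N,
      LΨ 𝕜 Φ Ψ (2 * l + 1) * (D 𝕜).symm (LΦ 𝕜 Φ Ψ (2 * (N - l) - 1) * Ψ) =
      pairing 𝕜 (LΦ 𝕜 Φ Ψ) (LΨ 𝕜 Φ Ψ) 0 (2 * (N - l) - 1) * LΨ 𝕜 Φ Ψ (2 * l + 1) := by
    intro l hl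
    rw [Finset.mem_range] at hl
    rw [LΨ_mul_Dinv hΦ hΨ, Even.neg_one_pow, one_smul]
    exact Even.mul_left ⟨N - l, by omega⟩ _
  have e4 : ∀ x ∈ antidiagonal (2 * N), (-1 : ℤ) ^ ((2 * N + 1) * x.1 + x.2) •
        (pairing 𝕜 (LΦ 𝕜 Φ Ψ) (LΨ 𝕜 Φ Ψ) 0 x.2 * LΨ 𝕜 Φ Ψ x.1) =
      pairing 𝕜 (LΦ 𝕜 Φ Ψ) (LΨ 𝕜 Φ Ψ) 0 x.2 * LΨ 𝕜 Φ Ψ x.1 := by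
    intro x hx
    rw [mem_antidiagonal] at hx
    rw [Even.neg_one_pow, one_smul]
    rw [show (2 * N + 1) * x.1 + x.2 = 2 * (N * x.1 + N) by linear_combination hx]
    exact even_two_mul _
  have e5 : ∀ x ∈ antidiagonal (2 * N), (-1 : ℤ) ^ x.2 •
        (pairing 𝕜 (LΦ 𝕜 Φ Ψ) (LΨ 𝕜 Φ Ψ) 0 x.2 * LΨ 𝕜 Φ Ψ x.1) = (-1 : ℤ) ^ x.1 •
      (pairing 𝕜 (LΦ 𝕜 Φ Ψ) (LΨ 𝕜 Φ Ψ) 0 x.2 * LΨ 𝕜 Φ Ψ x.1) := by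
    intro x hx
    rw [mem_antidiagonal] at hx
    refine zsmul_neg_one_pow_congr ?_ _
    have := even_two_mul N
    rw [← hx, Nat.even_add] at this
    exact this.symm
  rw [Finset.sum_congr rfl e3, Finset.sum_congr rfl e4, Finset.sum_congr rfl e5, e1, e2]
  simp only [pow_mul, hs.neg_one_pow]
  refine and_congr (Eq.congr_right ?_) (Eq.congr_right ?_)
  · change _ - (_ + (2 : ℤ) • ∑ l ∈ Finset.range N, _) - _ +
      (2 : ℤ) • ∑ l ∈ Finset.range N, LΦ 𝕜 Φ Ψ (2 * (N - l) - 1) *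
        pairing 𝕜 (LΦ 𝕜 Φ Ψ) (LΨ 𝕜 Φ Ψ) (2 * l + 1) 0 = _
    module
  · module

theorem EvenPair.isTowerFlow {T : EvenFlow 𝕜 A} {l p : ℕ} (hT : EvenPair 𝕜 Φ Ψ l T)
    (hΦ : par 𝕜 Φ = Φ) (hΨ : par 𝕜 Ψ = Ψ) (hp : 2 * l = p + 1) :
    IsTowerFlow (LΦ 𝕜 Φ Ψ) (LΨ 𝕜 Φ Ψ) p T.toLin where
  toIsFlow := T.isFlow (hp ▸ even_two_mul l)
  map_φ_zero := ((evenPair_iff hΦ hΨ hp T).1 hT).1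
  map_ψ_zero := ((evenPair_iff hΦ hΨ hp T).1 hT).2

theorem OddPair.isTowerFlow {T : OddFlow 𝕜 A} {n p : ℕ} (hT : OddPair 𝕜 Φ Ψ n T)
    (hΦ : par 𝕜 Φ = Φ) (hΨ : par 𝕜 Ψ = Ψ) (hp : 2 * n - 1 = p + 1) :
    IsTowerFlow (LΦ 𝕜 Φ Ψ) (LΨ 𝕜 Φ Ψ) p T.toLin where
  toIsFlow := T.isFlow (hp ▸ ⟨n - 1, by omega⟩)
  map_φ_zero := ((oddPair_iff hΦ hΨ hp T).1 hT).1
  map_ψ_zero := ((oddPair_iff hΦ hΨ hp T).1 hT).2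

end PairEquations
-- The Lax equations.
section Lax

open Finset.HasAntidiagonal

variable {𝕜 : Type u} {A : Type v} [Field 𝕜] [NonUnitalRing A] [Module 𝕜 A]
  [IsScalarTower 𝕜 A A] [SMulCommClass 𝕜 A A] [SuperfieldAlgebra 𝕜 A] {s : ℕ} {V : A →ₗ[𝕜] A}

namespace SPDO

theorem coeff_mapCoeff (P : SPDO 𝕜 A) (n : ℤ) : (mapCoeff V P).coeff n = ext V (P.coeff n) := rfl

theorem mapCoeff_add (P Q : SPDO 𝕜 A) : mapCoeff V (P + Q) = mapCoeff V P + mapCoeff V Q :=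
  ext_coeff fun n => by simp only [coeff_mapCoeff, coeff_add, map_add]

theorem mapCoeff_dOp : mapCoeff V (dOp 𝕜 A) = 0 := ext_coeff fun n => by
  rw [coeff_mapCoeff, dOp, coeff_single, coeff_zero]
  split_ifs
  · ext <;> simp
  · exact map_zero _

theorem mapCoeff_fnOp (a : A) : mapCoeff V (fnOp 𝕜 A a) = fnOp 𝕜 A (V a) := ext_coeff fun n => by
  rw [coeff_mapCoeff, fnOp_apply, fnOp_apply, coeff_single, coeff_single]
  split_ifs
  · exact ext_inr _ _
  · exact map_zero _

theorem mapCoeff_dOp_mul (hV : IsFlow s V) (Q : SPDO 𝕜 A) :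
    mapCoeff V (dOp 𝕜 A * Q) = (-1 : ℤ) ^ s • (dOp 𝕜 A * mapCoeff V Q) := ext_coeff fun n => by
  rw [coeff_mapCoeff, dOp, coeff_D_mul, coeff_zsmul, coeff_D_mul, coeff_mapCoeff, coeff_mapCoeff]
  ext
  · simp
  · have h1 := hV.par_map (Q.coeff (n - 1)).snd
    have h2 := hV.map_D (Q.coeff n).snd
    simp only [ext_snd, Unitization.snd_add, Unitization.snd_smul, cD_snd, cpar_snd, map_add, h1,
      h2, smul_add, zsmul_neg_one_pow_self]

theorem mapCoeff_dInv_mul (hV : IsFlow s V) (Q : SPDO 𝕜 A) :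
    mapCoeff V (dInv 𝕜 A * Q) = (-1 : ℤ) ^ s • (dInv 𝕜 A * mapCoeff V Q) := by
  have h := mapCoeff_dOp_mul hV (dInv 𝕜 A * Q)
  rw [← mul_assoc, dOp_mul_dInv, one_mul] at h
  rw [h, mul_smul_comm, zsmul_neg_one_pow_self, ← mul_assoc, dInv_mul_dOp, one_mul]

theorem mapCoeff_fnOp_mul (hV : IsFlow s V) {i : ℕ} {a : A} (ha : IsHomog 𝕜 i a) (Q : SPDO 𝕜 A) :
    mapCoeff V (fnOp 𝕜 A a * Q) =
      fnOp 𝕜 A (V a) * Q + (-1 : ℤ) ^ (s * i) • (fnOp 𝕜 A a * mapCoeff V Q) :=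
  ext_coeff fun n => by
    rw [coeff_mapCoeff, coeff_fnOp_mul, coeff_add, coeff_zsmul, coeff_fnOp_mul, coeff_fnOp_mul,
      coeff_mapCoeff]
    ext
    · simp
    · simp only [ext_snd, ext_fst, Unitization.snd_add, Unitization.snd_smul, Unitization.snd_mul,
        Unitization.fst_inr, Unitization.snd_inr, zero_smul, zero_add, map_add, map_smul,
        hV.leibniz ha, add_assoc]

theorem mapCoeff_kernel (hV : IsFlow s V) {i : ℕ} {a : A} (ha : IsHomog 𝕜 i a) (b : A) :
    mapCoeff V (kernel 𝕜 a b) =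
      kernel 𝕜 (V a) b + (-1 : ℤ) ^ (s * i + s) • kernel 𝕜 a (V b) := by
  rw [kernel_apply, mul_assoc, mapCoeff_fnOp_mul hV ha, mapCoeff_dInv_mul hV, mapCoeff_fnOp,
    mul_smul_comm, smul_smul, ← pow_add, ← mul_assoc, ← mul_assoc]
  rfl

end SPDO

open SPDO

variable {φ ψ : ℕ → A} {f : A}

namespace IsTower

variable (h : IsTower 𝕜 φ ψ f)
include h

/-- Multiplication by L on the right raises the index of ψ, up to a function and a kernel ending in
ψ₀; `lax_mul_kernel` does the same for φ on the left. -/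
theorem kernel_mul_lax (i j : ℕ) :
    kernel 𝕜 (φ j) (ψ i) * (dOp 𝕜 A + fnOp 𝕜 A f + kernel 𝕜 (φ 0) (ψ 0)) =
      kernel 𝕜 (φ j) (ψ (i + 1)) + (-1 : ℤ) ^ i • fnOp 𝕜 A (φ j * ψ i) +
        kernel 𝕜 (φ j * pairing 𝕜 φ ψ i 0) (ψ 0) := by
  have h1 := h.homog_pairing i 0
  rw [mul_add, mul_add, kernel_mul_dOp, kernel_mul_fnOp, kernel_mul_kernel, h.ψ_succ,
    h.homog_ψ i, (h.homog_ψ i).mul_comm h.homog_f]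
  change _ + _ + (kernel 𝕜 (φ j * pairing 𝕜 φ ψ i 0) (ψ 0) -
    kernel 𝕜 (φ j) (par 𝕜 (pairing 𝕜 φ ψ i 0) * ψ 0)) = _
  rw [h1, smul_mul_assoc, h1.mul_comm (h.homog_ψ 0)]
  simp only [map_add, map_zsmul, map_neg, mul_smul_comm, mul_zero, mul_one, add_zero, pow_zero,
    one_smul, pow_succ]
  module

theorem lax_mul_kernel (i j : ℕ) :
    (dOp 𝕜 A + fnOp 𝕜 A f + kernel 𝕜 (φ 0) (ψ 0)) * kernel 𝕜 (φ j) (ψ i) =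
      kernel 𝕜 (φ (j + 1)) (ψ i) + (-1 : ℤ) ^ j • fnOp 𝕜 A (φ j * ψ i) +
        (-1 : ℤ) ^ j • kernel 𝕜 (φ 0) (pairing 𝕜 φ ψ 0 j * ψ i) := by
  have h1 := h.homog_pairing 0 j
  rw [add_mul, add_mul, dOp_mul_kernel, fnOp_mul_kernel, kernel_mul_kernel, h.φ_succ,
    h.homog_φ j]
  change _ + _ + (kernel 𝕜 (φ 0 * pairing 𝕜 φ ψ 0 j) (ψ i) -
    kernel 𝕜 (φ 0) (par 𝕜 (pairing 𝕜 φ ψ 0 j) * ψ i)) = _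
  rw [h1, smul_mul_assoc]
  simp only [kernel_add_left, map_zsmul, smul_mul_assoc, pow_succ, zero_add]
  module

end IsTower

/-- In (-1)^(p+1) L Y - Y L the index-raised kernels telescope to the leading terms of V(φ₀) and
V(ψ₀), the kernels ending in ψ₀ or beginning with φ₀ give the remaining terms, and the functions add
up to V(f). -/
theorem IsTowerFlow.mapCoeff_lax {p : ℕ} (hV : IsTowerFlow φ ψ p V) (h : IsTower 𝕜 φ ψ f) :
    mapCoeff V (dOp 𝕜 A + fnOp 𝕜 A f + kernel 𝕜 (φ 0) (ψ 0)) =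
      (-1 : ℤ) ^ (p + 1) • ((dOp 𝕜 A + fnOp 𝕜 A f + kernel 𝕜 (φ 0) (ψ 0)) *
        ∑ x ∈ antidiagonal p, (-1 : ℤ) ^ ((p + 1) * x.1) • kernel 𝕜 (φ x.2) (ψ x.1)) -
      (∑ x ∈ antidiagonal p, (-1 : ℤ) ^ ((p + 1) * x.1) • kernel 𝕜 (φ x.2) (ψ x.1)) *
        (dOp 𝕜 A + fnOp 𝕜 A f + kernel 𝕜 (φ 0) (ψ 0)) := by
  have ht := sum_antidiagonal_telescope p
    (fun x => (-1 : ℤ) ^ ((p + 1) * x.1 + (p + 1)) • kernel 𝕜 (φ x.2) (ψ x.1))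
  have hfn : ∑ x ∈ antidiagonal p, (-1 : ℤ) ^ ((p + 1) * x.1) •
        ((-1 : ℤ) ^ (p + 1 + x.2) • fnOp 𝕜 A (φ x.2 * ψ x.1) -
          (-1 : ℤ) ^ x.1 • fnOp 𝕜 A (φ x.2 * ψ x.1)) =
      -((2 : ℤ) • ∑ x ∈ antidiagonal p, (-1 : ℤ) ^ x.1 • fnOp 𝕜 A (ψ x.1 * φ x.2)) := by
    rw [Finset.smul_sum, ← Finset.sum_neg_distrib]
    refine Finset.sum_congr rfl ?_
    rintro ⟨a, b⟩ hx
    obtain rfl := mem_antidiagonal.1 hx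
    rw [(h.homog_φ b).mul_comm (h.homog_ψ a), map_zsmul, two_zsmul]
    rcases neg_one_pow_eq_or ℤ a with ha | ha <;> rcases neg_one_pow_eq_or ℤ b with hb | hb <;>
      simp [ha, hb, pow_add, pow_mul] <;> abel
  have key : (-1 : ℤ) ^ (p + 1) • ((dOp 𝕜 A + fnOp 𝕜 A f + kernel 𝕜 (φ 0) (ψ 0)) *
        ∑ x ∈ antidiagonal p, (-1 : ℤ) ^ ((p + 1) * x.1) • kernel 𝕜 (φ x.2) (ψ x.1)) -
      (∑ x ∈ antidiagonal p, (-1 : ℤ) ^ ((p + 1) * x.1) • kernel 𝕜 (φ x.2) (ψ x.1)) *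
        (dOp 𝕜 A + fnOp 𝕜 A f + kernel 𝕜 (φ 0) (ψ 0)) =
      ∑ x ∈ antidiagonal p, (
        (-1 : ℤ) ^ ((p + 1) * x.1) • ((-1 : ℤ) ^ (p + 1 + x.2) • fnOp 𝕜 A (φ x.2 * ψ x.1) -
          (-1 : ℤ) ^ x.1 • fnOp 𝕜 A (φ x.2 * ψ x.1)) -
        ((-1 : ℤ) ^ ((p + 1) * (x.1 + 1) + (p + 1)) • kernel 𝕜 (φ x.2) (ψ (x.1 + 1)) -
          (-1 : ℤ) ^ ((p + 1) * x.1 + (p + 1)) • kernel 𝕜 (φ (x.2 + 1)) (ψ x.1)) -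
        (-1 : ℤ) ^ ((p + 1) * x.1) • kernel 𝕜 (φ x.2 * pairing 𝕜 φ ψ x.1 0) (ψ 0) +
        (-1 : ℤ) ^ ((p + 1) + ((p + 1) * x.1 + x.2)) •
          kernel 𝕜 (φ 0) (pairing 𝕜 φ ψ 0 x.2 * ψ x.1)) := by
    rw [Finset.mul_sum, Finset.sum_mul, Finset.smul_sum, ← Finset.sum_sub_distrib]
    refine Finset.sum_congr rfl fun x _ => ?_
    rw [mul_smul_comm, smul_mul_assoc, h.kernel_mul_lax, h.lax_mul_kernel]
    generalize p + 1 = m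
    -- The extra m in the exponent makes the telescoping sign of the ψ-shifted kernel equal to its
    -- original one.
    rw [show m * (x.1 + 1) + m = m * x.1 + (m + m) by ring, pow_add _ _ (m + m),
      Even.neg_one_pow ⟨m, rfl⟩, mul_one]
    simp only [pow_add]
    module
  rw [key, Finset.sum_add_distrib, Finset.sum_sub_distrib, Finset.sum_sub_distrib, hfn, ht,
    mapCoeff_add, mapCoeff_add, mapCoeff_dOp, mapCoeff_fnOp, mapCoeff_kernel hV.toIsFlow
    (h.homog_φ 0), hV.map_f h, hV.map_φ_zero, hV.map_ψ_zero]
  simp only [kernel_sub_left, kernel_sum_left, kernel_zsmul_left]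
  simp only [map_neg, map_add, map_zsmul, map_sum, smul_add, smul_neg, Finset.smul_sum, smul_smul, ← pow_add, mul_zero,
    zero_add]
  have s1 : (-1 : ℤ) ^ (p + 1 + (p + 1)) = 1 := Even.neg_one_pow ⟨_, rfl⟩
  have s2 : (-1 : ℤ) ^ ((p + 1) * (p + 1) + (p + 1)) = 1 :=
    Even.neg_one_pow (by simp only [Nat.even_add, Nat.even_mul]; tauto)
  rw [s1, s2]
  module

variable {Φ Ψ : A}

theorem Lpow_one_eq : Lpow 𝕜 Φ Ψ 1 =
    dOp 𝕜 A + fnOp 𝕜 A (f0 𝕜 Φ Ψ) + kernel 𝕜 (LΦ 𝕜 Φ Ψ 0) (LΨ 𝕜 Φ Ψ 0) := by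
  rw [Lpow_one, toSPDO_L, one_smul]; rfl

theorem plus_eq (P : SPDO 𝕜 A) : P.plus = P - P.minus := eq_sub_of_add_eq (plus_add_minus P)

theorem EvenPair.evenLax {T : EvenFlow 𝕜 A} {l : ℕ} (hT : EvenPair 𝕜 Φ Ψ l T) (hl : 1 ≤ l)
    (hΦ : par 𝕜 Φ = Φ) (hΨ : par 𝕜 Ψ = Ψ) : EvenLax 𝕜 Φ Ψ l T := by
  obtain ⟨p, hp⟩ : ∃ p, 2 * l = p + 1 := ⟨2 * l - 1, by omega⟩
  have hs : Even (p + 1) := hp ▸ even_two_mul l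
  have key := (hT.isTowerFlow hΦ hΨ hp).mapCoeff_lax (isTower_L hΦ hΨ)
  rw [← Lpow_one_eq] at key
  simp only [pow_mul, hs.neg_one_pow, one_pow, one_smul] at key
  rw [← (Lpow_expansion hΦ hΨ p).1] at key
  have hc : Lpow 𝕜 Φ Ψ (p + 1) * Lpow 𝕜 Φ Ψ 1 = Lpow 𝕜 Φ Ψ 1 * Lpow 𝕜 Φ Ψ (p + 1) := by
    rw [Lpow_eq_pow (p + 1), ← pow_succ, ← pow_succ']
  rw [EvenLax, hp, key, SPDO.comm, SPDO.comm, plus_eq, sub_mul, mul_sub, hc]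
  constructor <;> abel

theorem OddPair.oddLax {T : OddFlow 𝕜 A} {n : ℕ} (hT : OddPair 𝕜 Φ Ψ n T) (hn : 1 ≤ n)
    (hΦ : par 𝕜 Φ = Φ) (hΨ : par 𝕜 Ψ = Ψ) : OddLax 𝕜 Φ Ψ n T := by
  obtain ⟨N, rfl⟩ : ∃ N, n = N + 1 := ⟨n - 1, by omega⟩
  have hp : 2 * (N + 1) - 1 = 2 * N + 1 := by omega
  have hs : Odd (2 * N + 1) := (even_two_mul N).add_one
  have key := (hT.isTowerFlow hΦ hΨ hp).mapCoeff_lax (isTower_L hΦ hΨ)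
  have hY := sum_antidiagonal_alternating N fun x => kernel 𝕜 (LΦ 𝕜 Φ Ψ x.2) (LΨ 𝕜 Φ Ψ x.1)
  rw [← X_toSPDO, ← (Lpow_expansion hΦ hΨ (2 * N)).1, ← sub_eq_iff_eq_add] at hY
  rw [← Lpow_one_eq] at key
  simp only [pow_mul _ (2 * N + 1), hs.neg_one_pow] at key
  rw [← hY] at key
  have hc : Lpow 𝕜 Φ Ψ (2 * N + 1) * Lpow 𝕜 Φ Ψ 1 = Lpow 𝕜 Φ Ψ (2 * (N + 1)) := by
    rw [Lpow_eq_pow (2 * N + 1), ← pow_succ, ← Lpow_eq_pow]; rfl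
  have hc' : Lpow 𝕜 Φ Ψ 1 * Lpow 𝕜 Φ Ψ (2 * N + 1) = Lpow 𝕜 Φ Ψ (2 * (N + 1)) :=
    (Lpow_succ _).symm
  rw [OddLax, hp, key, SPDO.anticomm, SPDO.anticomm, SPDO.anticomm, plus_eq]
  simp only [sub_mul, mul_sub, hc, hc']
  constructor <;> module

end Lax
-- The flow algebra on Φ₀, Ψ₀ and f₀, and its closure properties.
section FlowAlgebra

open Finset.HasAntidiagonal

variable {𝕜 : Type u} {A : Type v} [Field 𝕜] [NonUnitalRing A] [Module 𝕜 A]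
  [SuperfieldAlgebra 𝕜 A] {φ ψ : ℕ → A} {f : A} {p q r : ℕ} {U V W : A →ₗ[𝕜] A}

namespace IsTowerFlow

theorem comm_φ (hV : IsTowerFlow φ ψ p V) (hW : IsTowerFlow φ ψ q W) (h : IsTower 𝕜 φ ψ f)
    (hpq : Even ((p + 1) * (q + 1))) : W (V (φ 0)) = V (W (φ 0)) := by
  have := supercommutator_φ hV hW h
  rw [hpq.neg_one_pow, one_smul, sub_self, zero_smul] at this
  exact sub_eq_zero.1 this

theorem comm_ψ (hV : IsTowerFlow φ ψ p V) (hW : IsTowerFlow φ ψ q W) (h : IsTower 𝕜 φ ψ f)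
    (hpq : Even ((p + 1) * (q + 1))) : W (V (ψ 0)) = V (W (ψ 0)) := by
  have := supercommutator_ψ hV hW h
  rw [hpq.neg_one_pow, one_smul, sub_self, zero_smul] at this
  exact sub_eq_zero.1 this

/-- For even p and q the sign in the sum is (-1)^(a+b) with a+b = p+q+1 odd, hence constantly -1:
the alternation disappears and a bosonic flow results. -/
theorem anticomm_φ (hV : IsTowerFlow φ ψ p V) (hW : IsTowerFlow φ ψ q W)
    (hU : IsTowerFlow φ ψ (p + q + 1) U) (h : IsTower 𝕜 φ ψ f) (hp : Even p) (hq : Even q) :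
    W (V (φ 0)) + V (W (φ 0)) = -((2 : ℤ) • U (φ 0)) := by
  have := supercommutator_φ hV hW h
  rw [(hp.add_one.mul hq.add_one).neg_one_pow, neg_one_smul, sub_neg_eq_add] at this
  rw [this, hU.map_φ_zero, (hp.add hq).neg_one_pow, (hp.add hq).add_one.add_one.neg_one_pow]
  have e1 : ∀ x ∈ antidiagonal (p + q + 1), (-1 : ℤ) ^ ((p + 1) * x.1 + (q + 1) * x.2) •
      (φ x.2 * pairing 𝕜 φ ψ x.1 0) = -((-1 : ℤ) ^ ((p + q + 1 + 1) * x.1) •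
      (φ x.2 * pairing 𝕜 φ ψ x.1 0)) := by
    intro x hx
    rw [mem_antidiagonal] at hx
    rw [pow_add, pow_mul, pow_mul, pow_mul, hp.add_one.neg_one_pow, hq.add_one.neg_one_pow,
      (hp.add hq).add_one.add_one.neg_one_pow, ← pow_add, hx, (hp.add hq).add_one.neg_one_pow,
      one_pow, neg_one_smul, one_smul]
  rw [Finset.sum_congr rfl e1, Finset.sum_neg_distrib]
  module

theorem anticomm_ψ (hV : IsTowerFlow φ ψ p V) (hW : IsTowerFlow φ ψ q W)
    (hU : IsTowerFlow φ ψ (p + q + 1) U) (h : IsTower 𝕜 φ ψ f) (hp : Even p) (hq : Even q) :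
    W (V (ψ 0)) + V (W (ψ 0)) = -((2 : ℤ) • U (ψ 0)) := by
  have := supercommutator_ψ hV hW h
  rw [(hp.add_one.mul hq.add_one).neg_one_pow, neg_one_smul, sub_neg_eq_add] at this
  rw [this, hU.map_ψ_zero, (hp.add hq).neg_one_pow, (hp.add hq).add_one.add_one.neg_one_pow]
  have e1 : ∀ x ∈ antidiagonal (p + q + 1), (-1 : ℤ) ^ ((p + 1) * x.1 + (q + 1) * x.2 + x.2) •
      (pairing 𝕜 φ ψ 0 x.2 * ψ x.1) = -((-1 : ℤ) ^ ((p + q + 1 + 1) * x.1 + x.2) •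
      (pairing 𝕜 φ ψ 0 x.2 * ψ x.1)) := by
    intro x hx
    rw [mem_antidiagonal] at hx
    rw [pow_add, pow_add, pow_add, pow_mul, pow_mul, pow_mul, hp.add_one.neg_one_pow,
      hq.add_one.neg_one_pow, (hp.add hq).add_one.add_one.neg_one_pow, ← pow_add _ x.1, hx,
      (hp.add hq).add_one.neg_one_pow, one_pow, one_mul, neg_one_mul, neg_smul]
  rw [Finset.sum_congr rfl e1, Finset.sum_neg_distrib]
  module

end IsTowerFlow

section Closure

variable {T : ℕ → EvenFlow 𝕜 A} {δ : ℕ → OddFlow 𝕜 A} {a b : A}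

theorem OddFlow.map_Dinv (S : OddFlow 𝕜 A) (a : A) : S ((D 𝕜).symm a) = -(D 𝕜).symm (S a) := by
  simpa using (S.isFlow odd_one).map_Dinv a

theorem EvenFlow.map_Dinv (S : EvenFlow 𝕜 A) (a : A) : S ((D 𝕜).symm a) = (D 𝕜).symm (S a) := by
  simpa using (S.isFlow Even.zero).map_Dinv a

theorem FlowAlgebraAt.zero : FlowAlgebraAt T δ 0 := fun k l _ _ => by simp

theorem FlowAlgebraAt.add (ha : FlowAlgebraAt T δ a) (hb : FlowAlgebraAt T δ b) :
    FlowAlgebraAt T δ (a + b) := fun k l hk hl => by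
  obtain ⟨h1, h2, h3⟩ := ha k l hk hl
  obtain ⟨h1', h2', h3'⟩ := hb k l hk hl
  simp only [map_add, smul_add, neg_add, ← h1, ← h1', h2, h2', h3, h3', and_true]
  abel

theorem FlowAlgebraAt.smul (c : 𝕜) (ha : FlowAlgebraAt T δ a) : FlowAlgebraAt T δ (c • a) :=
  fun k l hk hl => by
    obtain ⟨h1, h2, h3⟩ := ha k l hk hl
    simp only [map_smul, ← smul_add, h1, h2, h3, and_true, smul_neg]
    rw [smul_comm]

theorem FlowAlgebraAt.par (ha : FlowAlgebraAt T δ a) : FlowAlgebraAt T δ (par 𝕜 a) :=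
  fun k l hk hl => by
    obtain ⟨h1, h2, h3⟩ := ha k l hk hl
    have e (n : ℕ) (x : A) : δ n (SKP.par 𝕜 x) = -SKP.par 𝕜 (δ n x) := by
      rw [(δ n).par_comm, neg_neg]
    simp only [e, ← (T _).par_comm, map_neg, neg_neg, ← map_add, h1, h2, h3, and_true, map_zsmul]

theorem FlowAlgebraAt.D (ha : FlowAlgebraAt T δ a) : FlowAlgebraAt T δ (D 𝕜 a) :=
  fun k l hk hl => by
    obtain ⟨h1, h2, h3⟩ := ha k l hk hl
    simp only [(δ _).D_anticomm, (T _).D_comm, map_neg, neg_neg, ← map_add, h1, h2, h3, and_true,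
      map_zsmul]

theorem FlowAlgebraAt.Dinv (ha : FlowAlgebraAt T δ a) : FlowAlgebraAt T δ ((SKP.D 𝕜).symm a) :=
  fun k l hk hl => by
    obtain ⟨h1, h2, h3⟩ := ha k l hk hl
    simp only [OddFlow.map_Dinv, EvenFlow.map_Dinv, map_neg, neg_neg, ← map_add, h1, h2, h3,
      and_true, map_zsmul]

/-- The anticommutator of odd superderivations is an even derivation: the mixed terms cancel because
δ anticommutes with the grading. -/
theorem FlowAlgebraAt.mul (ha : FlowAlgebraAt T δ a) (hb : FlowAlgebraAt T δ b) :
    FlowAlgebraAt T δ (a * b) := fun k l hk hl => by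
  obtain ⟨h1, h2, h3⟩ := ha k l hk hl
  obtain ⟨h1', h2', h3'⟩ := hb k l hk hl
  have e (n : ℕ) (x : A) : δ n (SKP.par 𝕜 x) = -SKP.par 𝕜 (δ n x) := by
    rw [(δ n).par_comm, neg_neg]
  refine ⟨?_, ?_, ?_⟩
  · have e' : -((2 : ℤ) • T (k + l - 1) (a * b)) =
        -((2 : ℤ) • T (k + l - 1) a) * b + a * -((2 : ℤ) • T (k + l - 1) b) := by
      simp only [(T _).leibniz, smul_add, neg_add, neg_mul, mul_neg, smul_mul_assoc, mul_smul_comm]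
    rw [e', ← h1, ← h1']
    simp only [(δ _).leibniz, map_add, e, SuperfieldAlgebra.par_par, add_mul, mul_add, neg_mul]
    abel
  · simp only [(δ _).leibniz, (T _).leibniz, map_add, (T _).par_comm, h2, h2']
    abel
  · simp only [(T _).leibniz, map_add, h3, h3']
    abel

end Closure

variable [IsScalarTower 𝕜 A A] [SMulCommClass 𝕜 A A]
  {Φ Ψ : A} {T : ℕ → EvenFlow 𝕜 A} {δ : ℕ → OddFlow 𝕜 A}

/-- The levels match: (2k-2) + (2l-2) + 1 = 2(k+l-1) - 1, the level of ∂/∂t_(k+l-1). -/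
theorem flowAlgebraAt_pair (hΦ : par 𝕜 Φ = Φ) (hΨ : par 𝕜 Ψ = Ψ)
    (hT : ∀ l, 1 ≤ l → EvenPair 𝕜 Φ Ψ l (T l)) (hδ : ∀ n, 1 ≤ n → OddPair 𝕜 Φ Ψ n (δ n)) :
    FlowAlgebraAt T δ Φ ∧ FlowAlgebraAt T δ Ψ := by
  have h := isTower_L hΦ hΨ
  have hT' (l : ℕ) : IsTowerFlow (LΦ 𝕜 Φ Ψ) (LΨ 𝕜 Φ Ψ) (2 * l + 1) (T (l + 1)).toLin :=
    (hT (l + 1) l.succ_pos).isTowerFlow hΦ hΨ (mul_add_one 2 l)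
  have hδ' (n : ℕ) : IsTowerFlow (LΦ 𝕜 Φ Ψ) (LΨ 𝕜 Φ Ψ) (2 * n) (δ (n + 1)).toLin :=
    (hδ (n + 1) n.succ_pos).isTowerFlow hΦ hΨ (by omega)
  have he (l n : ℕ) : Even ((2 * l + 1 + 1) * n) :=
    (even_two_mul l).add_one.add_one.mul_right n
  have hU (k l : ℕ) : IsTowerFlow (LΦ 𝕜 Φ Ψ) (LΨ 𝕜 Φ Ψ) (2 * l + 2 * k + 1)
      (T (k + 1 + (l + 1) - 1)).toLin := by
    have := hT' (k + l)
    rwa [show 2 * (k + l) = 2 * l + 2 * k by ring,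
      show k + l + 1 = k + 1 + (l + 1) - 1 by omega] at this
  constructor <;> intro k l hk hl <;>
    obtain ⟨k, rfl⟩ := Nat.exists_eq_add_of_le' hk <;>
    obtain ⟨l, rfl⟩ := Nat.exists_eq_add_of_le' hl
  · exact ⟨(hδ' l).anticomm_φ (hδ' k) (hU k l) h (even_two_mul l) (even_two_mul k),
      ((hT' k).comm_φ (hδ' l) h (he k _)).symm, (hT' l).comm_φ (hT' k) h (he l _)⟩
  · exact ⟨(hδ' l).anticomm_ψ (hδ' k) (hU k l) h (even_two_mul l) (even_two_mul k),
      ((hT' k).comm_ψ (hδ' l) h (he k _)).symm, (hT' l).comm_ψ (hT' k) h (he l _)⟩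

theorem FlowAlgebraAt.f0 (hΦ : FlowAlgebraAt T δ Φ) (hΨ : FlowAlgebraAt T δ Ψ) :
    FlowAlgebraAt T δ (f0 𝕜 Φ Ψ) := by
  rw [SKP.f0, ← Int.cast_smul_eq_zsmul 𝕜]
  exact (hΦ.mul hΨ).Dinv.smul _

theorem isHomog_flowΦ (hΦ : par 𝕜 Φ = Φ) (hΨ : par 𝕜 Ψ = Ψ) (p : ℕ) :
    IsHomog 𝕜 (p + 1) (flowΦ 𝕜 Φ Ψ p) := by
  have h := isTower_L hΦ hΨ
  refine ((h.homog_φ _).zsmul _).sub (IsHomog.sum fun x hx => ((h.homog_φ _).mul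
    (h.homog_pairing _ _)).congr ?_ |>.zsmul _)
  rw [← mem_antidiagonal.1 hx, show x.2 + (x.1 + 0 + 1) = x.1 + x.2 + 1 by ring]

theorem isHomog_flowΨ (hΦ : par 𝕜 Φ = Φ) (hΨ : par 𝕜 Ψ = Ψ) (p : ℕ) :
    IsHomog 𝕜 (p + 1) (flowΨ 𝕜 Φ Ψ p) := by
  have h := isTower_L hΦ hΨ
  refine ((h.homog_ψ _).zsmul _).neg.add (IsHomog.sum fun x hx => ((h.homog_pairing _ _).mul
    (h.homog_ψ _)).congr ?_ |>.zsmul _)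
  rw [← mem_antidiagonal.1 hx, show 0 + x.2 + 1 + x.1 = x.1 + x.2 + 1 by ring]

end FlowAlgebra

/-! ### Superderivations of the free superfield algebra. -/

section Free

variable {𝕜 : Type u} {A : Type v} [Field 𝕜] [NonUnitalRing A] [Module 𝕜 A]
  [SuperfieldAlgebra 𝕜 A]

/-- The axioms govern homogeneous factors only, so twice b is split into its even part b + par b and
odd part b - par b; cancelling the 2 is where characteristic zero is used. -/
theorem odd_mul [CharZero 𝕜] {x : A} (hx : par 𝕜 x = -x) (b : A) : x * b = par 𝕜 b * x := by
  have hpp : par 𝕜 (par 𝕜 b) = b := SuperfieldAlgebra.par_par b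
  have h1 := SuperfieldAlgebra.even_comm (𝕜 := 𝕜) (b + par 𝕜 b) x
    (by rw [map_add]; exact (congrArg _ hpp).trans (add_comm _ _))
  have h2 := SuperfieldAlgebra.odd_comm (𝕜 := 𝕜) x (b - par 𝕜 b) hx
    (by rw [map_sub, neg_sub]; exact congrArg _ hpp)
  have h3 : (2 : 𝕜) • (x * b) = (2 : 𝕜) • (par 𝕜 b * x) := by
    rw [add_mul, mul_add] at h1
    rw [sub_mul, mul_sub] at h2
    rw [two_smul, two_smul]
    linear_combination (norm := module) h2 - h1
  exact smul_right_injective A (two_ne_zero (α := 𝕜)) h3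

variable (𝕜 A) in
/-- The twist in the Leibniz rule of an odd (`s = true`) or even (`s = false`) superderivation. -/
def twist (s : Bool) : A →ₗ[𝕜] A := bif s then par 𝕜 else LinearMap.id

/-- The sign in the commutation of an odd or even superderivation with `𝒟`. -/
def sgn (s : Bool) : ℤ := bif s then -1 else 1

namespace FreeSuperfield

theorem mk_zero : (mk .zero : FreeSuperfield 𝕜) = 0 := rfl
theorem mk_add (a b : Term 𝕜) : mk (.add a b) = mk a + mk b := rfl
theorem mk_smul (c : 𝕜) (a : Term 𝕜) : mk (.smul c a) = c • mk a := rfl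
theorem mk_mul (a b : Term 𝕜) : mk (.mul a b) = mk a * mk b := rfl
theorem mk_par (a : Term 𝕜) : mk (.par a) = par 𝕜 (mk a) := rfl
theorem mk_D (a : Term 𝕜) : mk (.D a) = D 𝕜 (mk a) := rfl

/-- The superderivation with values `u`, `v` on the generators, on expressions. -/
noncomputable def flowTerm (s : Bool) (u v : FreeSuperfield 𝕜) : Term 𝕜 → FreeSuperfield 𝕜
  | .Φ => u
  | .Ψ => v
  | .zero => 0
  | .add a b => flowTerm s u v a + flowTerm s u v b
  | .smul c a => c • flowTerm s u v a
  | .mul a b => flowTerm s u v a * mk b + twist 𝕜 _ s (mk a) * flowTerm s u v b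
  | .par a => sgn s • par 𝕜 (flowTerm s u v a)
  | .D a => sgn s • D 𝕜 (flowTerm s u v a)
  | .Dinv a => sgn s • (D 𝕜).symm (flowTerm s u v a)

/-- The derivation prescribed on generators respects every defining law. For the two conditional
laws the induction hypothesis on the premise says that the derivative of a homogeneous expression
has the shifted parity. -/
theorem flowTerm_congr [CharZero 𝕜] {s : Bool} {u v : FreeSuperfield 𝕜} (hu : par 𝕜 u = sgn s • u)
    (hv : par 𝕜 v = sgn s • v) {a b : Term 𝕜} (h : Term.Rel 𝕜 a b) :
    flowTerm s u v a = flowTerm s u v b := by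
  have hpp (x : FreeSuperfield 𝕜) : par 𝕜 (par 𝕜 x) = x := SuperfieldAlgebra.par_par x
  have hpm (x y : FreeSuperfield 𝕜) : par 𝕜 (x * y) = par 𝕜 x * par 𝕜 y :=
    SuperfieldAlgebra.par_mul x y
  have hpD (x : FreeSuperfield 𝕜) : par 𝕜 (D 𝕜 x) = -D 𝕜 (par 𝕜 x) := SuperfieldAlgebra.par_D x
  have hDm (x y : FreeSuperfield 𝕜) : D 𝕜 (x * y) = D 𝕜 x * y + par 𝕜 x * D 𝕜 y :=
    SuperfieldAlgebra.D_mul x y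
  have hs : sgn s * sgn s = 1 := by cases s <;> rfl
  induction h with
  | refl a => rfl
  | symm _ ih => exact ih.symm
  | trans _ _ ih ih' => exact ih.trans ih'
  | congr_mul h h' ih ih' => simp only [flowTerm, ih, ih', sound h, sound h']
  | congr_add _ _ ih ih' => simp only [flowTerm, ih, ih']
  | congr_smul _ _ ih => simp only [flowTerm, ih]
  | congr_par _ ih => simp only [flowTerm, ih]
  | congr_D _ ih => simp only [flowTerm, ih]
  | congr_Dinv _ ih => simp only [flowTerm, ih]
  | add_assoc a b c => simp only [flowTerm, add_assoc]
  | add_comm a b => exact add_comm _ _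
  | zero_add a => exact zero_add _
  | neg_add a => simp only [flowTerm]; module
  | one_smul a => exact one_smul _ _
  | mul_smul c d a => exact mul_smul _ _ _
  | add_smul c d a => exact add_smul _ _ _
  | zero_smul a => exact zero_smul _ _
  | smul_add c a b => exact smul_add _ _ _
  | smul_zero c => exact smul_zero _
  | mul_assoc a b c =>
    cases s <;> simp only [flowTerm, twist, mk_mul, cond_true, cond_false, LinearMap.id_apply, hpm,
      add_mul, mul_add, mul_assoc, add_assoc]
  | left_distrib a b c => simp only [flowTerm, mk_add, mul_add]; abel
  | right_distrib a b c => simp only [flowTerm, mk_add, map_add, add_mul]; abel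
  | zero_mul a => simp only [flowTerm, mk_zero, map_zero, zero_mul, add_zero]
  | mul_zero a => simp only [flowTerm, mk_zero, mul_zero, add_zero]
  | smul_mul c a b => simp only [flowTerm, mk_smul, map_smul, smul_mul_assoc, smul_add]
  | mul_smul' c a b => simp only [flowTerm, mk_smul, mul_smul_comm, smul_add]
  | par_Φ => simp only [flowTerm, hu, smul_smul, hs, one_smul]
  | par_Ψ => simp only [flowTerm, hv, smul_smul, hs, one_smul]
  | par_add a b => simp only [flowTerm, map_add, smul_add]
  | par_smul c a => simp only [flowTerm, map_smul]; exact smul_comm _ _ _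
  | par_par a => simp only [flowTerm, map_zsmul, hpp, smul_smul, hs, one_smul]
  | par_mul a b =>
    cases s <;> simp only [flowTerm, twist, mk_par, cond_true, cond_false, LinearMap.id_apply, hpm,
      map_add, smul_add, smul_mul_assoc, mul_smul_comm]
  | even_comm a b h ih =>
    have ha : par 𝕜 (mk a) = mk a := sound h
    cases s
    · simp only [flowTerm, sgn, cond_false, one_smul] at ih
      simp only [flowTerm, twist, cond_false, LinearMap.id_apply]
      rw [SuperfieldAlgebra.even_comm (𝕜 := 𝕜) _ (mk b) ih,
        SuperfieldAlgebra.even_comm (𝕜 := 𝕜) _ (flowTerm _ u v b) ha, add_comm]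
    · simp only [flowTerm, sgn, cond_true, neg_one_smul] at ih
      simp only [flowTerm, twist, cond_true, ha]
      -- Here the derivative of the even a is odd while b need not be homogeneous, so the graded
      -- commutation `odd_mul` is required.
      rw [odd_mul (neg_eq_iff_eq_neg.1 ih) (mk b),
        SuperfieldAlgebra.even_comm (𝕜 := 𝕜) _ (flowTerm _ u v b) ha, add_comm]
  | odd_comm a b h h' ih ih' =>
    have ha : par 𝕜 (mk a) = -mk a := sound h
    have hb : par 𝕜 (mk b) = -mk b := sound h'
    cases s
    · simp only [flowTerm, sgn, cond_false, one_smul, neg_smul] at ih ih'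
      simp only [flowTerm, twist, cond_false, LinearMap.id_apply]
      rw [SuperfieldAlgebra.odd_comm (𝕜 := 𝕜) _ (mk b) ih hb,
        SuperfieldAlgebra.odd_comm (𝕜 := 𝕜) (mk a) (flowTerm _ u v b) ha ih']
      module
    · simp only [flowTerm, sgn, cond_true, one_smul, neg_smul, neg_inj] at ih ih'
      simp only [flowTerm, twist, cond_true, ha, hb]
      rw [SuperfieldAlgebra.even_comm (𝕜 := 𝕜) _ (mk b) ih,
        SuperfieldAlgebra.even_comm (𝕜 := 𝕜) _ (mk a) ih', neg_mul, neg_mul]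
      module
  | D_add a b => simp only [flowTerm, map_add, smul_add]
  | D_smul c a => simp only [flowTerm, map_smul]; exact smul_comm _ _ _
  | Dinv_D a =>
    simp only [flowTerm, map_zsmul, LinearEquiv.symm_apply_apply, smul_smul, hs, one_smul]
  | D_Dinv a =>
    simp only [flowTerm, map_zsmul, LinearEquiv.apply_symm_apply, smul_smul, hs, one_smul]
  | par_D a => simp only [flowTerm, map_zsmul, hpD, smul_smul, hs, one_smul, neg_smul]
  | D_mul a b =>
    cases s
    · simp only [flowTerm, twist, sgn, cond_false, LinearMap.id_apply, one_smul, map_add, hDm, mk_D,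
        mk_par]
      abel
    · simp only [flowTerm, twist, sgn, cond_true, neg_one_smul, map_add, hDm, mk_D,
        mk_par, hpD, neg_mul, mul_neg, hpp]
      abel

/-- The superderivation with values `u`, `v` on the generators. -/
noncomputable def flowMap [CharZero 𝕜] {s : Bool} {u v : FreeSuperfield 𝕜}
    (hu : par 𝕜 u = sgn s • u) (hv : par 𝕜 v = sgn s • v) :
    FreeSuperfield 𝕜 →ₗ[𝕜] FreeSuperfield 𝕜 where
  toFun := Quotient.lift (flowTerm s u v) fun _ _ h => flowTerm_congr hu hv h
  map_add' x y := by
    induction x using ind; induction y using ind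
    rfl
  map_smul' c x := by
    induction x using ind
    rfl

theorem exists_evenFlow [CharZero 𝕜] {u v : FreeSuperfield 𝕜} (hu : par 𝕜 u = u)
    (hv : par 𝕜 v = v) : ∃ T : EvenFlow 𝕜 (FreeSuperfield 𝕜), T (genΦ 𝕜) = u ∧ T (genΨ 𝕜) = v := by
  refine ⟨⟨flowMap (s := false) (hu.trans (one_smul _ _).symm) (hv.trans (one_smul _ _).symm),
    fun a => ?_, fun a b => ?_, fun a => ?_⟩, rfl, rfl⟩
  · induction a using ind
    exact (one_smul ℤ _).symm
  · induction a using ind; induction b using ind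
    rfl
  · induction a using ind
    exact one_smul ℤ _

theorem exists_oddFlow [CharZero 𝕜] {u v : FreeSuperfield 𝕜} (hu : par 𝕜 u = -u)
    (hv : par 𝕜 v = -v) : ∃ δ : OddFlow 𝕜 (FreeSuperfield 𝕜), δ (genΦ 𝕜) = u ∧ δ (genΨ 𝕜) = v := by
  refine ⟨⟨flowMap (s := true) (hu.trans (neg_one_smul ℤ _).symm)
    (hv.trans (neg_one_smul ℤ _).symm), fun a => ?_, fun a b => ?_, fun a => ?_⟩, rfl, rfl⟩
  · induction a using ind
    exact neg_eq_iff_eq_neg.1 (neg_one_smul ℤ _).symm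
  · induction a using ind; induction b using ind
    rfl
  · induction a using ind
    exact neg_one_smul ℤ _

theorem flowAlgebraAt {T : ℕ → EvenFlow 𝕜 (FreeSuperfield 𝕜)}
    {δ : ℕ → OddFlow 𝕜 (FreeSuperfield 𝕜)} (hΦ : FlowAlgebraAt T δ (genΦ 𝕜))
    (hΨ : FlowAlgebraAt T δ (genΨ 𝕜)) (g : FreeSuperfield 𝕜) : FlowAlgebraAt T δ g := by
  induction g using ind with | _ a
  induction a with
  | Φ => exact hΦ
  | Ψ => exact hΨ
  | zero => exact FlowAlgebraAt.zero
  | add a b ha hb => exact ha.add hb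
  | smul c a ha => exact ha.smul c
  | mul a b ha hb => exact ha.mul hb
  | par a ha => exact ha.par
  | D a ha => exact ha.D
  | Dinv a ha => exact ha.Dinv

end FreeSuperfield
end Free

/-! ### Assembly of both halves of the proposition. -/

theorem lax_and_flowAlgebraAt {𝕜 : Type u} {A : Type v} [Field 𝕜] [NonUnitalRing A] [Module 𝕜 A]
    [IsScalarTower 𝕜 A A] [SMulCommClass 𝕜 A A] [SuperfieldAlgebra 𝕜 A] {Φ Ψ : A}
    (hΦ : par 𝕜 Φ = Φ) (hΨ : par 𝕜 Ψ = Ψ) {T : ℕ → EvenFlow 𝕜 A} {δ : ℕ → OddFlow 𝕜 A}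
    (hT : ∀ l, 1 ≤ l → EvenPair 𝕜 Φ Ψ l (T l)) (hδ : ∀ n, 1 ≤ n → OddPair 𝕜 Φ Ψ n (δ n)) :
    (∀ l, 1 ≤ l → EvenLax 𝕜 Φ Ψ l (T l)) ∧ (∀ n, 1 ≤ n → OddLax 𝕜 Φ Ψ n (δ n)) ∧
      FlowAlgebraAt T δ Φ ∧ FlowAlgebraAt T δ Ψ ∧ FlowAlgebraAt T δ (f0 𝕜 Φ Ψ) :=
  have h := flowAlgebraAt_pair hΦ hΨ hT hδ
  ⟨fun l hl => (hT l hl).evenLax hl hΦ hΨ, fun n hn => (hδ n hn).oddLax hn hΦ hΨ, h.1, h.2,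
    h.1.f0 h.2⟩

namespace FreeSuperfield

variable {𝕜 : Type u} [Field 𝕜]

theorem par_genΦ : par 𝕜 (genΦ 𝕜) = genΦ 𝕜 := sound .par_Φ

theorem par_genΨ : par 𝕜 (genΨ 𝕜) = genΨ 𝕜 := sound .par_Ψ

/-- The condition 1 ≤ l stands inside the existential so that a flow can be chosen for every index;
the truncated l - 1 makes l = 0 a harmless default. -/
theorem exists_evenPair [CharZero 𝕜] (l : ℕ) : ∃ T : EvenFlow 𝕜 (FreeSuperfield 𝕜),
    1 ≤ l → EvenPair 𝕜 (genΦ 𝕜) (genΨ 𝕜) l T := by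
  have hs : Even (2 * (l - 1) + 1 + 1) := (even_two_mul _).add_one.add_one
  obtain ⟨T, hT⟩ := exists_evenFlow (𝕜 := 𝕜)
    ((isHomog_flowΦ (par_genΦ (𝕜 := 𝕜)) par_genΨ (2 * (l - 1) + 1)).trans
      (by rw [hs.neg_one_pow, one_smul]))
    ((isHomog_flowΨ (par_genΦ (𝕜 := 𝕜)) par_genΨ (2 * (l - 1) + 1)).trans
      (by rw [hs.neg_one_pow, one_smul]))
  exact ⟨T, fun hl => (evenPair_iff par_genΦ par_genΨ (by omega) T).2 hT⟩

theorem exists_oddPair [CharZero 𝕜] (n : ℕ) : ∃ δ : OddFlow 𝕜 (FreeSuperfield 𝕜),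
    1 ≤ n → OddPair 𝕜 (genΦ 𝕜) (genΨ 𝕜) n δ := by
  have hs : Odd (2 * (n - 1) + 1) := (even_two_mul _).add_one
  obtain ⟨δ, hδ⟩ := exists_oddFlow (𝕜 := 𝕜)
    ((isHomog_flowΦ (par_genΦ (𝕜 := 𝕜)) par_genΨ (2 * (n - 1))).trans
      (by rw [hs.neg_one_pow, neg_one_smul]))
    ((isHomog_flowΨ (par_genΦ (𝕜 := 𝕜)) par_genΨ (2 * (n - 1))).trans
      (by rw [hs.neg_one_pow, neg_one_smul]))
  exact ⟨δ, fun hn => (oddPair_iff par_genΦ par_genΨ (by omega) δ).2 hδ⟩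

end FreeSuperfield

end SKP

theorem proposition2 (𝕜 : Type*) [Field 𝕜] [CharZero 𝕜] :
    -- On the free superfield algebra the bosonic and the modified fermionic flows exist and
    -- satisfy the flow algebra everywhere.
    (∃ (T : ℕ → SKP.EvenFlow 𝕜 (SKP.FreeSuperfield 𝕜))
        (δ : ℕ → SKP.OddFlow 𝕜 (SKP.FreeSuperfield 𝕜)),
      (∀ l : ℕ, 1 ≤ l →
        SKP.EvenPair 𝕜 (SKP.FreeSuperfield.genΦ 𝕜) (SKP.FreeSuperfield.genΨ 𝕜) l (T l) ∧
        SKP.EvenLax 𝕜 (SKP.FreeSuperfield.genΦ 𝕜) (SKP.FreeSuperfield.genΨ 𝕜) l (T l)) ∧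
      (∀ n : ℕ, 1 ≤ n →
        SKP.OddPair 𝕜 (SKP.FreeSuperfield.genΦ 𝕜) (SKP.FreeSuperfield.genΨ 𝕜) n (δ n) ∧
        SKP.OddLax 𝕜 (SKP.FreeSuperfield.genΦ 𝕜) (SKP.FreeSuperfield.genΨ 𝕜) n (δ n)) ∧
      (∀ g : SKP.FreeSuperfield 𝕜, SKP.FlowAlgebraAt T δ g)) ∧
    -- On every superfield algebra, flows with the given action on the pair `Φ₀`, `Ψ₀` satisfy the
    -- Lax equations and the flow algebra on all the fields of the hierarchy.
    (∀ (A : Type*) [NonUnitalRing A] [Module 𝕜 A] [IsScalarTower 𝕜 A A] [SMulCommClass 𝕜 A A]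
        [SKP.SuperfieldAlgebra 𝕜 A] (Φ Ψ : A),
      SKP.par 𝕜 Φ = Φ → SKP.par 𝕜 Ψ = Ψ →
      ∀ (T : ℕ → SKP.EvenFlow 𝕜 A) (δ : ℕ → SKP.OddFlow 𝕜 A),
        (∀ l : ℕ, 1 ≤ l → SKP.EvenPair 𝕜 Φ Ψ l (T l)) →
        (∀ n : ℕ, 1 ≤ n → SKP.OddPair 𝕜 Φ Ψ n (δ n)) →
        (∀ l : ℕ, 1 ≤ l → SKP.EvenLax 𝕜 Φ Ψ l (T l)) ∧
        (∀ n : ℕ, 1 ≤ n → SKP.OddLax 𝕜 Φ Ψ n (δ n)) ∧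
        SKP.FlowAlgebraAt T δ Φ ∧ SKP.FlowAlgebraAt T δ Ψ ∧
        SKP.FlowAlgebraAt T δ (SKP.f0 𝕜 Φ Ψ)) := by
  refine ⟨?_, fun A _ _ _ _ _ Φ Ψ hΦ hΨ T δ hT hδ => SKP.lax_and_flowAlgebraAt hΦ hΨ hT hδ⟩
  choose T hT using SKP.FreeSuperfield.exists_evenPair (𝕜 := 𝕜)
  choose δ hδ using SKP.FreeSuperfield.exists_oddPair (𝕜 := 𝕜)
  obtain ⟨hT', hδ', hΦ, hΨ, -⟩ := SKP.lax_and_flowAlgebraAt SKP.FreeSuperfield.par_genΦ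
    SKP.FreeSuperfield.par_genΨ hT hδ
  exact ⟨T, δ, fun l hl => ⟨hT l hl, hT' l hl⟩, fun n hn => ⟨hδ n hn, hδ' n hn⟩,
    SKP.FreeSuperfield.flowAlgebraAt hΦ hΨ⟩
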